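/- Let $M$ be a symmetric integer $n\times n$ matrix whose entries lie in $[-n,n]$, and let $a$ be (the index of) one of its columns. Let $e_a$ be the corresponding standard basis vector of $\mathbb R^n$, and let the eigenvalue support $\Theta_a$ of $a$ be the set of those eigenvalues $\theta$ of $M$ for which the orthogonal projection of $e_a$ onto the eigenspace of $\theta$ is not zero. Consider the following condition. (b) There are a square-free integer $\Delta>0$ and an integer $p$ such that every $\theta\in\Theta_a$ is of the form $\theta=\tfrac12\,(p+q\sqrt\Delta)$ for some integer $q$ (which may depend on $\theta$). Then there is an algorithm that, given $n$, $M$ and $a$, decides in time polynomial in $n$ whether condition (b) holds. Moreover, if (b) holds, then the algorithm also computes, still in time polynomial in $n$, the elements of $\Theta_a$ and, for each of them, a basis of the corresponding eigenspace of $M$. The output is exact: it consists of a square-free integer $\Delta>0$, an integer $p$, integers $q_0>q_1>\dots>q_k$ such that $\theta_r=\tfrac12\,(p+q_r\sqrt\Delta)$, $r=0,\dots,k$, are precisely the elements of $\Theta_a$, and, for each $r$, a basis of the eigenspace of $\theta_r$ that consists of vectors with entries of the form $u+v\sqrt\Delta$ with $u,v\in\mathbb Z$, each entry given by the pair $(u,v)$.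 (Time is measured on a random-access machine with integer registers and arrays, under logarithmic cost: every operation is charged the number of bits of the integers involved.) -/

import Mathlib

/-! ## A random-access machine with logarithmic cost

Programs are structured (sequencing, branching, while loops). The memory consists of integer registers
and of integer arrays with indirect addressing; a program names only finitely many of either.
Every operation is charged one unit plus the number of bits of all the integers that it touches
(operands, addresses, results), so that polynomial time on this machine is polynomial time on a
Turing machine. -/

namespace Ram

/-- Memory: `reg x` is the content of register `x`, and `arr k i` is cell `i` of array `k`. -/
structure Store where
  reg : ℕ → ℤ
  arr : ℕ → ℤ → ℤ

/-- Number of bits of an integer, including one for the sign. -/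
def bits (z : ℤ) : ℕ := z.natAbs.size + 1

/-- Arithmetic expressions. -/
inductive Expr where
  | const (z : ℤ)
  | reg (x : ℕ)
  | read (k : ℕ) (i : Expr)
  | add (e₁ e₂ : Expr)
  | sub (e₁ e₂ : Expr)
  | mul (e₁ e₂ : Expr)
  | div (e₁ e₂ : Expr)

/-- Value of an expression. Division is integer division, with value `0` for divisor `0`. -/
def Expr.eval (s : Store) : Expr → ℤ
  | .const z => z
  | .reg x => s.reg x
  | .read k i => s.arr k (i.eval s)
  | .add e₁ e₂ => e₁.eval s + e₂.eval s
  | .sub e₁ e₂ => e₁.eval s - e₂.eval s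
  | .mul e₁ e₂ => e₁.eval s * e₂.eval s
  | .div e₁ e₂ => e₁.eval s / e₂.eval s

/-- Time spent on evaluating an expression. At every node the bits of the value are charged, and so
the bits of the operands of each operation (and of each address) are charged at its subexpressions. -/
def Expr.cost (s : Store) : Expr → ℕ
  | .const z => 1 + bits z
  | .reg x => 1 + bits (s.reg x)
  | .read k i => i.cost s + 1 + bits (Expr.eval s (.read k i))
  | .add e₁ e₂ => e₁.cost s + e₂.cost s + 1 + bits (Expr.eval s (.add e₁ e₂))
  | .sub e₁ e₂ => e₁.cost s + e₂.cost s + 1 + bits (Expr.eval s (.sub e₁ e₂))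
  | .mul e₁ e₂ => e₁.cost s + e₂.cost s + 1 + bits (Expr.eval s (.mul e₁ e₂))
  | .div e₁ e₂ => e₁.cost s + e₂.cost s + 1 + bits (Expr.eval s (.div e₁ e₂))

/-- Programs. -/
inductive Prog where
  | skip
  | set (x : ℕ) (e : Expr)
  | write (k : ℕ) (i e : Expr)
  | seq (c₁ c₂ : Prog)
  | ifPos (e : Expr) (c₁ c₂ : Prog)
  | whilePos (e : Expr) (c : Prog)

/-- `Exec c s t s'`: started in the memory `s`, the program `c` halts after time `t` with memory `s'`. -/
inductive Exec : Prog → Store → ℕ → Store → Prop where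
  | skip (s : Store) : Exec .skip s 1 s
  | set (x : ℕ) (e : Expr) (s : Store) :
      Exec (.set x e) s (1 + e.cost s) ⟨Function.update s.reg x (e.eval s), s.arr⟩
  | write (k : ℕ) (i e : Expr) (s : Store) :
      Exec (.write k i e) s (1 + i.cost s + e.cost s)
        ⟨s.reg, Function.update s.arr k (Function.update (s.arr k) (i.eval s) (e.eval s))⟩
  | seq {c₁ c₂ : Prog} {s₁ s₂ s₃ : Store} {t₁ t₂ : ℕ} :
      Exec c₁ s₁ t₁ s₂ → Exec c₂ s₂ t₂ s₃ → Exec (.seq c₁ c₂) s₁ (t₁ + t₂) s₃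
  | ifTrue {e : Expr} {c₁ c₂ : Prog} {s s' : Store} {t : ℕ} :
      0 < e.eval s → Exec c₁ s t s' → Exec (.ifPos e c₁ c₂) s (1 + e.cost s + t) s'
  | ifFalse {e : Expr} {c₁ c₂ : Prog} {s s' : Store} {t : ℕ} :
      e.eval s ≤ 0 → Exec c₂ s t s' → Exec (.ifPos e c₁ c₂) s (1 + e.cost s + t) s'
  | whileTrue {e : Expr} {c : Prog} {s₁ s₂ s₃ : Store} {t₁ t₂ : ℕ} :
      0 < e.eval s₁ → Exec c s₁ t₁ s₂ → Exec (.whilePos e c) s₂ t₂ s₃ →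
        Exec (.whilePos e c) s₁ (1 + e.cost s₁ + t₁ + t₂) s₃
  | whileFalse {e : Expr} {c : Prog} {s : Store} :
      e.eval s ≤ 0 → Exec (.whilePos e c) s (1 + e.cost s) s

/-- The input is stored in the first cells of array `0` and its length in register `0`; everything
else is `0` at the start. -/
def initial (input : List ℤ) : Store where
  reg := Function.update 0 0 (input.length : ℤ)
  arr := Function.update 0 0 fun i => if 0 ≤ i then input.getD i.toNat 0 else 0

/-- The output is found in the first cells of array `1`, and its length in register `1`. -/
def output (s : Store) : List ℤ :=
  (List.range (s.reg 1).toNat).map fun i => s.arr 1 (i : ℤ)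

/-- On the given input the program halts with the given output; the running time, including
one unit for each cell of the output, is at most `T`. -/
def ComputesInTime (c : Prog) (input out : List ℤ) (T : ℕ) : Prop :=
  ∃ (t : ℕ) (s : Store), Exec c (initial input) t s ∧ output s = out ∧ t + out.length ≤ T

end Ram

/-! ## Eigenvalue supports and the periodicity condition -/

namespace StateTransfer

/-- The eigenspace for `θ` of an integer matrix, acting on the Euclidean space `ℝⁿ`. -/
noncomputable def eigenspace {n : ℕ} (M : Matrix (Fin n) (Fin n) ℤ) (θ : ℝ) :
    Submodule ℝ (EuclideanSpace ℝ (Fin n)) :=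
  Module.End.eigenspace (Matrix.toEuclideanLin (M.map (Int.cast : ℤ → ℝ))) θ

/-- The eigenvalue support of `a`: all `θ` such that the orthogonal projection of the standard basis
vector `e_a` onto the eigenspace for `θ` is not `0` (so `θ` is an eigenvalue). -/
def eigenvalueSupport {n : ℕ} (M : Matrix (Fin n) (Fin n) ℤ) (a : Fin n) : Set ℝ :=
  {θ | (eigenspace M θ).starProjection (EuclideanSpace.single a (1 : ℝ)) ≠ 0}

/-- The number `(p + q √Δ) / 2`. -/
noncomputable def quadValue (Δ p q : ℤ) : ℝ := ((p : ℝ) + (q : ℝ) * √(Δ : ℝ)) / 2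

/-- All eigenvalues in the support of `a` are of the form `(p + q √Δ) / 2`, with one and the same
square-free `Δ > 0` and the same integer `p`. (The eigenvalues are real; a negative `Δ` would force
`q = 0` and then `Δ = 1` does as well.) -/
def ConditionB {n : ℕ} (M : Matrix (Fin n) (Fin n) ℤ) (a : Fin n) : Prop :=
  ∃ Δ p : ℤ, 0 < Δ ∧ Squarefree Δ ∧ ∀ θ ∈ eigenvalueSupport M a, ∃ q : ℤ, θ = quadValue Δ p q

/-- The real vector with entries `u + v √Δ`, for a vector of pairs `(u, v)` of integers. -/
noncomputable def quadVector {n : ℕ} (Δ : ℤ) (x : Fin n → ℤ × ℤ) : EuclideanSpace ℝ (Fin n) :=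
  WithLp.toLp 2 fun i => ((x i).1 : ℝ) + ((x i).2 : ℝ) * √(Δ : ℝ)

/-- An exact finite description of eigenvalues `(p + q √Δ) / 2`, each of which is given by its integer
`q` and comes with a list of vectors with entries `u + v √Δ`. -/
structure SpectralData (n : ℕ) where
  Δ : ℤ
  p : ℤ
  entries : List (ℤ × List (Fin n → ℤ × ℤ))

/-- The data describe all the eigenvalues in the support of `a`, each of them once and in
decreasing order, together with a basis of the eigenspace for each of them. -/
structure SpectralData.Correct {n : ℕ} (D : SpectralData n) (M : Matrix (Fin n) (Fin n) ℤ)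
    (a : Fin n) : Prop where
  pos : 0 < D.Δ
  squarefree : Squarefree D.Δ
  decreasing : (D.entries.map fun e => quadValue D.Δ D.p e.1).Pairwise (· > ·)
  support : eigenvalueSupport M a = {θ | ∃ e ∈ D.entries, θ = quadValue D.Δ D.p e.1}
  independent : ∀ e ∈ D.entries,
    LinearIndependent ℝ fun i : Fin e.2.length => quadVector D.Δ (e.2.get i)
  span : ∀ e ∈ D.entries,
    Submodule.span ℝ (Set.range fun i : Fin e.2.length => quadVector D.Δ (e.2.get i)) =
      eigenspace M (quadValue D.Δ D.p e.1)

/-- The input `n, a, M₀₀, M₀₁, …`, with the entries of the matrix row by row. -/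
def encodeInput {n : ℕ} (M : Matrix (Fin n) (Fin n) ℤ) (a : Fin n) : List ℤ :=
  (n : ℤ) :: ((a : ℕ) : ℤ) :: (List.ofFn fun i => List.ofFn fun j => M i j).flatten

/-- A vector of pairs, written down pair by pair. -/
def encodeVector {n : ℕ} (x : Fin n → ℤ × ℤ) : List ℤ :=
  (List.ofFn x).flatMap fun z => [z.1, z.2]

/-- `Δ`, `p` and the number of eigenvalues; then, for each eigenvalue, its `q`, the number of its
eigenvectors, and these eigenvectors. -/
def SpectralData.encode {n : ℕ} (D : SpectralData n) : List ℤ :=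
  D.Δ :: D.p :: (D.entries.length : ℤ) ::
    D.entries.flatMap fun e => e.1 :: (e.2.length : ℤ) :: e.2.flatMap encodeVector

end StateTransfer

/-! Write `B = 2M - p`. Every eigenvalue satisfies `|θ| ≤ n²`, and this makes the search for `(Δ,
p)` finite (`conditionB_iff`). Suppose that `Δ > 1` and that some `θ = (p + q√Δ)/2` with `q ≠ 0`
lies in the support. The determinant of `B - q√Δ` is an element of `ℤ[√Δ]`, so the conjugate of `θ`
is an eigenvalue as well; sum and difference of the two give `|p| ≤ 2n²` and `Δ ≤ 4n⁴`. In all other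
cases `Δ = 1` will do, with a small `p`. Consequently `|q| ≤ 4n²`.

A candidate pair is tested with integers only. The inner product of the vector `∏ (B² - q²Δ) e_a`,
over `0 ≤ q ≤ 4n²`, with an eigenvector `x` for `θ` is `∏ ((2θ - p)² - q²Δ) · x_a`. As the
eigenvectors span, the vector vanishes exactly when every `θ` in the support has the required form
(`annihilate_eq_zero_iff`).

For a good pair each `q` is treated separately. The eigenspace of `θ` lies in the kernel of the
integer matrix `A = B² - q²Δ`, and `w ↦ (B + q√Δ) w` maps this kernel into the eigenspace. If `Δ >
1` and `q ≠ 0`, the `√Δ`-part of coordinate `i` of the image of an integer vector `w` is `q w_i`, so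
no nonzero coordinate of `w` is lost. If `q = 0`, then `B² w = 0` forces `B w = 0`, and `w` itself
is taken. If `Δ = 1`, then `q` is absorbed into `p`, which leads back to `q = 0`. So the machine
never computes with `√Δ`.

The kernel is handled by fraction-free Gram–Schmidt: `Q / G` is the projection onto the complement
of the processed vectors, and `G` is the Gram determinant of an independent subfamily. The division
in an update is exact because `Q = G - Rᵀ adj(RRᵀ) R` (`Valid.step_pos`). From `|Q i j| ≤ G`, and
since a step multiplies `G` by at most a squared length, numbers keep polynomially many bits. Once
the rows of `A` are processed, `Q a a > 0` says that `θ` is in the support (`gain_pos_iff`).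
Processing, for `j = 0, 1, …`, also `e_j` and row `j` of `B` leaves the kernel vectors `w` for which
`w` and `B w` vanish up to `j`. A positive diagonal entry at `j` yields an eigenvector whose first
nonzero coordinate is `j`; otherwise there is none. The result is a basis in echelon form
(`PartialBasis`).

On the machine nearly all work is done by one operation, `fillSum`, which fills an array segment
with sums of an expression. With values of `O(n³)` bits and loops of polynomial length, the running
time is a polynomial number of `timeUnit`s (`decisionProg_spec`). -/

namespace Ram

infixl:65 " +ₑ " => Expr.add
infixl:65 " -ₑ " => Expr.sub
infixl:70 " *ₑ " => Expr.mul
infixl:70 " /ₑ " => Expr.div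
infixr:40 " ;; " => Prog.seq

/-! ### Sizes of values and costs of expressions -/

theorem bits_le {z : ℤ} {m : ℕ} (h : |z| ≤ 2 ^ m) : bits z ≤ m + 2 := by
  have h1 : z.natAbs < 2 ^ (m + 1) := by
    zify
    calc |z| ≤ 2 ^ m := h
      _ < 2 ^ (m + 1) := pow_lt_pow_right₀ (by norm_num) (by omega)
  have := Nat.size_le.2 h1
  unfold bits
  omega

/-- Sums are bounded like products, which is why `Expr.deg` adds up over sums and differences too.
-/
theorem two_pow_add_le {m k : ℕ} (hm : 1 ≤ m) (hk : 1 ≤ k) :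
    (2 : ℤ) ^ m + 2 ^ k ≤ 2 ^ (m + k) := by
  have h1 : (2 : ℤ) ≤ 2 ^ m := by
    calc (2 : ℤ) = 2 ^ 1 := by norm_num
      _ ≤ 2 ^ m := pow_le_pow_right₀ (by norm_num) hm
  have h2 : (2 : ℤ) ≤ 2 ^ k := by
    calc (2 : ℤ) = 2 ^ 1 := by norm_num
      _ ≤ 2 ^ k := pow_le_pow_right₀ (by norm_num) hk
  rw [pow_add]
  nlinarith

theorem abs_ediv_le (x y : ℤ) : |x / y| ≤ |x| := by
  rw [Int.abs_eq_natAbs, Int.abs_eq_natAbs]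
  exact_mod_cast Int.natAbs_ediv_le_natAbs x y

/-- Number of leaves that contribute to the magnitude of the value. -/
def Expr.deg : Expr → ℕ
  | .const _ => 1
  | .reg _ => 1
  | .read _ _ => 1
  | .add e₁ e₂ => e₁.deg + e₂.deg
  | .sub e₁ e₂ => e₁.deg + e₂.deg
  | .mul e₁ e₂ => e₁.deg + e₂.deg
  | .div e₁ _ => e₁.deg

/-- Cost factor of an expression. -/
def Expr.weight : Expr → ℕ
  | .const _ => 1
  | .reg _ => 1
  | .read _ i => i.weight + 1
  | .add e₁ e₂ => e₁.weight + e₂.weight + (e₁.deg + e₂.deg)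
  | .sub e₁ e₂ => e₁.weight + e₂.weight + (e₁.deg + e₂.deg)
  | .mul e₁ e₂ => e₁.weight + e₂.weight + (e₁.deg + e₂.deg)
  | .div e₁ e₂ => e₁.weight + e₂.weight + e₁.deg

/-- All constants, registers and cells read by the expression are bounded by `2 ^ b`. -/
def Expr.Leaves (b : ℕ) (s : Store) : Expr → Prop
  | .const z => |z| ≤ 2 ^ b
  | .reg x => |s.reg x| ≤ 2 ^ b
  | .read k i => i.Leaves b s ∧ |s.arr k (i.eval s)| ≤ 2 ^ b
  | .add e₁ e₂ => e₁.Leaves b s ∧ e₂.Leaves b s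
  | .sub e₁ e₂ => e₁.Leaves b s ∧ e₂.Leaves b s
  | .mul e₁ e₂ => e₁.Leaves b s ∧ e₂.Leaves b s
  | .div e₁ e₂ => e₁.Leaves b s ∧ e₂.Leaves b s

/-- All constants of the expression are bounded by `8`. -/
def Expr.SmallConsts : Expr → Prop
  | .const z => |z| ≤ 8
  | .reg _ => True
  | .read _ i => i.SmallConsts
  | .add e₁ e₂ => e₁.SmallConsts ∧ e₂.SmallConsts
  | .sub e₁ e₂ => e₁.SmallConsts ∧ e₂.SmallConsts
  | .mul e₁ e₂ => e₁.SmallConsts ∧ e₂.SmallConsts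
  | .div e₁ e₂ => e₁.SmallConsts ∧ e₂.SmallConsts

/-- The expression uses neither register `y` nor array `k`. -/
def Expr.Avoids (y k : ℕ) : Expr → Prop
  | .const _ => True
  | .reg x => x ≠ y
  | .read k' i => k' ≠ k ∧ i.Avoids y k
  | .add e₁ e₂ => e₁.Avoids y k ∧ e₂.Avoids y k
  | .sub e₁ e₂ => e₁.Avoids y k ∧ e₂.Avoids y k
  | .mul e₁ e₂ => e₁.Avoids y k ∧ e₂.Avoids y k
  | .div e₁ e₂ => e₁.Avoids y k ∧ e₂.Avoids y k

theorem Expr.deg_pos (e : Expr) : 1 ≤ e.deg := by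
  induction e <;> simp only [Expr.deg] <;> omega

theorem Expr.abs_eval_le {b : ℕ} (hb : 1 ≤ b) {s : Store} {e : Expr} (h : e.Leaves b s) :
    |e.eval s| ≤ 2 ^ (e.deg * b) := by
  induction e with
  | const z => simpa [Expr.deg, Expr.eval, Expr.Leaves] using h
  | reg x => simpa [Expr.deg, Expr.eval, Expr.Leaves] using h
  | read k i ih => simpa [Expr.deg, Expr.eval] using h.2
  | add e₁ e₂ ih₁ ih₂ =>
    simp only [Expr.eval, Expr.deg, add_mul]
    exact (abs_add_le _ _).trans ((add_le_add (ih₁ h.1) (ih₂ h.2)).trans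
      (two_pow_add_le (Nat.mul_pos e₁.deg_pos hb) (Nat.mul_pos e₂.deg_pos hb)))
  | sub e₁ e₂ ih₁ ih₂ =>
    simp only [Expr.eval, Expr.deg, add_mul]
    exact (abs_sub _ _).trans ((add_le_add (ih₁ h.1) (ih₂ h.2)).trans
      (two_pow_add_le (Nat.mul_pos e₁.deg_pos hb) (Nat.mul_pos e₂.deg_pos hb)))
  | mul e₁ e₂ ih₁ ih₂ =>
    simp only [Expr.eval, Expr.deg, add_mul, pow_add, abs_mul]
    exact mul_le_mul (ih₁ h.1) (ih₂ h.2) (abs_nonneg _) (by positivity)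
  | div e₁ e₂ ih₁ ih₂ =>
    simp only [Expr.eval, Expr.deg]
    exact (abs_ediv_le _ _).trans (ih₁ h.1)

/-- A node of degree `d` has a value of at most `d * b + 2` bits, and together with the unit charge
this is at most `d * (b + 3)`; `weight` adds up these degrees. -/
theorem Expr.cost_le {b : ℕ} (hb : 1 ≤ b) {s : Store} {e : Expr} (h : e.Leaves b s) :
    e.cost s ≤ e.weight * (b + 3) := by
  induction e with
  | const z =>
    have := bits_le h
    simp only [Expr.cost, Expr.weight]; omega
  | reg x =>
    have := bits_le h
    simp only [Expr.cost, Expr.weight]; omega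
  | read k i ih =>
    have := bits_le h.2
    have h1 := ih h.1
    simp only [Expr.cost, Expr.weight, Expr.eval, add_mul]; omega
  | add e₁ e₂ ih₁ ih₂ =>
    have h0 := bits_le (Expr.abs_eval_le hb (e := .add e₁ e₂) h)
    have h1 := ih₁ h.1
    have h2 := ih₂ h.2
    have := e₁.deg_pos
    simp only [Expr.cost, Expr.weight, Expr.deg] at h0 ⊢
    nlinarith
  | sub e₁ e₂ ih₁ ih₂ =>
    have h0 := bits_le (Expr.abs_eval_le hb (e := .sub e₁ e₂) h)
    have h1 := ih₁ h.1
    have h2 := ih₂ h.2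
    have := e₁.deg_pos
    simp only [Expr.cost, Expr.weight, Expr.deg] at h0 ⊢
    nlinarith
  | mul e₁ e₂ ih₁ ih₂ =>
    have h0 := bits_le (Expr.abs_eval_le hb (e := .mul e₁ e₂) h)
    have h1 := ih₁ h.1
    have h2 := ih₂ h.2
    have := e₁.deg_pos
    simp only [Expr.cost, Expr.weight, Expr.deg] at h0 ⊢
    nlinarith
  | div e₁ e₂ ih₁ ih₂ =>
    have h0 := bits_le (Expr.abs_eval_le hb (e := .div e₁ e₂) h)
    have h1 := ih₁ h.1
    have h2 := ih₂ h.2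
    have := e₁.deg_pos
    simp only [Expr.cost, Expr.weight, Expr.deg] at h0 ⊢
    nlinarith

/-- Needed for loops: while an accumulator register and a target array change, the summand keeps the
value that it has in the initial store. -/
theorem Expr.eval_congr {y k : ℕ} {e : Expr} (he : e.Avoids y k) {s s' : Store}
    (hr : ∀ x, x ≠ y → s.reg x = s'.reg x) (ha : ∀ j, j ≠ k → s.arr j = s'.arr j) :
    e.eval s = e.eval s' := by
  induction e with
  | const z => rfl
  | reg x => exact hr x he
  | read j i ih => simp only [Expr.eval]; rw [ih he.2, ha j he.1]
  | add e₁ e₂ ih₁ ih₂ => simp only [Expr.eval]; rw [ih₁ he.1, ih₂ he.2]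
  | sub e₁ e₂ ih₁ ih₂ => simp only [Expr.eval]; rw [ih₁ he.1, ih₂ he.2]
  | mul e₁ e₂ ih₁ ih₂ => simp only [Expr.eval]; rw [ih₁ he.1, ih₂ he.2]
  | div e₁ e₂ ih₁ ih₂ => simp only [Expr.eval]; rw [ih₁ he.1, ih₂ he.2]

/-! ### Bounded memory -/

/-- All registers and cells are bounded by `2 ^ b`. -/
structure Store.Bdd (b : ℕ) (s : Store) : Prop where
  reg : ∀ x, |s.reg x| ≤ 2 ^ b
  arr : ∀ k i, |s.arr k i| ≤ 2 ^ b

/-- Assignment to a register. -/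
def Store.setReg (s : Store) (x : ℕ) (v : ℤ) : Store := ⟨Function.update s.reg x v, s.arr⟩

/-- Replacement of an array. -/
def Store.setArr (s : Store) (k : ℕ) (f : ℤ → ℤ) : Store := ⟨s.reg, Function.update s.arr k f⟩

@[simp] theorem Store.setReg_reg (s : Store) (x : ℕ) (v : ℤ) (y : ℕ) :
    (s.setReg x v).reg y = if y = x then v else s.reg y := by
  simp [Store.setReg, Function.update_apply]

@[simp] theorem Store.setReg_arr (s : Store) (x : ℕ) (v : ℤ) : (s.setReg x v).arr = s.arr := rfl

@[simp] theorem Store.setArr_reg (s : Store) (k : ℕ) (f : ℤ → ℤ) : (s.setArr k f).reg = s.reg := rfl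

@[simp] theorem Store.setArr_arr (s : Store) (k : ℕ) (f : ℤ → ℤ) (j : ℕ) :
    (s.setArr k f).arr j = if j = k then f else s.arr j := by
  simp [Store.setArr, Function.update_apply]

theorem Store.Bdd.setReg {b : ℕ} {s : Store} (h : s.Bdd b) (x : ℕ) {v : ℤ} (hv : |v| ≤ 2 ^ b) :
    (s.setReg x v).Bdd b := by
  refine ⟨fun y => ?_, h.arr⟩
  rw [Store.setReg_reg]
  split_ifs
  exacts [hv, h.reg y]

theorem Store.Bdd.setArr {b : ℕ} {s : Store} (h : s.Bdd b) (k : ℕ) {f : ℤ → ℤ}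
    (hf : ∀ i, |f i| ≤ 2 ^ b) : (s.setArr k f).Bdd b := by
  refine ⟨h.reg, fun j i => ?_⟩
  rw [Store.setArr_arr]
  split_ifs
  exacts [hf i, h.arr j i]

theorem Store.Bdd.leaves {b : ℕ} (hb : 3 ≤ b) {s : Store} (h : s.Bdd b) {e : Expr}
    (he : e.SmallConsts) : e.Leaves b s := by
  induction e with
  | const z =>
    refine le_trans he ?_
    calc (8 : ℤ) = 2 ^ 3 := by norm_num
      _ ≤ 2 ^ b := pow_le_pow_right₀ (by norm_num) hb
  | reg x => exact h.reg x
  | read k i ih => exact ⟨ih he, h.arr k _⟩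
  | add e₁ e₂ ih₁ ih₂ => exact ⟨ih₁ he.1, ih₂ he.2⟩
  | sub e₁ e₂ ih₁ ih₂ => exact ⟨ih₁ he.1, ih₂ he.2⟩
  | mul e₁ e₂ ih₁ ih₂ => exact ⟨ih₁ he.1, ih₂ he.2⟩
  | div e₁ e₂ ih₁ ih₂ => exact ⟨ih₁ he.1, ih₂ he.2⟩

theorem Store.Bdd.cost_le {b : ℕ} (hb : 3 ≤ b) {s : Store} (h : s.Bdd b) {e : Expr}
    (he : e.SmallConsts) : e.cost s ≤ e.weight * (b + 3) :=
  Expr.cost_le (by omega) (h.leaves hb he)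

/-! ### Runs with a time bound -/

/-- The program takes the first store to the second one in time at most `T`. -/
def Run (c : Prog) (s : Store) (T : ℕ) (s' : Store) : Prop := ∃ t, Exec c s t s' ∧ t ≤ T

theorem Run.mono {c : Prog} {s s' : Store} {T T' : ℕ} (h : Run c s T s') (hT : T ≤ T') :
    Run c s T' s' := by
  obtain ⟨t, h1, h2⟩ := h
  exact ⟨t, h1, h2.trans hT⟩

theorem Run.seq {c₁ c₂ : Prog} {s₁ s₂ s₃ : Store} {T₁ T₂ : ℕ} (h₁ : Run c₁ s₁ T₁ s₂)
    (h₂ : Run c₂ s₂ T₂ s₃) : Run (.seq c₁ c₂) s₁ (T₁ + T₂) s₃ := by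
  obtain ⟨t₁, h1, h2⟩ := h₁
  obtain ⟨t₂, h3, h4⟩ := h₂
  exact ⟨_, .seq h1 h3, add_le_add h2 h4⟩

section
variable {b : ℕ} (hb : 3 ≤ b) {s : Store} (hs : s.Bdd b)
include hb hs

theorem Run.set (x : ℕ) {e : Expr} (he : e.SmallConsts) :
    Run (.set x e) s ((e.weight + 1) * (b + 3)) (s.setReg x (e.eval s)) := by
  refine ⟨_, .set x e s, ?_⟩
  have := hs.cost_le hb he
  rw [add_mul]
  omega

theorem Run.write (k : ℕ) {i e : Expr} (hi : i.SmallConsts) (he : e.SmallConsts) :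
    Run (.write k i e) s ((i.weight + e.weight + 1) * (b + 3))
      (s.setArr k (Function.update (s.arr k) (i.eval s) (e.eval s))) := by
  refine ⟨_, .write k i e s, ?_⟩
  have := hs.cost_le hb he
  have := hs.cost_le hb hi
  rw [add_mul, add_mul]
  omega

theorem Run.ifPos {e : Expr} (he : e.SmallConsts) {c₁ c₂ : Prog} {T : ℕ} {s' : Store}
    (h₁ : 0 < e.eval s → Run c₁ s T s') (h₂ : e.eval s ≤ 0 → Run c₂ s T s') :
    Run (.ifPos e c₁ c₂) s ((e.weight + 1) * (b + 3) + T) s' := by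
  have hc := hs.cost_le hb he
  by_cases h : 0 < e.eval s
  · obtain ⟨t, h3, h4⟩ := h₁ h
    refine ⟨_, .ifTrue h h3, ?_⟩
    rw [add_mul]; omega
  · obtain ⟨t, h3, h4⟩ := h₂ (not_lt.1 h)
    refine ⟨_, .ifFalse (not_lt.1 h) h3, ?_⟩
    rw [add_mul]; omega

end

/-- Count register `x` from `0` up to the content of register `N`. -/
def forLoop (x N : ℕ) (c : Prog) : Prog :=
  .set x (.const 0) ;; .whilePos (.reg N -ₑ .reg x) (c ;; .set x (.reg x +ₑ .const 1))

/-- Induction on the number of rounds left. The loop test and the increment cost at most `5 * (b +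
3)` each; the final failing test accounts for the last summand. The invariant is required again only
after the increment. -/
theorem whilePos_spec {b : ℕ} (hb : 3 ≤ b) {x N : ℕ} {c : Prog} {T : ℕ} {m : ℕ}
    (I : ℕ → Store → Prop)
    (hI : ∀ k s, I k s → s.Bdd b ∧ s.reg x = k ∧ s.reg N = m)
    (hbody : ∀ k s, k < m → I k s → ∃ s', Run c s T s' ∧ s'.Bdd b ∧ s'.reg x = k ∧
      I (k + 1) (s'.setReg x (k + 1 : ℤ)))
    {k : ℕ} {s : Store} (hk : k ≤ m) (h : I k s) :
    ∃ s', Run (.whilePos (.reg N -ₑ .reg x) (c ;; .set x (.reg x +ₑ .const 1))) s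
      ((m - k) * (T + 10 * (b + 3)) + 5 * (b + 3)) s' ∧ I m s' := by
  obtain ⟨d, hd⟩ : ∃ d, m - k = d := ⟨_, rfl⟩
  induction d generalizing k s with
  | zero =>
    obtain rfl : k = m := by omega
    obtain ⟨h1, h2, h3⟩ := hI k s h
    refine ⟨s, ⟨_, .whileFalse ?_, ?_⟩, h⟩
    · simp [Expr.eval, h2, h3]
    · have := h1.cost_le hb (e := .reg N -ₑ .reg x) (by simp [Expr.SmallConsts])
      simp only [Expr.weight, Expr.deg] at this
      omega
  | succ d ih =>
    obtain ⟨h1, h2, h3⟩ := hI k s h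
    obtain ⟨s₁, ⟨t₁, h4, h4'⟩, h5, h6, h7⟩ := hbody k s (by omega) h
    obtain ⟨s₂, ⟨t₂, h8, h8'⟩, h9⟩ := ih (by omega) h7 (by omega)
    obtain ⟨t₃, h10, h10'⟩ := Run.set hb h5 x (e := .reg x +ₑ .const 1) (by simp [Expr.SmallConsts])
    have h11 : (Expr.reg x +ₑ Expr.const 1).eval s₁ = (k + 1 : ℤ) := by simp [Expr.eval, h6]
    rw [h11] at h10
    refine ⟨s₂, ⟨_, .whileTrue ?_ (.seq h4 h10) h8, ?_⟩, h9⟩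
    · simp only [Expr.eval, h2, h3]; omega
    · have := h1.cost_le hb (e := .reg N -ₑ .reg x) (by simp [Expr.SmallConsts])
      simp only [Expr.weight, Expr.deg] at this h10'
      have e1 : m - k = (m - (k + 1)) + 1 := by omega
      rw [e1, add_mul]
      omega

theorem forLoop_spec {b : ℕ} (hb : 3 ≤ b) {x N : ℕ} {c : Prog} {T : ℕ} {m : ℕ}
    (I : ℕ → Store → Prop)
    (hI : ∀ k s, I k s → s.Bdd b ∧ s.reg x = k ∧ s.reg N = m)
    (hbody : ∀ k s, k < m → I k s → ∃ s', Run c s T s' ∧ s'.Bdd b ∧ s'.reg x = k ∧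
      I (k + 1) (s'.setReg x (k + 1 : ℤ)))
    {s : Store} (hs : s.Bdd b) (h : I 0 (s.setReg x 0)) :
    ∃ s', Run (forLoop x N c) s ((m + 1) * (T + 10 * (b + 3))) s' ∧ I m s' := by
  obtain ⟨s', h1, h2⟩ := whilePos_spec hb I hI hbody (Nat.zero_le m) h
  refine ⟨s', ((Run.set hb hs x (e := .const 0) (by simp [Expr.SmallConsts])).seq h1).mono ?_, h2⟩
  simp only [Expr.weight, add_mul, Nat.sub_zero]
  omega

end Ram

/-! ### The basic operation: filling an array segment with sums -/

namespace Ram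

theorem Store.ext_of {s s' : Store} (hr : ∀ x, s.reg x = s'.reg x) (ha : ∀ k, s.arr k = s'.arr k) :
    s = s' := by
  obtain ⟨r, a⟩ := s
  obtain ⟨r', a'⟩ := s'
  obtain rfl : r = r' := funext hr
  obtain rfl : a = a' := funext ha
  rfl

/-- Cell `O + i` of array `k` becomes the sum of `e` over `j < L`, for each `i < N`; here `O`, `N`, `L`
are registers, and `e` finds `i` in register `20` and `j` in register `22`. -/
def fillSum (k O N L : ℕ) (e : Expr) : Prog :=
  forLoop 20 N (.set 21 (.const 0) ;; forLoop 22 L (.set 21 (.reg 21 +ₑ e)) ;;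
    .write k (.reg O +ₑ .reg 20) (.reg 21)) ;;
  .set 20 (.const 0) ;; .set 21 (.const 0) ;; .set 22 (.const 0)

/-- The sum computed for a cell by `fillSum`. -/
def sumAt (s : Store) (l : ℕ) (e : Expr) (i : ℤ) : ℤ :=
  ∑ j ∈ Finset.range l, e.eval ((s.setReg 20 i).setReg 22 j)

/-- The array written by `fillSum`. -/
def filled (s : Store) (k : ℕ) (o : ℤ) (m l : ℕ) (e : Expr) : ℤ → ℤ := fun c =>
  if o ≤ c ∧ c < o + m then sumAt s l e (c - o) else s.arr k c

theorem abs_sum_eval_le {b : ℕ} (hb : 1 ≤ b) {s : Store} {l : ℕ} {e : Expr} {i : ℤ}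
    (h : ∀ j < l, e.Leaves b ((s.setReg 20 i).setReg 22 j)) :
    |sumAt s l e i| ≤ l * 2 ^ (e.deg * b) := by
  refine (Finset.abs_sum_le_sum_abs _ _).trans ?_
  refine (Finset.sum_le_sum fun j hj => Expr.abs_eval_le hb (h j (Finset.mem_range.1 hj))).trans ?_
  simp

/-- The number of summands contributes one more factor `2 ^ b`, hence the `deg + 1` in all later
size estimates. -/
theorem abs_sumAt_le {b : ℕ} (hb : 1 ≤ b) {s : Store} {l : ℕ} (hl : (l : ℤ) ≤ 2 ^ b) {e : Expr}
    {i : ℤ} (h : ∀ j < l, e.Leaves b ((s.setReg 20 i).setReg 22 j)) :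
    |sumAt s l e i| ≤ 2 ^ ((e.deg + 1) * b) := by
  refine (abs_sum_eval_le hb h).trans ?_
  rw [add_mul, one_mul, pow_add, mul_comm]
  exact mul_le_mul_of_nonneg_left hl (by positivity)

theorem pow_two_mono {m k : ℕ} (h : m ≤ k) : (2 : ℤ) ^ m ≤ 2 ^ k :=
  pow_le_pow_right₀ (by norm_num) h

section
variable {b B : ℕ} (hb : 3 ≤ b) {k O N L : ℕ} {e : Expr} {s : Store} {m l : ℕ}

theorem Store.Bdd.filled (hb : 3 ≤ b) (hs : s.Bdd B) (hl : (l : ℤ) ≤ 2 ^ b)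
    (hbB : (e.deg + 1) * b ≤ B)
    (h : ∀ i < m, ∀ j < l, e.Leaves b ((s.setReg 20 (i : ℤ)).setReg 22 j)) (o : ℤ) :
    (s.setArr k (filled s k o m l e)).Bdd B := by
  refine hs.setArr _ fun c => ?_
  unfold Ram.filled
  split_ifs with hc
  · have hi := h (c - o).toNat (by omega)
    rw [Int.toNat_of_nonneg (by omega)] at hi
    exact (abs_sumAt_le (by omega) hl hi).trans (pow_two_mono hbB)
  · exact hs.arr _ _

/-- The invariant is that register `21` holds the partial sum. The target array `f` and the old
counter `z` are arbitrary, since earlier rounds of the outer loop have changed them. -/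
theorem fillSum_inner (hb : 3 ≤ b) (hs : s.Bdd B) (hL : s.reg L = l)
    (hL' : L ≠ 20 ∧ L ≠ 21 ∧ L ≠ 22) (hav : e.Avoids 21 k)
    (hc : e.SmallConsts) (hl : (l : ℤ) ≤ 2 ^ b) (hbB : (e.deg + 1) * b ≤ B) {i : ℕ}
    (hi : (i : ℤ) ≤ 2 ^ B)
    (h : ∀ j < l, e.Leaves b ((s.setReg 20 (i : ℤ)).setReg 22 j))
    {f : ℤ → ℤ} (hf : ∀ c, |f c| ≤ 2 ^ B) {z : ℤ} (hz : |z| ≤ 2 ^ B) :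
    Run (forLoop 22 L (.set 21 (.reg 21 +ₑ e)))
      ((((s.setReg 20 i).setReg 21 0).setReg 22 z).setArr k f)
      ((l + 1) * ((e.weight + 13 + e.deg) * (B + 3)))
      ((((s.setReg 20 i).setReg 21 (sumAt s l e i)).setReg 22 l).setArr k f) := by
  have hB : 3 ≤ B := hb.trans (le_trans (by nlinarith [e.deg_pos]) hbB)
  have hpart : ∀ j, j ≤ l → |sumAt s j e i| ≤ 2 ^ B := fun j hj =>
    (abs_sumAt_le (by omega) ((Int.ofNat_le.2 hj).trans hl)
      fun j' hj' => h j' (by omega)).trans (pow_two_mono hbB)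
  have hlB : (l : ℤ) ≤ 2 ^ B := hL ▸ (le_abs_self _).trans (hs.reg L)
  have hbdd : ∀ j, j ≤ l →
      ((((s.setReg 20 (i : ℤ)).setReg 21 (sumAt s j e i)).setReg 22 (j : ℤ)).setArr k f).Bdd B := by
    intro j hj
    refine (((hs.setReg 20 (by simpa using hi)).setReg 21 (hpart j hj)).setReg 22 ?_).setArr k hf
    rw [Nat.abs_cast]
    exact (Int.ofNat_le.2 hj).trans hlB
  have hstart : ((((s.setReg 20 (i : ℤ)).setReg 21 0).setReg 22 z).setArr k f).Bdd B :=
    (((hs.setReg 20 (by simpa using hi)).setReg 21 (by simp)).setReg 22 hz).setArr k hf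
  refine Exists.elim (forLoop_spec hB (T := (e.weight + 3 + e.deg) * (B + 3)) (m := l)
    (fun j s' => s' = ((((s.setReg 20 (i : ℤ)).setReg 21 (sumAt s j e i)).setReg 22
      (j : ℤ)).setArr k f) ∧ j ≤ l) (x := 22) (N := L) (c := .set 21 (.reg 21 +ₑ e)) ?_ ?_ hstart ?_) ?_
  · rintro j s' ⟨rfl, hj⟩
    exact ⟨hbdd j hj, by simp, by simp [hL'.1, hL'.2.1, hL'.2.2, hL]⟩
  · rintro j s' hj ⟨rfl, -⟩
    have hR := Run.set hB (hbdd j hj.le) 21 (e := .reg 21 +ₑ e)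
      (by simp [Expr.SmallConsts, hc])
    have hv : (Expr.reg 21 +ₑ e).eval
        ((((s.setReg 20 (i : ℤ)).setReg 21 (sumAt s j e i)).setReg 22 (j : ℤ)).setArr k f) =
        sumAt s (j + 1) e i := by
      simp only [Expr.eval]
      rw [sumAt, sumAt, Finset.sum_range_succ]
      refine congrArg₂ (· + ·) (by simp) (Expr.eval_congr hav (fun x hx => ?_) (fun k' hk' => ?_))
      · simp [hx]
      · simp [hk']
    rw [hv] at hR
    refine ⟨_, hR.mono ?_, (hbdd j hj.le).setReg 21 (hpart _ hj), by simp, ?_, hj⟩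
    · simp only [Expr.weight, Expr.deg]
      exact Nat.mul_le_mul_right _ (by omega)
    · refine Store.ext_of (fun x => ?_) (fun k' => by simp)
      simp only [Store.setReg_reg, Store.setArr_reg]
      split_ifs <;> simp_all
  · refine ⟨Store.ext_of (fun x => ?_) (fun k' => by simp), Nat.zero_le _⟩
    simp only [Store.setReg_reg, Store.setArr_reg, sumAt]
    split_ifs <;> simp_all
  · rintro s' ⟨h1, h2, -⟩
    rw [h2] at h1
    exact h1.mono (Nat.mul_le_mul_left _ (by nlinarith))

/-- The working registers are `0` before and after, so the net effect is exactly the replacement of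
one array. -/
theorem fillSum_spec (hb : 3 ≤ b) (hs : s.Bdd B) (h20 : s.reg 20 = 0) (h21 : s.reg 21 = 0)
    (h22 : s.reg 22 = 0) (hN : s.reg N = m) (hL : s.reg L = l)
    (hO' : O ≠ 20 ∧ O ≠ 21 ∧ O ≠ 22) (hN' : N ≠ 20 ∧ N ≠ 21 ∧ N ≠ 22)
    (hL' : L ≠ 20 ∧ L ≠ 21 ∧ L ≠ 22) (hav : e.Avoids 21 k)
    (hc : e.SmallConsts) (hl : (l : ℤ) ≤ 2 ^ b) (hbB : (e.deg + 1) * b ≤ B)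
    (h : ∀ i < m, ∀ j < l, e.Leaves b ((s.setReg 20 (i : ℤ)).setReg 22 j)) :
    Run (fillSum k O N L e) s ((m + 1) * ((l + 1) * ((e.weight + e.deg + 50) * (B + 3))))
      (s.setArr k (filled s k (s.reg O) m l e)) := by
  have hB : 3 ≤ B := hb.trans (le_trans (by nlinarith [e.deg_pos]) hbB)
  have hmB : (m : ℤ) ≤ 2 ^ B := hN ▸ (le_abs_self _).trans (hs.reg N)
  have hlB : (l : ℤ) ≤ 2 ^ B := hL ▸ (le_abs_self _).trans (hs.reg L)
  have hF : ∀ i, i ≤ m → ∀ c, |filled s k (s.reg O) i l e c| ≤ 2 ^ B := by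
    intro i hi c
    have := (Store.Bdd.filled (k := k) hb hs hl hbB (fun i' hi' => h i' (lt_of_lt_of_le hi' hi))
      (s.reg O)).arr k c
    simpa using this
  refine Exists.elim (forLoop_spec hB
    (T := (l + 1) * ((e.weight + 13 + e.deg) * (B + 3)) + 8 * (B + 3)) (m := m)
    -- `y` and `z` stand for what the previous round has left in the registers `21` and `22`; only
    -- their size matters.
    (fun i s' => (∃ y z : ℤ, |y| ≤ 2 ^ B ∧ |z| ≤ 2 ^ B ∧
      s' = ((((s.setReg 20 (i : ℤ)).setReg 21 y).setReg 22 z).setArr k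
        (filled s k (s.reg O) i l e))) ∧ i ≤ m) (x := 20) (N := N)
    (c := .set 21 (.const 0) ;; forLoop 22 L (.set 21 (.reg 21 +ₑ e)) ;;
      .write k (.reg O +ₑ .reg 20) (.reg 21)) ?_ ?_ hs ?_) ?_
  · rintro i s' ⟨⟨y, z, hy, hz, rfl⟩, hi⟩
    refine ⟨(((hs.setReg 20 ?_).setReg 21 hy).setReg 22 hz).setArr k (hF i hi), by simp,
      by simp [hN', hN]⟩
    rw [Nat.abs_cast]
    exact (Int.ofNat_le.2 hi).trans hmB
  · rintro i s' hi ⟨⟨y, z, hy, hz, rfl⟩, -⟩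
    have hiB : (i : ℤ) ≤ 2 ^ B := (Int.ofNat_le.2 hi.le).trans hmB
    have hb0 : ((((s.setReg 20 (i : ℤ)).setReg 21 y).setReg 22 z).setArr k
        (filled s k (s.reg O) i l e)).Bdd B :=
      (((hs.setReg 20 (by simpa using hiB)).setReg 21 hy).setReg 22 hz).setArr k (hF i hi.le)
    have r1 := Run.set hB hb0 21 (e := .const 0) (by simp [Expr.SmallConsts])
    have e1 : (((((s.setReg 20 (i : ℤ)).setReg 21 y).setReg 22 z).setArr k
        (filled s k (s.reg O) i l e)).setReg 21 0) =
        ((((s.setReg 20 (i : ℤ)).setReg 21 0).setReg 22 z).setArr k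
        (filled s k (s.reg O) i l e)) := by
      refine Store.ext_of (fun x => ?_) (fun k' => by simp)
      simp only [Store.setReg_reg, Store.setArr_reg]
      split_ifs <;> simp_all
    simp only [Expr.eval] at r1
    rw [e1] at r1
    have r2 := fillSum_inner hb hs hL hL' hav hc hl hbB hiB (h i hi) (hF i hi.le) hz
    have hsum : |sumAt s l e i| ≤ 2 ^ B :=
      (abs_sumAt_le (by omega) hl (h i hi)).trans (pow_two_mono hbB)
    have hb2 : ((((s.setReg 20 (i : ℤ)).setReg 21 (sumAt s l e i)).setReg 22 (l : ℤ)).setArr k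
        (filled s k (s.reg O) i l e)).Bdd B :=
      (((hs.setReg 20 (by simpa using hiB)).setReg 21 hsum).setReg 22
        (by simpa using hlB)).setArr k (hF i hi.le)
    have r3 := Run.write hB hb2 k (i := .reg O +ₑ .reg 20) (e := .reg 21)
      (by simp [Expr.SmallConsts]) (by simp [Expr.SmallConsts])
    -- One write extends the filled segment from `i` to `i + 1` cells.
    have hupd : Function.update (filled s k (s.reg O) i l e) (s.reg O + i) (sumAt s l e i) =
        filled s k (s.reg O) (i + 1) l e := by
      funext c
      rw [Function.update_apply]
      unfold filled
      by_cases hce : c = s.reg O + i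
      · rw [if_pos hce, if_pos (by push_cast; omega), hce]
        congr 1; ring
      · rw [if_neg hce]
        by_cases h5 : s.reg O ≤ c ∧ c < s.reg O + i
        · rw [if_pos h5, if_pos (by push_cast; omega)]
        · rw [if_neg h5, if_neg (by push_cast; omega)]
    refine ⟨_, (r1.seq (r2.seq r3)).mono ?_, ?_, ?_, ⟨sumAt s l e i, l, hsum, by simpa using hlB, ?_⟩, hi⟩
    · simp only [Expr.weight, Expr.deg]
      omega
    · refine hb2.setArr k fun c => ?_
      have := hF (i + 1) hi c
      rw [← hupd] at this
      simpa [Expr.eval, hO'] using this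
    · simp
    · refine Store.ext_of (fun x => ?_) (fun k' => ?_)
      · simp only [Store.setReg_reg, Store.setArr_reg]
        split_ifs <;> simp_all
      · have := hupd
        by_cases hk : k' = k
        · subst hk
          simpa [Expr.eval, hO'] using this
        · simp [hk]
  · refine ⟨⟨0, 0, by simp, by simp, Store.ext_of (fun x => ?_) (fun k' => ?_)⟩, Nat.zero_le _⟩
    · simp only [Store.setReg_reg, Store.setArr_reg]
      split_ifs <;> simp_all
    · by_cases hk : k' = k
      · subst hk
        simp only [Store.setReg_arr, Store.setArr_arr, if_true]
        funext c
        unfold filled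
        rw [if_neg (by push_cast; omega)]
      · simp [hk]
  · rintro s' ⟨h1, ⟨y, z, hy, hz, h2⟩, -⟩
    subst h2
    have hb0 : ((((s.setReg 20 (m : ℤ)).setReg 21 y).setReg 22 z).setArr k
        (filled s k (s.reg O) m l e)).Bdd B :=
      (((hs.setReg 20 (by simpa using hmB)).setReg 21 hy).setReg 22 hz).setArr k (hF m le_rfl)
    have r1 := Run.set hB hb0 20 (e := .const 0) (by simp [Expr.SmallConsts])
    have hb1 := hb0.setReg 20 (v := 0) (by simp)
    have r2 := Run.set hB hb1 21 (e := .const 0) (by simp [Expr.SmallConsts])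
    have hb2 := hb1.setReg 21 (v := 0) (by simp)
    have r3 := Run.set hB hb2 22 (e := .const 0) (by simp [Expr.SmallConsts])
    have r := (h1.seq (r1.seq (r2.seq r3)))
    have heq : (((((((s.setReg 20 (m : ℤ)).setReg 21 y).setReg 22 z).setArr k
        (filled s k (s.reg O) m l e)).setReg 20 0).setReg 21 0).setReg 22 0) =
        s.setArr k (filled s k (s.reg O) m l e) := by
      refine Store.ext_of (fun x => ?_) (fun k' => by simp)
      simp only [Store.setReg_reg, Store.setArr_reg]
      split_ifs <;> simp_all
    simp only [Expr.eval] at r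
    rw [heq] at r
    refine r.mono ?_
    simp only [Expr.weight]
    have : 1 ≤ (m + 1) * (l + 1) := Nat.mul_pos (by omega) (by omega)
    have e1 : (m + 1) * ((l + 1) * ((e.weight + e.deg + 50) * (B + 3))) =
      (m + 1) * ((l + 1) * ((e.weight + 13 + e.deg) * (B + 3)) + 8 * (B + 3) + 10 * (B + 3))
        + (m + 1) * l * (18 * (B + 3)) + (m + 1) * (l + 1) * (19 * (B + 3)) := by ring
    rw [e1]
    have : 19 * (B + 3) ≤ (m + 1) * (l + 1) * (19 * (B + 3)) := Nat.le_mul_of_pos_left _ this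
    omega

end

end Ram

/-! ## Integer Gram–Schmidt orthogonalization -/

open Matrix

/-- An integer matrix and a scalar: `Q / G` is the orthogonal projection onto the orthogonal
complement of the vectors processed so far. -/
structure GramSchmidt (n : ℕ) where
  Q : Matrix (Fin n) (Fin n) ℤ
  G : ℤ

namespace GramSchmidt

variable {n : ℕ}

/-- The state before any vector has been processed. -/
def init (n : ℕ) : GramSchmidt n := ⟨1, 1⟩

/-- Squared norm of the projection of `r`, times `G`. -/
def gain (σ : GramSchmidt n) (r : Fin n → ℤ) : ℤ := r ⬝ᵥ σ.Q *ᵥ r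

/-- Process the vector `r`. -/
def step (σ : GramSchmidt n) (r : Fin n → ℤ) : GramSchmidt n :=
  if 0 < σ.gain r then
    ⟨.of fun i j => (σ.gain r * σ.Q i j - (σ.Q *ᵥ r) i * (σ.Q *ᵥ r) j) / σ.G, σ.gain r⟩
  else σ

/-- The state is the one that belongs to the set `S` of processed vectors. -/
structure Valid (σ : GramSchmidt n) (S : Set (Fin n → ℤ)) : Prop where
  pos : 0 < σ.G
  symm : σ.Qᵀ = σ.Q
  -- The rows of `R` are the processed vectors that were kept. Their Gram determinant `G` is
  -- positive, so they are independent; the last two equations say that `Q / G` is the projection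
  -- along their span onto its orthogonal complement.
  rep : ∃ (ι : Type) (_ : Fintype ι) (_ : DecidableEq ι) (R : Matrix ι (Fin n) ℤ)
    (Y : Matrix ι (Fin n) ℤ), (∀ i, R i ∈ S) ∧ (R * Rᵀ).det = σ.G ∧ R * σ.Q = 0 ∧
      σ.G • (1 : Matrix (Fin n) (Fin n) ℤ) - σ.Q = Rᵀ * Y
  kill : ∀ r ∈ S, σ.Q *ᵥ r = 0

theorem valid_init : (init n).Valid ∅ where
  pos := by simp [init]
  symm := by simp [init]
  rep := ⟨Empty, inferInstance, inferInstance, 0, 0, fun i => i.elim, by simp [init], by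
    ext i; exact i.elim, by simp [init]⟩
  kill := by simp

variable {σ : GramSchmidt n} {S : Set (Fin n → ℤ)}

/-- `Q Rᵀ = 0` by symmetry, and `G - Q = Rᵀ Y`, so `Q (G - Q) = 0`: the matrix `Q / G` is
idempotent. -/
theorem Valid.sq (h : σ.Valid S) : σ.Q * σ.Q = σ.G • σ.Q := by
  obtain ⟨ι, _, _, R, Y, -, -, h3, h4⟩ := h.rep
  have h5 : σ.Q * (σ.G • (1 : Matrix (Fin n) (Fin n) ℤ) - σ.Q) = 0 := by
    rw [h4, ← Matrix.mul_assoc]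
    have : σ.Q * Rᵀ = 0 := by
      rw [← h.symm, ← Matrix.transpose_mul, h3, Matrix.transpose_zero]
    rw [this, Matrix.zero_mul]
  rw [Matrix.mul_sub, Matrix.mul_smul, Matrix.mul_one, sub_eq_zero] at h5
  exact h5.symm

theorem Valid.dot_mulVec (h : σ.Valid S) (x y : Fin n → ℤ) :
    x ⬝ᵥ σ.Q *ᵥ y = (σ.Q *ᵥ x) ⬝ᵥ y := by
  rw [Matrix.dotProduct_mulVec, ← Matrix.mulVec_transpose, h.symm]

theorem Valid.norm_sq (h : σ.Valid S) (r : Fin n → ℤ) :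
    (σ.Q *ᵥ r) ⬝ᵥ (σ.Q *ᵥ r) = σ.G * σ.gain r := by
  rw [← h.dot_mulVec, Matrix.mulVec_mulVec, h.sq, Matrix.smul_mulVec, dotProduct_smul, gain,
    smul_eq_mul]

theorem Valid.gain_nonneg (h : σ.Valid S) (r : Fin n → ℤ) : 0 ≤ σ.gain r := by
  have h1 : 0 ≤ σ.G * σ.gain r := by
    rw [← h.norm_sq]
    exact Finset.sum_nonneg fun i _ => mul_self_nonneg _
  exact nonneg_of_mul_nonneg_right h1 h.pos

/-- The squared length of `Q r` is `G` times the gain, so a gain that is not positive means that `r`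
already lies in the span. -/
theorem Valid.mulVec_eq_zero (h : σ.Valid S) {r : Fin n → ℤ} (hr : σ.gain r ≤ 0) :
    σ.Q *ᵥ r = 0 := by
  have h1 : (σ.Q *ᵥ r) ⬝ᵥ (σ.Q *ᵥ r) = 0 := by
    rw [h.norm_sq, le_antisymm hr (h.gain_nonneg r), mul_zero]
  exact dotProduct_self_eq_zero.1 h1

/-- A projection does not increase length: the complementary component `G r - Q r` has nonnegative
squared length. This controls the growth of `G`. -/
theorem Valid.gain_le (h : σ.Valid S) (r : Fin n → ℤ) : σ.gain r ≤ σ.G * (r ⬝ᵥ r) := by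
  have h1 : 0 ≤ (σ.G • r - σ.Q *ᵥ r) ⬝ᵥ (σ.G • r - σ.Q *ᵥ r) :=
    Finset.sum_nonneg fun i _ => mul_self_nonneg _
  rw [sub_dotProduct, dotProduct_sub, dotProduct_sub, h.norm_sq, smul_dotProduct,
    dotProduct_smul, smul_dotProduct, dotProduct_smul, dotProduct_comm (σ.Q *ᵥ r) r] at h1
  simp only [smul_eq_mul] at h1
  change 0 ≤ σ.G * (σ.G * (r ⬝ᵥ r)) - σ.G * σ.gain r - (σ.G * σ.gain r - σ.G * σ.gain r) at h1
  have := h.pos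
  by_contra hlt
  push Not at hlt
  nlinarith

theorem Valid.gain_single (_h : σ.Valid S) (i : Fin n) : σ.gain (Pi.single i 1) = σ.Q i i := by
  simp [gain]

/-- Row `i` of the symmetric `Q` has squared length `G * Q i i`. Its own diagonal term gives `Q i i
≤ G`, and then every entry has square at most `G²`. -/
theorem Valid.abs_le (h : σ.Valid S) (i j : Fin n) : |σ.Q i j| ≤ σ.G := by
  have h1 : ∑ k, σ.Q i k * σ.Q i k = σ.G * σ.Q i i := by
    have := congrFun (congrFun h.sq i) i
    rw [Matrix.mul_apply, Matrix.smul_apply, smul_eq_mul] at this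
    rw [← this]
    exact Finset.sum_congr rfl fun k _ => by
      rw [show σ.Q k i = σ.Q i k from congrFun (congrFun h.symm i) k]
  have h2 : ∀ k, σ.Q i k * σ.Q i k ≤ σ.G * σ.Q i i := fun k => by
    rw [← h1]
    exact Finset.single_le_sum (f := fun k => σ.Q i k * σ.Q i k)
      (fun k _ => mul_self_nonneg _) (Finset.mem_univ k)
  have h3 := h2 i
  have h4 := h2 j
  have h5 := h.pos
  have h6 : 0 ≤ σ.Q i i := h.gain_single i ▸ h.gain_nonneg _
  have h7 : σ.Q i i ≤ σ.G := by
    by_contra hlt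
    push Not at hlt
    nlinarith
  refine abs_le_of_sq_le_sq (by nlinarith) h5.le

/-- A bordered Gram determinant. -/
theorem det_bordered {ι : Type} [Fintype ι] [DecidableEq ι] (S : Matrix ι ι ℤ) (b : ι → ℤ) (d : ℤ)
    (hS : S.det ≠ 0) :
    (fromBlocks S (replicateCol Unit b) (replicateRow Unit b) (of fun _ _ => d)).det =
      S.det * d - b ⬝ᵥ S.adjugate *ᵥ b := by
  -- Multiplication by a block triangular matrix of determinant `det S` clears the border column;
  -- afterwards `det S` is cancelled.
  have h1 : fromBlocks S (replicateCol Unit b) (replicateRow Unit b) (of fun _ _ => d) *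
      fromBlocks 1 (replicateCol Unit (-(S.adjugate *ᵥ b))) 0 (of fun _ _ => S.det) =
      fromBlocks S 0 (replicateRow Unit b) (of fun _ _ => S.det * d - b ⬝ᵥ S.adjugate *ᵥ b) := by
    rw [fromBlocks_multiply]
    congr 1
    · simp
    · ext i j
      have : (S *ᵥ (S.adjugate *ᵥ b)) i = S.det * b i := by
        rw [mulVec_mulVec, mul_adjugate, smul_mulVec, one_mulVec]; rfl
      simp only [Matrix.add_apply, Matrix.mul_apply, replicateCol_apply, of_apply, Matrix.zero_apply,
        Finset.univ_unique, Finset.sum_singleton, Pi.neg_apply, mul_neg, Finset.sum_neg_distrib]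
      change -(S *ᵥ (S.adjugate *ᵥ b)) i + _ = 0
      rw [this]; ring
    · simp
    · ext i j
      simp only [Matrix.add_apply, Matrix.mul_apply, replicateCol_apply, replicateRow_apply, of_apply,
        Finset.univ_unique, Finset.sum_singleton, Pi.neg_apply, mul_neg, Finset.sum_neg_distrib]
      change -(b ⬝ᵥ S.adjugate *ᵥ b) + _ = _
      ring
  have h2 := congrArg det h1
  rw [det_mul, det_fromBlocks_zero₂₁, det_fromBlocks_zero₁₂, det_one, one_mul] at h2
  simp only [det_unique, of_apply] at h2
  rw [mul_comm] at h2
  exact mul_left_cancel₀ hS h2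

/-- Add `r` as a row to `R`, giving `R'`. The bordered determinant formula shows that the new Gram
determinant is the gain `g`, so `Q' = g - R'ᵀ adj(R'R'ᵀ) R'` is integral. The update numerator `E =
g Q - w wᵀ` turns out to be `G Q'`, and so the division by `G` is exact. -/
theorem Valid.step_pos (h : σ.Valid S) {r : Fin n → ℤ} (hr : 0 < σ.gain r) :
    ∃ Q' : Matrix (Fin n) (Fin n) ℤ, σ.step r = ⟨Q', σ.gain r⟩ ∧
      σ.G • Q' = σ.gain r • σ.Q - vecMulVec (σ.Q *ᵥ r) (σ.Q *ᵥ r) ∧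
      (⟨Q', σ.gain r⟩ : GramSchmidt n).Valid (insert r S) := by
  obtain ⟨ι, _, _, R, Y, h1, h2, h3, h4⟩ := h.rep
  set w := σ.Q *ᵥ r with hw
  set g := σ.gain r with hg
  set E := g • σ.Q - vecMulVec w w with hE
  have hG := h.pos.ne'
  let R' : Matrix (ι ⊕ Unit) (Fin n) ℤ := fromRows R (replicateRow Unit r)
  have hRw : R *ᵥ w = 0 := by rw [hw, mulVec_mulVec, h3, zero_mulVec]
  have hrQ : r ᵥ* σ.Q = w := by rw [← mulVec_transpose, h.symm]
  -- the value of `Y`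
  have hY : Y = (R * Rᵀ).adjugate * R := by
    have h5 : σ.G • R = R * Rᵀ * Y := by
      rw [Matrix.mul_assoc, ← h4, Matrix.mul_sub, h3, Matrix.mul_smul, Matrix.mul_one, sub_zero]
    have h6 : σ.G • Y = σ.G • ((R * Rᵀ).adjugate * R) := by
      rw [← Matrix.mul_smul, h5, ← Matrix.mul_assoc (R * Rᵀ).adjugate, adjugate_mul, h2,
        Matrix.smul_mul, Matrix.one_mul]
    exact smul_right_injective _ hG h6
  have hdet : (R' * R'ᵀ).det = g := by
    have h5 : R' * R'ᵀ = fromBlocks (R * Rᵀ) (replicateCol Unit (R *ᵥ r))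
        (replicateRow Unit (R *ᵥ r)) (of fun _ _ => r ⬝ᵥ r) := by
      rw [transpose_fromRows, fromRows_mul_fromCols]
      congr 1
      · ext i j
        simp [Matrix.mul_apply, dotProduct, mul_comm, mulVec]
    rw [h5, det_bordered _ _ _ (by rw [h2]; exact hG), h2]
    have h6 : σ.Q = σ.G • 1 - Rᵀ * ((R * Rᵀ).adjugate * R) := by
      rw [← hY, ← h4]; abel
    rw [hg, gain, h6, sub_mulVec, smul_mulVec, one_mulVec, dotProduct_sub, dotProduct_smul,
      ← mulVec_mulVec, ← mulVec_mulVec, dotProduct_mulVec r Rᵀ, vecMul_transpose]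
    rfl
  have hR'E : R' * E = 0 := by
    rw [hE]
    change fromRows R (replicateRow Unit r) * _ = _
    rw [fromRows_mul]
    have e1 : R * (g • σ.Q - vecMulVec w w) = 0 := by
      rw [Matrix.mul_sub, Matrix.mul_smul, h3, smul_zero, mul_vecMulVec, hRw]
      simp [vecMulVec]
      rfl
    have e2 : replicateRow Unit r * (g • σ.Q - vecMulVec w w) = 0 := by
      rw [Matrix.mul_sub, Matrix.mul_smul]
      ext i j
      have e3 : r ⬝ᵥ w = g := rfl
      have e4 : (replicateRow Unit r * σ.Q) i j = w j := by rw [← hrQ]; rfl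
      have e5 : (replicateRow Unit r * vecMulVec w w) i j = (r ⬝ᵥ w) * w j := by
        simp [Matrix.mul_apply, vecMulVec_apply, dotProduct, Finset.sum_mul, mul_assoc]
      rw [Matrix.sub_apply, Matrix.smul_apply, e4, e5, e3]
      simp
    rw [e1, e2]
    ext i j
    cases i <;> rfl
  -- Here `G g - E = g (G - Q) + w wᵀ` with `G - Q = Rᵀ Y`, and the left factor `w` is written as `G
  -- r - Rᵀ Y r`; collecting terms gives `Z`. Since `R' E = 0`, `Z` is then determined by `R'`, as
  -- `Y` was by `R`.
  obtain ⟨Z, hZ⟩ : ∃ Z : Matrix (ι ⊕ Unit) (Fin n) ℤ,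
      (σ.G * g) • (1 : Matrix (Fin n) (Fin n) ℤ) - E = R'ᵀ * Z := by
    refine ⟨fromRows (g • Y - vecMulVec (Y *ᵥ r) w) (replicateRow Unit (σ.G • w)), ?_⟩
    rw [transpose_fromRows, fromCols_mul_fromRows, Matrix.mul_sub, Matrix.mul_smul, ← h4,
      mul_vecMulVec, mulVec_mulVec, ← h4, sub_mulVec, smul_mulVec, one_mulVec, ← hw, hE]
    ext i j
    have e6 : ((replicateRow Unit r)ᵀ * replicateRow Unit (σ.G • w)) i j = r i * (σ.G * w j) := by
      simp [Matrix.mul_apply]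
    simp only [Matrix.add_apply, Matrix.sub_apply, Matrix.smul_apply, vecMulVec_apply, e6,
      smul_eq_mul, Pi.sub_apply, Pi.smul_apply]
    ring
  have hZ' : g • Z = g • (σ.G • ((R' * R'ᵀ).adjugate * R')) := by
    have h5 : (σ.G * g) • R' = R' * R'ᵀ * Z := by
      rw [Matrix.mul_assoc, ← hZ, Matrix.mul_sub, hR'E, Matrix.mul_smul, Matrix.mul_one, sub_zero]
    have h6 := congrArg (fun X => (R' * R'ᵀ).adjugate * X) h5
    rw [← Matrix.mul_assoc, adjugate_mul, hdet, Matrix.smul_mul, Matrix.one_mul,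
      Matrix.mul_smul] at h6
    rw [← h6, smul_smul, mul_comm]
  have hZ2 := smul_right_injective _ hr.ne' hZ'
  let Q' := g • (1 : Matrix (Fin n) (Fin n) ℤ) - R'ᵀ * ((R' * R'ᵀ).adjugate * R')
  have hQ' : σ.G • Q' = E := by
    rw [smul_sub, smul_smul, ← Matrix.mul_smul, ← hZ2, ← hZ]
    abel
  refine ⟨Q', ?_, hQ', hr, ?_, ⟨ι ⊕ Unit, inferInstance, inferInstance, R',
    (R' * R'ᵀ).adjugate * R', ?_, hdet, ?_, ?_⟩, ?_⟩
  · rw [step, if_pos hr]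
    congr 1
    ext i j
    have : σ.G * Q' i j = g * σ.Q i j - w i * w j := by
      have := congrFun (congrFun hQ' i) j
      simpa [hE, vecMulVec_apply, -zsmul_eq_mul] using this
    simp only [of_apply]
    rw [← hg, ← hw, ← this]
    exact Int.mul_ediv_cancel_left _ hG
  · have : σ.G • Q'ᵀ = σ.G • Q' := by
      rw [← transpose_smul, hQ', hE, transpose_sub, transpose_smul, h.symm, transpose_vecMulVec]
    exact smul_right_injective _ hG this
  · rintro (i | i)
    · exact Set.mem_insert_of_mem _ (h1 i)
    · exact Set.mem_insert _ _
  · have : σ.G • (R' * Q') = 0 := by rw [← Matrix.mul_smul, hQ', hR'E]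
    exact (smul_eq_zero.1 this).resolve_left hG
  · simp [Q']
  · intro x hx
    -- For `x = r` the two terms are both `g w`; for an older `x` both `Q x` and `w · x = r · Q x`
    -- vanish.
    have key : σ.G • (Q' *ᵥ x) = 0 := by
      rw [← smul_mulVec, hQ', hE, sub_mulVec, smul_mulVec, vecMulVec_mulVec]
      rcases hx with rfl | hx
      · rw [← hw, dotProduct_comm]
        change g • w - MulOpposite.op (x ⬝ᵥ w) • w = 0
        change g • w - MulOpposite.op g • w = 0
        ext i; simp [mul_comm]
      · rw [h.kill x hx, hw, ← h.dot_mulVec, h.kill x hx]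
        simp
    exact (smul_eq_zero.1 key).resolve_left hG

theorem Valid.step (h : σ.Valid S) (r : Fin n → ℤ) : (σ.step r).Valid (insert r S) := by
  by_cases hr : 0 < σ.gain r
  · obtain ⟨Q', h1, -, h2⟩ := h.step_pos hr
    rw [h1]; exact h2
  · rw [GramSchmidt.step, if_neg hr]
    obtain ⟨ι, i1, i2, R, Y, h1, h2⟩ := h.rep
    refine ⟨h.pos, h.symm, ⟨ι, i1, i2, R, Y, fun i => Set.mem_insert_of_mem _ (h1 i), h2⟩, ?_⟩
    rintro x (rfl | hx)
    · exact h.mulVec_eq_zero (not_lt.1 hr)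
    · exact h.kill x hx

/-- Hence the number of bits of `G` grows only linearly with the number of processed vectors. -/
theorem Valid.step_G_le (h : σ.Valid S) (r : Fin n → ℤ) {C : ℤ} (hC : 1 ≤ C) (hr : r ⬝ᵥ r ≤ C) :
    (σ.step r).G ≤ σ.G * C := by
  have := h.pos
  rw [GramSchmidt.step]
  split_ifs
  · exact (h.gain_le r).trans (mul_le_mul_of_nonneg_left hr h.pos.le)
  · nlinarith

/-- `Q` fixes, up to the factor `G`, the real vectors orthogonal to all processed vectors. -/
theorem Valid.fix (h : σ.Valid S) {x : Fin n → ℝ} (hx : ∀ r ∈ S, ∑ j, (r j : ℝ) * x j = 0)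
    (i : Fin n) : ∑ j, ((σ.Q *ᵥ Pi.single i 1) j : ℝ) * x j = σ.G * x i := by
  obtain ⟨ι, _, _, R, Y, h1, -, -, h4⟩ := h.rep
  have h5 : ∀ j, (σ.Q j i : ℝ) = σ.G * (if j = i then 1 else 0) - ∑ k, (R k j : ℝ) * Y k i := by
    intro j
    have := congrFun (congrFun h4 j) i
    simp only [Matrix.sub_apply, Matrix.smul_apply, Matrix.mul_apply, Matrix.one_apply,
      transpose_apply, smul_eq_mul] at this
    have h6 : σ.Q j i = σ.G * (if j = i then 1 else 0) - ∑ k, R k j * Y k i := by rw [← this]; ring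
    rw [h6]; push_cast; rfl
  have h7 : ∑ j, (∑ k, (R k j : ℝ) * Y k i) * x j = 0 := by
    simp only [Finset.sum_mul]
    rw [Finset.sum_comm]
    refine Finset.sum_eq_zero fun k _ => ?_
    have := hx _ (h1 k)
    calc ∑ j, (R k j : ℝ) * Y k i * x j = Y k i * ∑ j, (R k j : ℝ) * x j := by
          rw [Finset.mul_sum]; exact Finset.sum_congr rfl fun j _ => by ring
      _ = 0 := by rw [this, mul_zero]
  simp only [mulVec_single_one, col_apply, h5, sub_mul, Finset.sum_sub_distrib, h7, sub_zero]
  simp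

/-- Columns of `Q` are orthogonal to all processed vectors. -/
theorem Valid.orth (h : σ.Valid S) {r : Fin n → ℤ} (hr : r ∈ S) (x : Fin n → ℤ) :
    r ⬝ᵥ σ.Q *ᵥ x = 0 := by
  rw [h.dot_mulVec, h.kill r hr, zero_dotProduct]

end GramSchmidt

open Matrix

namespace StateTransfer

variable {n : ℕ}

/-! ### Eigenspaces in coordinates -/

theorem mem_eigenspace {M : Matrix (Fin n) (Fin n) ℤ} {θ : ℝ} {x : EuclideanSpace ℝ (Fin n)} :
    x ∈ eigenspace M θ ↔ ∀ i, ∑ j, (M i j : ℝ) * x j = θ * x i := by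
  rw [eigenspace, Module.End.mem_eigenspace_iff]
  constructor
  · intro h i
    have := congrArg (fun y : EuclideanSpace ℝ (Fin n) => y i) h
    simpa [Matrix.toEuclideanLin, Matrix.mulVec, dotProduct] using this
  · intro h
    ext i
    simpa [Matrix.toEuclideanLin, Matrix.mulVec, dotProduct] using h i

/-- The projection of `e_a` vanishes exactly when `e_a` is orthogonal to the eigenspace, that is,
when all eigenvectors vanish at `a`. -/
theorem mem_eigenvalueSupport {M : Matrix (Fin n) (Fin n) ℤ} {a : Fin n} {θ : ℝ} :
    θ ∈ eigenvalueSupport M a ↔ ∃ x ∈ eigenspace M θ, x a ≠ 0 := by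
  rw [eigenvalueSupport, Set.mem_ofPred_eq, Ne, Submodule.starProjection_apply_eq_zero_iff,
    Submodule.mem_orthogonal]
  push Not
  simp [EuclideanSpace.inner_single_right]

theorem isSymmetric_of_isSymm {M : Matrix (Fin n) (Fin n) ℤ} (hM : M.IsSymm) :
    (Matrix.toEuclideanLin (M.map (Int.cast : ℤ → ℝ))).IsSymmetric := by
  rw [Matrix.isSymmetric_toEuclideanLin_iff, Matrix.IsHermitian]
  ext i j
  simp [hM.apply]

/-- The spectral theorem: the eigenspaces of a symmetric matrix span the whole space. -/
theorem eq_zero_of_orthogonal {M : Matrix (Fin n) (Fin n) ℤ} (hM : M.IsSymm)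
    {v : EuclideanSpace ℝ (Fin n)}
    (hv : ∀ θ, ∀ x ∈ eigenspace M θ, ∑ i, v i * x i = 0) : v = 0 := by
  have h1 := (isSymmetric_of_isSymm hM).orthogonalComplement_iSup_eigenspaces_eq_bot
  have h2 : v ∈ (⨆ θ, eigenspace M θ)ᗮ := by
    rw [← Submodule.iInf_orthogonal, Submodule.mem_iInf]
    intro θ
    rw [Submodule.mem_orthogonal]
    intro x hx
    have := hv θ x hx
    simpa [PiLp.inner_apply, mul_comm] using this
  have h3 : v ∈ (⊥ : Submodule ℝ (EuclideanSpace ℝ (Fin n))) := by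
    rw [← h1]; exact h2
  exact (Submodule.mem_bot ℝ).1 h3

theorem eigenvalueSupport_nonempty {M : Matrix (Fin n) (Fin n) ℤ} (hM : M.IsSymm) (a : Fin n) :
    (eigenvalueSupport M a).Nonempty := by
  by_contra h
  rw [Set.not_nonempty_iff_eq_empty] at h
  have h1 : (EuclideanSpace.single a (1 : ℝ)) = 0 := by
    refine eq_zero_of_orthogonal hM fun θ x hx => ?_
    have : x a = 0 := by
      by_contra h2
      exact (h ▸ mem_eigenvalueSupport.2 ⟨x, hx, h2⟩ : θ ∈ (∅ : Set ℝ))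
    simp [this]
  have := congrArg (fun y : EuclideanSpace ℝ (Fin n) => y a) h1
  simp at this

/-- Compare both sides of `M x = θ x` at a coordinate where `|x i|` is largest: `n` entries of size
at most `n` give `n²`. -/
theorem abs_eigenvalue_le {M : Matrix (Fin n) (Fin n) ℤ} (hb : ∀ i j, |M i j| ≤ (n : ℤ)) {θ : ℝ}
    {x : EuclideanSpace ℝ (Fin n)} (hx : x ∈ eigenspace M θ) (hx0 : x ≠ 0) : |θ| ≤ (n : ℝ) ^ 2 := by
  have hne : ∃ i, x i ≠ 0 := by
    by_contra h
    push Not at h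
    exact hx0 (by ext i; simpa using h i)
  obtain ⟨i₀, h₀⟩ := hne
  obtain ⟨i, -, hi⟩ := Finset.exists_max_image Finset.univ (fun i => |x i|) ⟨i₀, Finset.mem_univ _⟩
  have hpos : 0 < |x i| := (abs_pos.2 h₀).trans_le (hi i₀ (Finset.mem_univ _))
  have h1 : |θ| * |x i| ≤ (n : ℝ) ^ 2 * |x i| := by
    rw [← abs_mul, ← mem_eigenspace.1 hx i]
    refine (Finset.abs_sum_le_sum_abs _ _).trans ?_
    calc ∑ j, |(M i j : ℝ) * x j| ≤ ∑ _j : Fin n, (n : ℝ) * |x i| := by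
          refine Finset.sum_le_sum fun j _ => ?_
          rw [abs_mul]
          exact mul_le_mul (by exact_mod_cast hb i j) (hi j (Finset.mem_univ _)) (abs_nonneg _)
            (by positivity)
      _ = (n : ℝ) ^ 2 * |x i| := by simp; ring
  exact le_of_mul_le_mul_right h1 hpos

theorem abs_le_of_mem_support {M : Matrix (Fin n) (Fin n) ℤ} (hb : ∀ i j, |M i j| ≤ (n : ℤ))
    {a : Fin n} {θ : ℝ} (h : θ ∈ eigenvalueSupport M a) : |θ| ≤ (n : ℝ) ^ 2 := by
  obtain ⟨x, hx, hxa⟩ := mem_eigenvalueSupport.1 h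
  exact abs_eigenvalue_le hb hx (by rintro rfl; simp at hxa)

/-! ### Quadratic irrationalities -/

theorem ne_mul_self {Δ : ℤ} (hs : Squarefree Δ) (h1 : 1 < Δ) (m : ℤ) : Δ ≠ m * m := by
  rintro rfl
  rcases Int.isUnit_iff.1 (hs m dvd_rfl) with rfl | rfl <;> norm_num at h1

/-- Square roots of `Δ` in `ℝ`. -/
noncomputable def rootPos {Δ : ℤ} (h : 0 ≤ Δ) : { r : ℝ // r * r = (Δ : ℤ) } :=
  ⟨√(Δ : ℝ), Real.mul_self_sqrt (by exact_mod_cast h)⟩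

/-- `Δ` is not a square, so `ℤ[√Δ]` embeds into `ℝ`. -/
theorem add_mul_sqrt_eq_zero {Δ : ℤ} (hs : Squarefree Δ) (h1 : 1 < Δ) {u v : ℤ}
    (h : (u : ℝ) + v * √(Δ : ℝ) = 0) : u = 0 ∧ v = 0 := by
  have h2 := Zsqrtd.lift_injective (rootPos (by omega : 0 ≤ Δ)) (ne_mul_self hs h1)
  have h3 : (⟨u, v⟩ : ℤ√Δ) = 0 := h2 (by simpa [rootPos] using h)
  exact ⟨congrArg Zsqrtd.re h3, congrArg Zsqrtd.im h3⟩

/-- `2 M - p`. -/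
def shifted (M : Matrix (Fin n) (Fin n) ℤ) (p : ℤ) : Matrix (Fin n) (Fin n) ℤ :=
  of fun i j => 2 * M i j - p * if i = j then 1 else 0

/-- `B² - c`. -/
def sqShifted (B : Matrix (Fin n) (Fin n) ℤ) (c : ℤ) : Matrix (Fin n) (Fin n) ℤ := B * B - c • 1

theorem shifted_symm {M : Matrix (Fin n) (Fin n) ℤ} (hM : M.IsSymm) (p : ℤ) (i j : Fin n) :
    shifted M p i j = shifted M p j i := by
  simp [shifted, hM.apply i j, eq_comm]

theorem shifted_apply_eigenvector {M : Matrix (Fin n) (Fin n) ℤ} {θ : ℝ}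
    {x : EuclideanSpace ℝ (Fin n)} :
    x ∈ eigenspace M θ ↔ ∀ p : ℤ, ∀ i, ∑ j, (shifted M p i j : ℝ) * x j = (2 * θ - p) * x i := by
  rw [mem_eigenspace]
  have key : ∀ (p : ℤ) i, ∑ j, (shifted M p i j : ℝ) * x j =
      2 * (∑ j, (M i j : ℝ) * x j) - p * x i := by
    intro p i
    simp [shifted, sub_mul, Finset.sum_sub_distrib, Finset.mul_sum, mul_assoc]
  constructor
  · intro h p i
    rw [key, h]; ring
  · intro h i
    have := h 0 i
    rw [key] at this
    push_cast at this
    linarith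

theorem mem_eigenspace_of_shifted {M : Matrix (Fin n) (Fin n) ℤ} {θ : ℝ} (p : ℤ)
    {x : EuclideanSpace ℝ (Fin n)} (h : ∀ i, ∑ j, (shifted M p i j : ℝ) * x j = (2 * θ - p) * x i) :
    x ∈ eigenspace M θ := by
  rw [mem_eigenspace]
  intro i
  have key : ∑ j, (shifted M p i j : ℝ) * x j = 2 * (∑ j, (M i j : ℝ) * x j) - p * x i := by
    simp [shifted, sub_mul, Finset.sum_sub_distrib, Finset.mul_sum, mul_assoc]
  have := h i
  rw [key] at this
  linarith

theorem sqShifted_apply_eigenvector {M : Matrix (Fin n) (Fin n) ℤ} {θ : ℝ}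
    {x : EuclideanSpace ℝ (Fin n)} (hx : x ∈ eigenspace M θ) (p c : ℤ) (i : Fin n) :
    ∑ j, (sqShifted (shifted M p) c i j : ℝ) * x j = ((2 * θ - p) ^ 2 - c) * x i := by
  have h := shifted_apply_eigenvector.1 hx p
  have h1 : ∀ j, (sqShifted (shifted M p) c i j : ℝ) =
      ∑ k, (shifted M p i k : ℝ) * shifted M p k j - c * if i = j then 1 else 0 := by
    intro j
    simp only [sqShifted, Matrix.sub_apply, Matrix.mul_apply, Matrix.smul_apply, Matrix.one_apply,
      smul_eq_mul]
    push_cast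
    rfl
  simp only [h1, sub_mul, Finset.sum_sub_distrib, Finset.sum_mul]
  rw [Finset.sum_comm]
  have h2 : ∀ k, ∑ j, (shifted M p i k : ℝ) * shifted M p k j * x j =
      (2 * θ - p) * ((shifted M p i k : ℝ) * x k) := by
    intro k
    calc _ = (shifted M p i k : ℝ) * ∑ j, (shifted M p k j : ℝ) * x j := by
          rw [Finset.mul_sum]; exact Finset.sum_congr rfl fun j _ => by ring
      _ = _ := by rw [h k]; ring
  simp only [h2, ← Finset.mul_sum, h i]
  simp
  ring

theorem sqShifted_symm {B : Matrix (Fin n) (Fin n) ℤ} (hB : ∀ i j, B i j = B j i) (c : ℤ)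
    (i j : Fin n) : sqShifted B c i j = sqShifted B c j i := by
  simp only [sqShifted, Matrix.sub_apply, Matrix.mul_apply, Matrix.smul_apply, Matrix.one_apply,
    eq_comm (a := i) (b := j)]
  congr 1
  exact Finset.sum_congr rfl fun k _ => by rw [hB i k, hB k j, mul_comm]

/-- A conjugate of an eigenvalue is an eigenvalue. -/
theorem exists_conj_eigenvector {M : Matrix (Fin n) (Fin n) ℤ} {Δ : ℤ} (hs : Squarefree Δ)
    (h1 : 1 < Δ) {p q : ℤ} {x : EuclideanSpace ℝ (Fin n)} (hx : x ∈ eigenspace M (quadValue Δ p q))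
    (hx0 : x ≠ 0) : ∃ y ∈ eigenspace M (quadValue Δ p (-q)), y ≠ 0 := by
  let r := rootPos (by omega : 0 ≤ Δ)
  let r' : { r : ℝ // r * r = (Δ : ℤ) } := ⟨-r.1, by rw [neg_mul_neg]; exact r.2⟩
  let C : Matrix (Fin n) (Fin n) (ℤ√Δ) := of fun i j =>
    (shifted M p i j : ℤ√Δ) - if i = j then ⟨0, q⟩ else 0
  have hC : ∀ (ρ : { r : ℝ // r * r = (Δ : ℤ) }) (x : Fin n → ℝ) (i : Fin n),
      (((Zsqrtd.lift ρ).mapMatrix C) *ᵥ x) i =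
        ∑ j, (shifted M p i j : ℝ) * x j - q * ρ.1 * x i := by
    intro ρ x i
    simp only [mulVec, dotProduct, RingHom.mapMatrix_apply, Matrix.map_apply, C, of_apply,
      map_sub, map_intCast, sub_mul, Finset.sum_sub_distrib]
    congr 1
    rw [Finset.sum_eq_single i]
    · simp
    · intro j _ hj; simp [hj.symm]
    · simp
  -- `C` is `2M - p - q√Δ` over `ℤ[√Δ]`. Its determinant vanishes under the embedding `√Δ ↦ √Δ`,
  -- hence is zero by injectivity, hence vanishes under `√Δ ↦ -√Δ` too.
  have hdet : (Zsqrtd.lift r) C.det = 0 := by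
    rw [RingHom.map_det]
    refine Matrix.exists_mulVec_eq_zero_iff.1 ⟨x, ?_, ?_⟩
    · intro h; exact hx0 (by ext i; exact congrFun h i)
    · ext i
      rw [hC, shifted_apply_eigenvector.1 hx p i]
      simp [quadValue, r, rootPos]
      ring
  have hdet0 : C.det = 0 := Zsqrtd.lift_injective r (ne_mul_self hs h1) (by rw [hdet, map_zero])
  have hdet' : ((Zsqrtd.lift r').mapMatrix C).det = 0 := by
    rw [← RingHom.map_det, hdet0, map_zero]
  obtain ⟨y, hy0, hy⟩ := Matrix.exists_mulVec_eq_zero_iff.2 hdet'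
  refine ⟨WithLp.toLp 2 y, mem_eigenspace_of_shifted p fun i => ?_, ?_⟩
  · have := congrFun hy i
    rw [hC] at this
    simp [quadValue, r', r, rootPos] at this ⊢
    linear_combination this
  · intro h
    exact hy0 (funext fun i => congrArg (fun z : EuclideanSpace ℝ (Fin n) => z i) h)

/-! ### Deciding the condition for a given pair -/

/-- The vector `∏_{q < k} ((2 M - p)² - q² Δ) e_a`. -/
def annihilate (M : Matrix (Fin n) (Fin n) ℤ) (a : Fin n) (Δ p : ℤ) : ℕ → Fin n → ℤ
  | 0 => Pi.single a 1
  | k + 1 => sqShifted (shifted M p) ((k : ℤ) ^ 2 * Δ) *ᵥ annihilate M a Δ p k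

/-- Each factor is symmetric, so it can be moved to the eigenvector `x`, on which it acts as a
scalar. -/
theorem sum_annihilate_mul {M : Matrix (Fin n) (Fin n) ℤ} (hM : M.IsSymm) (a : Fin n) (Δ p : ℤ)
    {θ : ℝ} {x : EuclideanSpace ℝ (Fin n)} (hx : x ∈ eigenspace M θ) (k : ℕ) :
    ∑ i, (annihilate M a Δ p k i : ℝ) * x i =
      (∏ q ∈ Finset.range k, ((2 * θ - p) ^ 2 - (q : ℝ) ^ 2 * Δ)) * x a := by
  induction k with
  | zero => simp [annihilate, Pi.single_apply]
  | succ k ih =>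
    have h1 : ∀ i, (annihilate M a Δ p (k + 1) i : ℝ) = ∑ j,
        (sqShifted (shifted M p) ((k : ℤ) ^ 2 * Δ) j i : ℝ) * annihilate M a Δ p k j := by
      intro i
      simp only [annihilate, mulVec, dotProduct]
      push_cast
      exact Finset.sum_congr rfl fun j _ => by rw [sqShifted_symm (shifted_symm hM p)]
    simp only [h1, Finset.sum_mul]
    rw [Finset.sum_comm, Finset.prod_range_succ]
    have h2 : ∀ j, ∑ i, (sqShifted (shifted M p) ((k : ℤ) ^ 2 * Δ) j i : ℝ) *
        annihilate M a Δ p k j * x i =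
        ((2 * θ - p) ^ 2 - (k : ℝ) ^ 2 * Δ) * (annihilate M a Δ p k j * x j) := by
      intro j
      calc _ = annihilate M a Δ p k j * ∑ i,
            (sqShifted (shifted M p) ((k : ℤ) ^ 2 * Δ) j i : ℝ) * x i := by
            rw [Finset.mul_sum]; exact Finset.sum_congr rfl fun i _ => by ring
        _ = _ := by rw [sqShifted_apply_eigenvector hx]; push_cast; ring
    simp only [h2, ← Finset.mul_sum, ih]
    ring

/-- Since eigenvectors span, the vector is zero exactly when its products with all eigenvectors are.
For an eigenvector with `x a ≠ 0` this means that some factor `(2θ - p)² - q²Δ` vanishes; the sign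
of `q` is chosen afterwards. -/
theorem annihilate_eq_zero_iff {M : Matrix (Fin n) (Fin n) ℤ} (hM : M.IsSymm) (a : Fin n)
    {Δ : ℤ} (hΔ : 0 < Δ) (p : ℤ) (k : ℕ) :
    annihilate M a Δ p k = 0 ↔
      ∀ θ ∈ eigenvalueSupport M a, ∃ q : ℤ, |q| < k ∧ θ = quadValue Δ p q := by
  have hsq : √(Δ : ℝ) * √(Δ : ℝ) = Δ := Real.mul_self_sqrt (by exact_mod_cast hΔ.le)
  constructor
  · intro h θ hθ
    obtain ⟨x, hx, hxa⟩ := mem_eigenvalueSupport.1 hθ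
    have h1 := sum_annihilate_mul hM a Δ p hx k
    rw [h] at h1
    simp only [Pi.zero_apply, Int.cast_zero, zero_mul, Finset.sum_const_zero] at h1
    obtain ⟨q, hq, hq0⟩ := Finset.prod_eq_zero_iff.1
      ((mul_eq_zero.1 h1.symm).resolve_right hxa)
    have h2 : (2 * θ - p - q * √(Δ : ℝ)) * (2 * θ - p + q * √(Δ : ℝ)) = 0 := by
      linear_combination hq0 - (q : ℝ) ^ 2 * hsq
    rw [Finset.mem_range] at hq
    rcases mul_eq_zero.1 h2 with h3 | h3
    · exact ⟨q, by simpa using hq, by simp only [quadValue]; push_cast; linarith⟩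
    · exact ⟨-q, by simpa using hq, by simp only [quadValue]; push_cast; linarith⟩
  · intro h
    have h0 : (WithLp.toLp 2 fun i => (annihilate M a Δ p k i : ℝ)) = 0 := by
      refine eq_zero_of_orthogonal hM fun θ x hx => ?_
      simp only
      rw [sum_annihilate_mul hM a Δ p hx k]
      by_cases hxa : x a = 0
      · rw [hxa, mul_zero]
      · obtain ⟨q, hq, rfl⟩ := h θ (mem_eigenvalueSupport.2 ⟨x, hx, hxa⟩)
        rw [Finset.prod_eq_zero (i := q.natAbs), zero_mul]
        · have := abs_lt.1 hq
          rw [Finset.mem_range]; omega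
        · have : ((q.natAbs : ℕ) : ℝ) ^ 2 = (q : ℝ) ^ 2 := by
            rw [Nat.cast_natAbs]
            push_cast
            exact sq_abs _
          rw [this]
          simp only [quadValue]
          linear_combination (q : ℝ) ^ 2 * hsq
    funext i
    have := congrArg (fun z : EuclideanSpace ℝ (Fin n) => z i) h0
    simpa using this

/-- The pair `(Δ, p)` witnesses the condition. -/
def Good (M : Matrix (Fin n) (Fin n) ℤ) (a : Fin n) (Δ p : ℤ) : Prop :=
  Squarefree Δ ∧ annihilate M a Δ p (4 * n ^ 2 + 1) = 0

/-- `q√Δ = 2θ - p` has absolute value at most `2n² + 2n²`, and `√Δ ≥ 1`. This is why `4n² + 1`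
factors suffice in `Good`. -/
theorem abs_q_le {Δ p q : ℤ} (hΔ : 0 < Δ) (hp : |p| ≤ 2 * (n : ℤ) ^ 2)
    (h : |quadValue Δ p q| ≤ (n : ℝ) ^ 2) : |q| ≤ 4 * (n : ℤ) ^ 2 := by
  have h1 : (1 : ℝ) ≤ √(Δ : ℝ) := by
    rw [Real.one_le_sqrt]; exact_mod_cast hΔ
  have h2 : |(q : ℝ)| * √(Δ : ℝ) ≤ 4 * (n : ℝ) ^ 2 := by
    have : (q : ℝ) * √(Δ : ℝ) = 2 * quadValue Δ p q - p := by simp only [quadValue]; ring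
    rw [← abs_of_nonneg (Real.sqrt_nonneg (Δ : ℝ)), ← abs_mul, this]
    have hp' : |(p : ℝ)| ≤ 2 * (n : ℝ) ^ 2 := by exact_mod_cast hp
    have := abs_sub (2 * quadValue Δ p q) p
    rw [abs_mul, abs_two] at this
    linarith
  have h3 : |(q : ℝ)| ≤ 4 * (n : ℝ) ^ 2 := by nlinarith [abs_nonneg (q : ℝ)]
  exact_mod_cast h3

theorem good_iff {M : Matrix (Fin n) (Fin n) ℤ} (hM : M.IsSymm) (hb : ∀ i j, |M i j| ≤ (n : ℤ))
    {a : Fin n} {Δ p : ℤ} (hΔ : 0 < Δ) (hp : |p| ≤ 2 * (n : ℤ) ^ 2) :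
    Good M a Δ p ↔ Squarefree Δ ∧ ∀ θ ∈ eigenvalueSupport M a, ∃ q : ℤ, θ = quadValue Δ p q := by
  rw [Good, annihilate_eq_zero_iff hM a hΔ]
  refine and_congr_right fun _ => forall₂_congr fun θ hθ => ⟨fun ⟨q, _, h⟩ => ⟨q, h⟩, ?_⟩
  rintro ⟨q, rfl⟩
  have := abs_q_le hΔ hp (abs_le_of_mem_support hb hθ)
  exact ⟨q, by push_cast; omega, rfl⟩

theorem conditionB_iff {M : Matrix (Fin n) (Fin n) ℤ} (hM : M.IsSymm)
    (hb : ∀ i j, |M i j| ≤ (n : ℤ)) {a : Fin n} :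
    ConditionB M a ↔ ∃ Δ p : ℤ, 0 < Δ ∧ Δ ≤ 4 * (n : ℤ) ^ 4 ∧ |p| ≤ 2 * (n : ℤ) ^ 2 ∧
      Good M a Δ p := by
  have hn : 1 ≤ (n : ℤ) := by have := a.pos; omega
  constructor
  · rintro ⟨Δ, p, hΔ, hs, h⟩
    have hn2 : 1 ≤ (n : ℤ) ^ 2 := one_le_pow₀ hn
    have hn4 : 1 ≤ (n : ℤ) ^ 4 := one_le_pow₀ hn
    -- If every `q` is `0`, then `Δ` plays no role and `1` replaces it; `p` is twice an eigenvalue.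
    by_cases hq : ∀ θ ∈ eigenvalueSupport M a, θ = quadValue Δ p 0
    · obtain ⟨θ, hθ⟩ := eigenvalueSupport_nonempty hM a
      have h1 := abs_le_of_mem_support hb hθ
      rw [hq θ hθ, quadValue] at h1
      simp only [Int.cast_zero, zero_mul, add_zero, abs_div, abs_two] at h1
      have hp : |p| ≤ 2 * (n : ℤ) ^ 2 := by
        have : |(p : ℝ)| ≤ 2 * (n : ℝ) ^ 2 := by linarith
        exact_mod_cast this
      refine ⟨1, p, one_pos, by omega, hp, (good_iff hM hb one_pos hp).2
        ⟨squarefree_one, fun θ hθ => ⟨0, ?_⟩⟩⟩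
      rw [hq θ hθ]; simp [quadValue]
    · push Not at hq
      obtain ⟨θ, hθ, hne⟩ := hq
      obtain ⟨q, rfl⟩ := h θ hθ
      have hq0 : q ≠ 0 := by rintro rfl; exact hne rfl
      -- With `q ≠ 0` and `Δ > 1`, the conjugate eigenvalue is also at most `n²` in absolute value:
      -- the sum is `p`, the difference `q√Δ`.
      by_cases h1 : 1 < Δ
      · obtain ⟨x, hx, hxa⟩ := mem_eigenvalueSupport.1 hθ
        have hx0 : x ≠ 0 := by rintro rfl; simp at hxa
        obtain ⟨y, hy, hy0⟩ := exists_conj_eigenvector hs h1 hx hx0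
        have e1 := abs_le.1 (abs_eigenvalue_le hb hx hx0)
        have e2 := abs_le.1 (abs_eigenvalue_le hb hy hy0)
        simp only [quadValue] at e1 e2
        push_cast at e1 e2
        have hp : |p| ≤ 2 * (n : ℤ) ^ 2 := by
          have : |(p : ℝ)| ≤ 2 * (n : ℝ) ^ 2 := by rw [abs_le]; constructor <;> linarith
          exact_mod_cast this
        have hq1 : |(q : ℝ) * √(Δ : ℝ)| ≤ 2 * (n : ℝ) ^ 2 := by
          rw [abs_le]; constructor <;> linarith
        have hΔ4 : Δ ≤ 4 * (n : ℤ) ^ 4 := by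
          have h2 : ((q : ℝ) * √(Δ : ℝ)) ^ 2 ≤ (2 * (n : ℝ) ^ 2) ^ 2 := by
            rw [← sq_abs]
            exact pow_le_pow_left₀ (abs_nonneg _) hq1 2
          rw [mul_pow, Real.sq_sqrt (by exact_mod_cast hΔ.le)] at h2
          have h3 : q ^ 2 * Δ ≤ (2 * (n : ℤ) ^ 2) ^ 2 := by exact_mod_cast h2
          have h4 : 1 ≤ q ^ 2 := by
            have := sq_pos_of_ne_zero hq0
            omega
          nlinarith
        exact ⟨Δ, p, hΔ, hΔ4, hp, (good_iff hM hb hΔ hp).2 ⟨hs, h⟩⟩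
      -- For `Δ = 1` only the parity of `p` matters; the rest moves into `q`.
      · obtain rfl : Δ = 1 := by omega
        have hp : |p % 2| ≤ 2 * (n : ℤ) ^ 2 := by
          rcases Int.emod_two_eq_zero_or_one p with h2 | h2 <;> rw [h2] <;> (simp; try omega)
        refine ⟨1, p % 2, one_pos, by omega, hp, (good_iff hM hb one_pos hp).2
          ⟨hs, fun θ hθ => ?_⟩⟩
        obtain ⟨q', rfl⟩ := h θ hθ
        refine ⟨q' + 2 * (p / 2), ?_⟩
        have : (p : ℝ) = (p % 2 : ℤ) + 2 * (p / 2 : ℤ) := by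
          have := Int.emod_add_mul_ediv p 2
          exact_mod_cast this.symm
        simp only [quadValue]
        rw [this]
        push_cast
        simp
        ring
  · rintro ⟨Δ, p, hΔ, -, hp, h⟩
    obtain ⟨h1, h2⟩ := (good_iff hM hb hΔ hp).1 h
    exact ⟨Δ, p, hΔ, h1, h2⟩

end StateTransfer

/-! ### Bases in echelon form -/

open Matrix

namespace StateTransfer

variable {n : ℕ}

/-- The vectors of the list lie in `E`, are independent, and together with the vectors of `E` that
vanish in the first `j` coordinates they give a direct decomposition of `E`. -/
structure PartialBasis (Δ : ℤ) (E : Submodule ℝ (EuclideanSpace ℝ (Fin n))) (j : ℕ)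
    (l : List (Fin n → ℤ × ℤ)) : Prop where
  mem : ∀ v ∈ l, quadVector Δ v ∈ E
  indep : LinearIndependent ℝ fun i : Fin l.length => quadVector Δ (l.get i)
  disj : ∀ y ∈ Submodule.span ℝ {z | ∃ v ∈ l, z = quadVector Δ v},
    (∀ k : Fin n, (k : ℕ) < j → y k = 0) → y = 0
  cover : ∀ x ∈ E, ∃ y ∈ Submodule.span ℝ {z | ∃ v ∈ l, z = quadVector Δ v},
    ∀ k : Fin n, (k : ℕ) < j → x k = y k

theorem range_get {Δ : ℤ} (l : List (Fin n → ℤ × ℤ)) :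
    Set.range (fun i : Fin l.length => quadVector Δ (l.get i)) =
      {z | ∃ v ∈ l, z = quadVector Δ v} := by
  ext z
  simp only [Set.mem_range, Set.mem_ofPred_eq]
  constructor
  · rintro ⟨i, rfl⟩; exact ⟨_, l.get_mem i, rfl⟩
  · rintro ⟨v, hv, rfl⟩
    obtain ⟨i, rfl⟩ := List.get_of_mem hv
    exact ⟨i, rfl⟩

theorem linearIndependent_concat {Δ : ℤ} {l : List (Fin n → ℤ × ℤ)} {v : Fin n → ℤ × ℤ}
    (hl : LinearIndependent ℝ fun i : Fin l.length => quadVector Δ (l.get i))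
    (hv : quadVector Δ v ∉ Submodule.span ℝ {z | ∃ v ∈ l, z = quadVector Δ v}) :
    LinearIndependent ℝ fun i : Fin (l ++ [v]).length => quadVector Δ ((l ++ [v]).get i) := by
  rw [← range_get] at hv
  have h := linearIndependent_finSnoc.2 ⟨hl, hv⟩
  have e : (l ++ [v]).length = l.length + 1 := by simp
  rw [← linearIndependent_equiv (finCongr e.symm)]
  have h1 : (fun i : Fin (l ++ [v]).length => quadVector Δ ((l ++ [v]).get i)) ∘ finCongr e.symm =
      Fin.snoc (fun i : Fin l.length => quadVector Δ (l.get i)) (quadVector Δ v) := by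
    funext i
    refine Fin.lastCases ?_ (fun i => ?_) i
    · simp
    · simp
  rw [h1]
  exact h

theorem PartialBasis.nil (Δ : ℤ) (E : Submodule ℝ (EuclideanSpace ℝ (Fin n))) :
    PartialBasis Δ E 0 [] where
  mem := by simp
  indep := by
    have : IsEmpty (Fin ([] : List (Fin n → ℤ × ℤ)).length) := Fin.isEmpty
    exact linearIndependent_empty_type
  disj := by
    intro y hy _
    simpa using hy
  cover := fun x _ => ⟨0, Submodule.zero_mem _, by simp⟩

/-- No vector of `E` has its first nonzero coordinate at `j`. Applied to `x - y`, this extends the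
agreement in `cover` to coordinate `j`. -/
theorem PartialBasis.skip {Δ : ℤ} {E : Submodule ℝ (EuclideanSpace ℝ (Fin n))} {j : Fin n}
    {l : List (Fin n → ℤ × ℤ)} (h : PartialBasis Δ E j l)
    (hj : ∀ x ∈ E, (∀ k : Fin n, (k : ℕ) < j → x k = 0) → x j = 0) :
    PartialBasis Δ E (j + 1) l where
  mem := h.mem
  indep := h.indep
  disj := fun y hy hk => h.disj y hy fun k hkj => hk k (by omega)
  cover := by
    intro x hx
    obtain ⟨y, hy, hxy⟩ := h.cover x hx
    refine ⟨y, hy, fun k hk => ?_⟩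
    rcases Nat.lt_succ_iff_lt_or_eq.1 hk with h1 | h1
    · exact hxy k h1
    · have hyE : y ∈ E := by
        refine Submodule.span_le.2 ?_ hy
        rintro z ⟨v, hv, rfl⟩; exact h.mem v hv
      have := hj (x - y) (E.sub_mem hx hyE) fun k hk => by simp [hxy k hk]
      obtain rfl : k = j := Fin.ext h1
      simpa [sub_eq_zero] using this

/-- The new vector has its pivot at `j`: by `disj` it is not in the old span, and a multiple of it
corrects coordinate `j` without disturbing earlier ones. -/
theorem PartialBasis.concat {Δ : ℤ} {E : Submodule ℝ (EuclideanSpace ℝ (Fin n))} {j : Fin n}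
    {l : List (Fin n → ℤ × ℤ)} (h : PartialBasis Δ E j l) {v : Fin n → ℤ × ℤ}
    (hv : quadVector Δ v ∈ E) (hv0 : ∀ k : Fin n, (k : ℕ) < j → quadVector Δ v k = 0)
    (hvj : quadVector Δ v j ≠ 0) : PartialBasis Δ E (j + 1) (l ++ [v]) := by
  have hset : {z | ∃ u ∈ l ++ [v], z = quadVector Δ u} =
      insert (quadVector Δ v) {z | ∃ u ∈ l, z = quadVector Δ u} := by
    ext z
    simp only [List.mem_append, List.mem_singleton, Set.mem_ofPred_eq, Set.mem_insert_iff]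
    constructor
    · rintro ⟨u, hu | rfl, rfl⟩
      exacts [.inr ⟨u, hu, rfl⟩, .inl rfl]
    · rintro (rfl | ⟨u, hu, rfl⟩)
      exacts [⟨v, .inr rfl, rfl⟩, ⟨u, .inl hu, rfl⟩]
  refine ⟨?_, linearIndependent_concat h.indep fun hmem => ?_, ?_, ?_⟩
  · intro u hu
    rcases List.mem_append.1 hu with h1 | h1
    · exact h.mem u h1
    · rw [List.mem_singleton.1 h1]; exact hv
  · apply hvj
    rw [h.disj _ hmem hv0]; rfl
  · intro y hy hk
    rw [hset, Submodule.mem_span_insert] at hy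
    obtain ⟨c, y', hy', rfl⟩ := hy
    have h1 : y' = 0 := h.disj y' hy' fun k hkj => by
      have := hk k (by omega)
      simpa [hv0 k hkj] using this
    have h2 := hk j (by omega)
    rw [h1] at h2 ⊢
    have h3 : c = 0 := by
      have : c * quadVector Δ v j = 0 := by simpa using h2
      exact (mul_eq_zero.1 this).resolve_right hvj
    simp [h3]
  · intro x hx
    obtain ⟨y, hy, hxy⟩ := h.cover x hx
    refine ⟨((x j - y j) / quadVector Δ v j) • quadVector Δ v + y, ?_, fun k hk => ?_⟩
    · rw [hset, Submodule.mem_span_insert]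
      exact ⟨_, y, hy, rfl⟩
    · rcases Nat.lt_succ_iff_lt_or_eq.1 hk with h1 | h1
      · simp [hv0 k h1, hxy k h1]
      · obtain rfl : k = j := Fin.ext h1
        simp [div_mul_cancel₀ _ hvj]

theorem PartialBasis.span_eq {Δ : ℤ} {E : Submodule ℝ (EuclideanSpace ℝ (Fin n))}
    {l : List (Fin n → ℤ × ℤ)} (h : PartialBasis Δ E n l) :
    Submodule.span ℝ (Set.range fun i : Fin l.length => quadVector Δ (l.get i)) = E := by
  rw [range_get]
  apply le_antisymm
  · refine Submodule.span_le.2 ?_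
    rintro z ⟨v, hv, rfl⟩; exact h.mem v hv
  · intro x hx
    obtain ⟨y, hy, hxy⟩ := h.cover x hx
    obtain rfl : x = y := by ext k; exact hxy k k.2
    exact hy

/-! ### Eigenvectors from the kernel of `(2 M - p)² - q² Δ` -/

/-- The vector `(B + f + q √Δ) w`. -/
def eigenvectorOf (B : Matrix (Fin n) (Fin n) ℤ) (q : ℤ) (w : Fin n → ℤ) : Fin n → ℤ × ℤ :=
  fun j => ((B *ᵥ w) j + 1 / (1 + q * q) * w j, q * w j)

/-- The integer quotient `f = 1 / (1 + q²)` is the indicator of `q = 0`. It lets one formula return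
`(B + q√Δ) w` for `q ≠ 0` and `w` itself for `q = 0`, where `B w` is zero. -/
theorem one_div_one_add_sq {q : ℤ} (hq : q ≠ 0) : (1 : ℤ) / (1 + q * q) = 0 := by
  have : 0 < q * q := mul_self_pos.2 hq
  exact Int.ediv_eq_zero_of_lt (by omega) (by omega)

variable {M : Matrix (Fin n) (Fin n) ℤ} {Δ p q : ℤ} {θ : ℝ}

theorem mulVec_eq_zero_of_sq {B : Matrix (Fin n) (Fin n) ℤ} (hB : ∀ i j, B i j = B j i)
    {w : Fin n → ℤ} (hw : B *ᵥ (B *ᵥ w) = 0) : B *ᵥ w = 0 := by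
  have hBt : Bᵀ = B := by ext i j; exact hB j i
  rw [← dotProduct_self_eq_zero, dotProduct_mulVec, ← mulVec_transpose, hBt, hw, zero_dotProduct]

/-- `(B - q√Δ)(B + q√Δ) = B² - q²Δ` kills `w`. For `q = 0`, symmetry of `B` turns `B² w = 0` into `B
w = 0`. -/
theorem eigenvectorOf_mem (hM : M.IsSymm) (hΔ : 0 < Δ) (hθ : 2 * θ = p + q * √(Δ : ℝ))
    {w : Fin n → ℤ} (hw : sqShifted (shifted M p) (q * q * Δ) *ᵥ w = 0) :
    quadVector Δ (eigenvectorOf (shifted M p) q w) ∈ eigenspace M θ := by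
  set B := shifted M p with hB
  have hsq : √(Δ : ℝ) * √(Δ : ℝ) = Δ := Real.mul_self_sqrt (by exact_mod_cast hΔ.le)
  have h1 : B *ᵥ (B *ᵥ w) = (q * q * Δ) • w := by
    rw [sqShifted, sub_mulVec, smul_mulVec, one_mulVec, sub_eq_zero] at hw
    rw [mulVec_mulVec, hw]
  have hf : ∀ j, (1 / (1 + q * q)) * (B *ᵥ w) j = 0 := by
    intro j
    by_cases hq : q = 0
    · have : B *ᵥ w = 0 := mulVec_eq_zero_of_sq (shifted_symm hM p) (by rw [h1, hq]; simp)
      rw [this]; simp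
    · rw [one_div_one_add_sq hq, zero_mul]
  have hqf : q * (1 / (1 + q * q)) = 0 := by
    by_cases hq : q = 0
    · rw [hq, zero_mul]
    · rw [one_div_one_add_sq hq, mul_zero]
  refine mem_eigenspace_of_shifted p fun i => ?_
  have e0 : (2 * θ - p) = q * √(Δ : ℝ) := by rw [hθ]; ring
  rw [e0, ← hB]
  have e1 : ∑ j, (B i j : ℝ) * ((B *ᵥ w) j : ℤ) = q * q * Δ * w i := by
    have := congrFun h1 i
    simp only [mulVec, dotProduct, Pi.smul_apply, smul_eq_mul] at this ⊢
    exact_mod_cast this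
  have e2 : ∑ j, (B i j : ℝ) * w j = ((B *ᵥ w) i : ℤ) := by
    simp only [mulVec, dotProduct]; push_cast; rfl
  have e3 : ((1 / (1 + q * q) : ℤ) : ℝ) * ((B *ᵥ w) i : ℤ) = 0 := by exact_mod_cast hf i
  have e4 : (q : ℝ) * ((1 / (1 + q * q) : ℤ) : ℝ) = 0 := by exact_mod_cast hqf
  have e5 : ∑ j, (B i j : ℝ) * quadVector Δ (eigenvectorOf B q w) j =
      ∑ j, (B i j : ℝ) * ((B *ᵥ w) j : ℤ) +
        (((1 / (1 + q * q) : ℤ) : ℝ) + q * √(Δ : ℝ)) * ∑ j, (B i j : ℝ) * w j := by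
    rw [Finset.mul_sum, ← Finset.sum_add_distrib]
    refine Finset.sum_congr rfl fun j _ => ?_
    simp only [quadVector, eigenvectorOf]
    push_cast
    ring
  rw [e5, e1, e2]
  simp only [quadVector, eigenvectorOf]
  push_cast at e3 e4 ⊢
  linear_combination e3 - √(Δ : ℝ) * w i * e4 - (q : ℝ) * q * w i * hsq

/-- For `q ≠ 0` the coefficient of `√Δ` is `q w_i`, and `1, √Δ` are independent over `ℤ`; for `q =
0` the vector is `w`. With `Δ = 1` and `q ≠ 0` the two parts could cancel, hence the hypothesis
`hq`. -/
theorem eigenvectorOf_ne (hM : M.IsSymm) (hs : Squarefree Δ) (hq : q = 0 ∨ 1 < Δ)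
    {w : Fin n → ℤ} (hw : sqShifted (shifted M p) (q * q * Δ) *ᵥ w = 0) {i : Fin n}
    (hi : w i ≠ 0) : quadVector Δ (eigenvectorOf (shifted M p) q w) i ≠ 0 := by
  intro h
  simp only [quadVector, eigenvectorOf] at h
  by_cases hq0 : q = 0
  · have h1 : shifted M p *ᵥ w = 0 := by
      refine mulVec_eq_zero_of_sq (shifted_symm hM p) ?_
      rw [sqShifted, hq0] at hw
      simpa using hw
    rw [hq0, h1] at h
    simp at h
    exact hi h
  · have := (add_mul_sqrt_eq_zero hs (hq.resolve_left hq0) h).2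
    exact (mul_ne_zero hq0 hi) this

/-- The vectors processed before the coordinate `j` is dealt with. -/
def processed (A B : Matrix (Fin n) (Fin n) ℤ) (j : ℕ) : Set (Fin n → ℤ) :=
  {r | (∃ i, r = A i) ∨ ∃ k : Fin n, (k : ℕ) < j ∧ (r = Pi.single k 1 ∨ r = B k)}

theorem processed_succ (A B : Matrix (Fin n) (Fin n) ℤ) (j : Fin n) :
    insert (B j) (insert (Pi.single j 1) (processed A B j)) = processed A B (j + 1) := by
  ext r
  simp only [processed, Set.mem_insert_iff, Set.mem_ofPred_eq]
  constructor
  · rintro (rfl | rfl | h | ⟨k, hk, h⟩)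
    · exact .inr ⟨j, by omega, .inr rfl⟩
    · exact .inr ⟨j, by omega, .inl rfl⟩
    · exact .inl h
    · exact .inr ⟨k, by omega, h⟩
  · rintro (h | ⟨k, hk, h⟩)
    · exact .inr (.inr (.inl h))
    · rcases Nat.lt_succ_iff_lt_or_eq.1 hk with h1 | h1
      · exact .inr (.inr (.inr ⟨k, h1, h⟩))
      · obtain rfl : k = j := Fin.ext h1
        rcases h with h | h
        exacts [.inr (.inl h), .inl h]

section
variable {σ : GramSchmidt n} {j : ℕ}

theorem kernel_of_valid
    (hσ : σ.Valid (processed (sqShifted (shifted M p) (q * q * Δ)) (shifted M p) j))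
    (x : Fin n → ℤ) : sqShifted (shifted M p) (q * q * Δ) *ᵥ (σ.Q *ᵥ x) = 0 := by
  funext i
  exact hσ.orth (.inl ⟨i, rfl⟩) x

/-- An eigenvector `x` vanishing before `j` is orthogonal to all processed vectors: to the rows of
`B² - q²Δ` as `(2θ - p)² = q²Δ`, and to row `k` of `B` as `(B x) k` is a multiple of `x k`. So `Q x
= G x`, and a zero column `i` of `Q` forces `x i = 0`. -/
theorem fix_of_valid (hΔ : 0 < Δ) (hθ : 2 * θ = p + q * √(Δ : ℝ))
    (hσ : σ.Valid (processed (sqShifted (shifted M p) (q * q * Δ)) (shifted M p) j))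
    {x : EuclideanSpace ℝ (Fin n)} (hx : x ∈ eigenspace M θ)
    (hxj : ∀ k : Fin n, (k : ℕ) < j → x k = 0) (i : Fin n) (hi : σ.gain (Pi.single i 1) ≤ 0) :
    x i = 0 := by
  have hsq : √(Δ : ℝ) * √(Δ : ℝ) = Δ := Real.mul_self_sqrt (by exact_mod_cast hΔ.le)
  have h := hσ.fix (x := x) ?_ i
  · rw [hσ.mulVec_eq_zero hi] at h
    have hG := hσ.pos.ne'
    simp at h
    exact h.resolve_left (by exact_mod_cast hG)
  · rintro r (⟨k, rfl⟩ | ⟨k, hk, rfl | rfl⟩)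
    · rw [sqShifted_apply_eigenvector hx, hθ]
      push_cast
      linear_combination (q : ℝ) ^ 2 * x k * hsq
    · simpa [Pi.single_apply] using hxj k hk
    · rw [shifted_apply_eigenvector.1 hx p k, hxj k hk, mul_zero]

/-- If `Q a a ≠ 0`, the kernel vector `Q e_a` is nonzero at `a`, and so is the eigenvector made from
it. The converse is `fix_of_valid` with no coordinates processed. -/
theorem gain_pos_iff (hM : M.IsSymm) (hΔ : 0 < Δ) (hs : Squarefree Δ) (hq : q = 0 ∨ 1 < Δ)
    (hθ : 2 * θ = p + q * √(Δ : ℝ))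
    (hσ : σ.Valid (processed (sqShifted (shifted M p) (q * q * Δ)) (shifted M p) 0)) (a : Fin n) :
    0 < σ.Q a a ↔ θ ∈ eigenvalueSupport M a := by
  rw [mem_eigenvalueSupport]
  constructor
  · intro h
    refine ⟨_, eigenvectorOf_mem hM hΔ hθ (kernel_of_valid hσ (Pi.single a 1)),
      eigenvectorOf_ne hM hs hq (kernel_of_valid hσ _) ?_⟩
    simpa using h.ne'
  · rintro ⟨x, hx, hxa⟩
    by_contra h
    refine hxa (fix_of_valid hΔ hθ hσ hx (by simp) a ?_)
    rw [hσ.gain_single]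
    exact not_lt.1 h

/-- Both integer parts of the new vector vanish before `j`: `w` because the `e_k` were processed, `B
w` because the rows of `B` were. -/
theorem partialBasis_step_pos (hM : M.IsSymm) (hΔ : 0 < Δ) (hs : Squarefree Δ)
    (hq : q = 0 ∨ 1 < Δ) (hθ : 2 * θ = p + q * √(Δ : ℝ)) {j : Fin n}
    (hσ : σ.Valid (processed (sqShifted (shifted M p) (q * q * Δ)) (shifted M p) j))
    {l : List (Fin n → ℤ × ℤ)} (h : PartialBasis Δ (eigenspace M θ) j l)
    (hg : 0 < σ.gain (Pi.single j 1)) :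
    PartialBasis Δ (eigenspace M θ) (j + 1)
      (l ++ [eigenvectorOf (shifted M p) q (σ.Q *ᵥ Pi.single j 1)]) := by
  refine h.concat (eigenvectorOf_mem hM hΔ hθ (kernel_of_valid hσ _)) (fun k hk => ?_)
    (eigenvectorOf_ne hM hs hq (kernel_of_valid hσ _) ?_)
  · have h1 : (σ.Q *ᵥ Pi.single j 1) k = 0 := by
      have := hσ.orth (.inr ⟨k, hk, .inl rfl⟩) (Pi.single j 1)
      rwa [single_dotProduct, one_mul] at this
    have h2 : (shifted M p *ᵥ (σ.Q *ᵥ Pi.single j 1)) k = 0 :=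
      hσ.orth (.inr ⟨k, hk, .inr rfl⟩) (Pi.single j 1)
    simp only [quadVector, eigenvectorOf, h1, h2]
    simp
  · rw [hσ.gain_single] at hg
    simpa using hg.ne'

theorem partialBasis_step_zero (hΔ : 0 < Δ) (hθ : 2 * θ = p + q * √(Δ : ℝ)) {j : Fin n}
    (hσ : σ.Valid (processed (sqShifted (shifted M p) (q * q * Δ)) (shifted M p) j))
    {l : List (Fin n → ℤ × ℤ)} (h : PartialBasis Δ (eigenspace M θ) j l)
    (hg : σ.gain (Pi.single j 1) ≤ 0) : PartialBasis Δ (eigenspace M θ) (j + 1) l :=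
  h.skip fun _ hx hx0 => fix_of_valid hΔ hθ hσ hx hx0 j hg

end

/-! ### Lists of eigenvalues with bases -/

/-- The entries describe the eigenvalues in the support with `q > Q`. -/
structure EntriesAbove (M : Matrix (Fin n) (Fin n) ℤ) (a : Fin n) (Δ p Q : ℤ)
    (l : List (ℤ × List (Fin n → ℤ × ℤ))) : Prop where
  above : ∀ e ∈ l, Q < e.1
  decreasing : (l.map Prod.fst).Pairwise (· > ·)
  support : ∀ e ∈ l, quadValue Δ p e.1 ∈ eigenvalueSupport M a
  basis : ∀ e ∈ l, PartialBasis Δ (eigenspace M (quadValue Δ p e.1)) n e.2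
  complete : ∀ q, Q < q → quadValue Δ p q ∈ eigenvalueSupport M a → ∃ e ∈ l, e.1 = q

theorem EntriesAbove.nil (hb : ∀ i j, |M i j| ≤ (n : ℤ)) (a : Fin n) (hΔ : 0 < Δ)
    (hp : |p| ≤ 2 * (n : ℤ) ^ 2) : EntriesAbove M a Δ p (4 * (n : ℤ) ^ 2) [] where
  above := by simp
  decreasing := by simp
  support := by simp
  basis := by simp
  complete := by
    intro q hq h
    have := (abs_le.1 (abs_q_le hΔ hp (abs_le_of_mem_support hb h))).2
    omega

theorem EntriesAbove.skip {a : Fin n} {Q : ℤ} {l : List (ℤ × List (Fin n → ℤ × ℤ))}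
    (h : EntriesAbove M a Δ p Q l) (hQ : quadValue Δ p Q ∉ eigenvalueSupport M a) :
    EntriesAbove M a Δ p (Q - 1) l where
  above := fun e he => by have := h.above e he; omega
  decreasing := h.decreasing
  support := h.support
  basis := h.basis
  complete := by
    intro q hq h1
    rcases eq_or_ne q Q with rfl | hne
    · exact absurd h1 hQ
    · exact h.complete q (by omega) h1

theorem EntriesAbove.concat {a : Fin n} {Q : ℤ} {l : List (ℤ × List (Fin n → ℤ × ℤ))}
    (h : EntriesAbove M a Δ p Q l) (hQ : quadValue Δ p Q ∈ eigenvalueSupport M a)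
    {W : List (Fin n → ℤ × ℤ)} (hW : PartialBasis Δ (eigenspace M (quadValue Δ p Q)) n W) :
    EntriesAbove M a Δ p (Q - 1) (l ++ [(Q, W)]) where
  above := fun e he => by
    rcases List.mem_append.1 he with h1 | h1
    · have := h.above e h1; omega
    · rw [List.mem_singleton.1 h1]; simp
  decreasing := by
    rw [List.map_append, List.pairwise_append]
    refine ⟨h.decreasing, by simp, ?_⟩
    intro x hx y hy
    obtain ⟨e, he, rfl⟩ := List.mem_map.1 hx
    simp only [List.map_cons, List.map_nil, List.mem_singleton] at hy
    subst hy
    exact h.above e he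
  support := fun e he => by
    rcases List.mem_append.1 he with h1 | h1
    · exact h.support e h1
    · rw [List.mem_singleton.1 h1]; exact hQ
  basis := fun e he => by
    rcases List.mem_append.1 he with h1 | h1
    · exact h.basis e h1
    · rw [List.mem_singleton.1 h1]; exact hW
  complete := by
    intro q hq h1
    rcases eq_or_ne q Q with rfl | hne
    · exact ⟨(q, W), by simp, rfl⟩
    · obtain ⟨e, he, he1⟩ := h.complete q (by omega) h1
      exact ⟨e, List.mem_append_left _ he, he1⟩

/-- The bound `|q| ≤ 4n²` puts every relevant `q` above `-4n² - 1`, so the list is complete. -/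
theorem EntriesAbove.correct (hM : M.IsSymm) (hb : ∀ i j, |M i j| ≤ (n : ℤ)) {a : Fin n}
    (hΔ : 0 < Δ) (hp : |p| ≤ 2 * (n : ℤ) ^ 2) (hg : Good M a Δ p)
    {l : List (ℤ × List (Fin n → ℤ × ℤ))}
    (h : EntriesAbove M a Δ p (-(4 * (n : ℤ) ^ 2) - 1) l) :
    SpectralData.Correct ⟨Δ, p, l⟩ M a where
  pos := hΔ
  squarefree := hg.1
  decreasing := by
    have h1 := h.decreasing
    rw [List.pairwise_map] at h1 ⊢
    refine h1.imp fun {x y} hxy => ?_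
    have h2 : 0 < √(Δ : ℝ) := Real.sqrt_pos.2 (by exact_mod_cast hΔ)
    have h3 : (y.1 : ℝ) < x.1 := by exact_mod_cast hxy
    simp only [quadValue]
    have := mul_lt_mul_of_pos_right h3 h2
    change _ < _
    linarith
  support := by
    ext θ
    constructor
    · intro hθ
      obtain ⟨q, rfl⟩ := ((good_iff hM hb hΔ hp).1 hg).2 θ hθ
      have := (abs_le.1 (abs_q_le hΔ hp (abs_le_of_mem_support hb hθ))).1
      obtain ⟨e, he, rfl⟩ := h.complete q (by omega) hθ
      exact ⟨e, he, rfl⟩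
    · rintro ⟨e, he, rfl⟩
      exact h.support e he
  independent := fun e he => (h.basis e he).indep
  span := fun e he => (h.basis e he).span_eq

end StateTransfer

namespace Ram

/-! ### Specifications of programs -/

/-- The second store differs from the first one at most in the registers `R` and in the arrays `K`. -/
structure Agree (R K : List ℕ) (s s' : Store) : Prop where
  reg : ∀ x, x ∉ R → s'.reg x = s.reg x
  arr : ∀ k, k ∉ K → s'.arr k = s.arr k

theorem Agree.refl (R K : List ℕ) (s : Store) : Agree R K s s := ⟨fun _ _ => rfl, fun _ _ => rfl⟩

theorem Agree.trans {R K : List ℕ} {s₁ s₂ s₃ : Store} (h : Agree R K s₁ s₂) (h' : Agree R K s₂ s₃) :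
    Agree R K s₁ s₃ :=
  ⟨fun x hx => (h'.reg x hx).trans (h.reg x hx), fun k hk => (h'.arr k hk).trans (h.arr k hk)⟩

theorem Agree.mono {R K R' K' : List ℕ} {s s' : Store} (h : Agree R K s s') (hR : R ⊆ R')
    (hK : K ⊆ K') : Agree R' K' s s' :=
  ⟨fun x hx => h.reg x fun h' => hx (hR h'), fun k hk => h.arr k fun h' => hk (hK h')⟩

/-- The unit in which running times are measured. -/
def timeUnit (N L : ℕ) : ℕ := (N + 1) * ((N + 1) * (400 * (L + 3)))

theorem le_timeUnit {N L c : ℕ} (hc : c ≤ 400) : c * (L + 3) ≤ timeUnit N L := by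
  unfold timeUnit
  have h1 : c * (L + 3) ≤ 400 * (L + 3) := Nat.mul_le_mul_right _ hc
  exact h1.trans ((Nat.le_mul_of_pos_left _ (Nat.succ_pos N)).trans
    (Nat.le_mul_of_pos_left _ (Nat.succ_pos N)))

/-- Started in `s`, the program halts within `τ` units of time in a bounded store with property `P`,
and changes at most the registers `R` and the arrays `K`. -/
def Does (N L : ℕ) (c : Prog) (s : Store) (τ : ℕ) (R K : List ℕ) (P : Store → Prop) : Prop :=
  ∃ s', Run c s (τ * timeUnit N L) s' ∧ s'.Bdd L ∧ Agree R K s s' ∧ P s'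

section
variable {N L : ℕ} {c c₁ c₂ : Prog} {s : Store} {τ τ₁ τ₂ : ℕ} {R K R' K' : List ℕ}
  {P P' : Store → Prop}

theorem Does.mono (h : Does N L c s τ R K P) {τ' : ℕ} (hτ : τ ≤ τ') (hR : R ⊆ R') (hK : K ⊆ K')
    (hP : ∀ s', s'.Bdd L → Agree R K s s' → P s' → P' s') : Does N L c s τ' R' K' P' := by
  obtain ⟨s', h1, h2, h3, h4⟩ := h
  exact ⟨s', h1.mono (Nat.mul_le_mul_right _ hτ), h2, h3.mono hR hK, hP s' h2 h3 h4⟩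

theorem Does.frame (h : Does N L c s τ R K P) (hR : R ⊆ R') (hK : K ⊆ K') :
    Does N L c s τ R' K' fun s' => P s' ∧ Agree R K s s' :=
  h.mono le_rfl hR hK fun _ _ h h' => ⟨h', h⟩

theorem Does.seq (h₁ : Does N L c₁ s τ₁ R K P)
    (h₂ : ∀ s', s'.Bdd L → Agree R K s s' → P s' → Does N L c₂ s' τ₂ R K P') :
    Does N L (c₁ ;; c₂) s (τ₁ + τ₂) R K P' := by
  obtain ⟨s₁, h1, h2, h3, h4⟩ := h₁
  obtain ⟨s₂, h5, h6, h7, h8⟩ := h₂ s₁ h2 h3 h4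
  exact ⟨s₂, (h1.seq h5).mono (by rw [add_mul]), h6, h3.trans h7, h8⟩

theorem Does.skip (hs : s.Bdd L) (h : P s) : Does N L .skip s 1 R K P := by
  refine ⟨s, ⟨1, .skip s, ?_⟩, hs, .refl _ _ _, h⟩
  have := le_timeUnit (N := N) (L := L) (c := 1) (by omega)
  omega

theorem Does.set (hL : 3 ≤ L) (hs : s.Bdd L) {x : ℕ} {e : Expr} (he : e.SmallConsts)
    (hw : e.weight ≤ 100) (hx : x ∈ R) (hv : |e.eval s| ≤ 2 ^ L) :
    Does N L (.set x e) s 1 R K fun s' => s' = s.setReg x (e.eval s) := by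
  refine ⟨_, (Run.set hL hs x he).mono ?_, hs.setReg x hv, ⟨fun y hy => ?_, fun k _ => rfl⟩, rfl⟩
  · rw [one_mul]; exact le_timeUnit (by omega)
  · rw [Store.setReg_reg, if_neg]; rintro rfl; exact hy hx

theorem Does.write (hL : 3 ≤ L) (hs : s.Bdd L) {k : ℕ} {i e : Expr} (hi : i.SmallConsts)
    (he : e.SmallConsts) (hw : i.weight + e.weight ≤ 100) (hk : k ∈ K) (hv : |e.eval s| ≤ 2 ^ L) :
    Does N L (.write k i e) s 1 R K fun s' =>
      s' = s.setArr k (Function.update (s.arr k) (i.eval s) (e.eval s)) := by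
  refine ⟨_, (Run.write hL hs k hi he).mono ?_, hs.setArr k fun c => ?_,
    ⟨fun _ _ => rfl, fun j hj => ?_⟩, rfl⟩
  · rw [one_mul]; exact le_timeUnit (by omega)
  · rw [Function.update_apply]
    split_ifs
    exacts [hv, hs.arr k c]
  · rw [Store.setArr_arr, if_neg]; rintro rfl; exact hj hk

theorem Does.ifPos (hL : 3 ≤ L) (hs : s.Bdd L) {e : Expr} (he : e.SmallConsts)
    (hw : e.weight ≤ 100) (h₁ : 0 < e.eval s → Does N L c₁ s τ R K P)
    (h₂ : e.eval s ≤ 0 → Does N L c₂ s τ R K P) : Does N L (.ifPos e c₁ c₂) s (τ + 1) R K P := by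
  have ht : (e.weight + 1) * (L + 3) + τ * timeUnit N L ≤ (τ + 1) * timeUnit N L := by
    have := le_timeUnit (N := N) (L := L) (c := e.weight + 1) (by omega)
    rw [add_mul τ, one_mul]; omega
  by_cases h : 0 < e.eval s
  · obtain ⟨s', h1, h2⟩ := h₁ h
    exact ⟨s', (Run.ifPos hL hs he (fun _ => h1) fun h' => absurd h (not_lt.2 h')).mono ht, h2⟩
  · obtain ⟨s', h1, h2⟩ := h₂ (not_lt.1 h)
    exact ⟨s', (Run.ifPos hL hs he (fun h' => absurd h' h) fun _ => h1).mono ht, h2⟩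

/-- The body may change only `R'`, which excludes the counter `x`, while the bound `y` is outside
`R`. One extra unit per round pays for test and increment. -/
theorem Does.for (hL : 3 ≤ L) (hs : s.Bdd L) {x y m : ℕ} (hy : s.reg y = m) (hyR : y ∉ R)
    (hx : x ∈ R) (hxR' : x ∉ R') (hR' : R' ⊆ R) (I : ℕ → Store → Prop) (h0 : I 0 (s.setReg x 0))
    (hbody : ∀ k s', k < m → s'.Bdd L → Agree R K s s' → s'.reg x = k → I k s' →
      Does N L c s' τ R' K fun s'' => I (k + 1) (s''.setReg x (k + 1 : ℤ))) :
    Does N L (forLoop x y c) s ((m + 1) * (τ + 1)) R K (I m) := by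
  have hm : (m : ℤ) ≤ 2 ^ L := hy ▸ (le_abs_self _).trans (hs.reg y)
  have hxy : y ≠ x := by rintro rfl; exact hyR hx
  refine Exists.elim (forLoop_spec hL (c := c) (T := τ * timeUnit N L) (m := m)
    (fun k s' => s'.Bdd L ∧ Agree R K s s' ∧ s'.reg x = k ∧ I k s') (x := x) (N := y)
    ?_ ?_ hs ?_) ?_
  · rintro k s' ⟨h1, h2, h3, -⟩
    exact ⟨h1, h3, by rw [h2.reg y hyR, hy]⟩
  · rintro k s' hk ⟨h1, h2, h3, h4⟩
    obtain ⟨s'', h5, h6, h7, h8⟩ := hbody k s' hk h1 h2 h3 h4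
    have hk1 : |((k : ℤ) + 1)| ≤ 2 ^ L := by
      rw [abs_of_nonneg (by positivity)]; omega
    refine ⟨s'', h5, h6, by rw [h7.reg x hxR', h3], h6.setReg x hk1, ⟨fun z hz => ?_, fun j hj => ?_⟩,
      by simp, h8⟩
    · rw [Store.setReg_reg, if_neg (by rintro rfl; exact hz hx), h7.reg z fun h => hz (hR' h),
        h2.reg z hz]
    · rw [Store.setReg_arr, h7.arr j hj, h2.arr j hj]
  · refine ⟨hs.setReg x (by simp), ⟨fun z hz => ?_, fun j _ => rfl⟩, by simp, h0⟩
    rw [Store.setReg_reg, if_neg (by rintro rfl; exact hz hx)]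
  · rintro s' ⟨h1, h2, h3, -, h4⟩
    refine ⟨s', h1.mono ?_, h2, h3, h4⟩
    rw [mul_assoc]
    refine Nat.mul_le_mul_left _ ?_
    have := le_timeUnit (N := N) (L := L) (c := 10) (by omega)
    rw [add_mul, one_mul]; omega

/-- The time unit is chosen so that a whole `fillSum` with loops of length at most `N` counts as
one; its `400` is the admitted `350` plus the overhead `50`. -/
theorem Does.fill {b : ℕ} (hb : 3 ≤ b) (hs : s.Bdd L) (h20 : s.reg 20 = 0) (h21 : s.reg 21 = 0)
    (h22 : s.reg 22 = 0) {k x y z m l : ℕ} {e : Expr} (hN : s.reg y = m) (hl : s.reg z = l)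
    (hmN : m ≤ N) (hlN : l ≤ N)
    (hx' : x ≠ 20 ∧ x ≠ 21 ∧ x ≠ 22) (hy' : y ≠ 20 ∧ y ≠ 21 ∧ y ≠ 22)
    (hz' : z ≠ 20 ∧ z ≠ 21 ∧ z ≠ 22) (hav : e.Avoids 21 k) (hc : e.SmallConsts)
    (hlb : (l : ℤ) ≤ 2 ^ b) (hbL : (e.deg + 1) * b ≤ L) (hw : e.weight + e.deg ≤ 350) (hk : k ∈ K)
    (h : ∀ i < m, ∀ j < l, e.Leaves b ((s.setReg 20 (i : ℤ)).setReg 22 j)) :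
    Does N L (fillSum k x y z e) s 1 R K fun s' =>
      s' = s.setArr k (filled s k (s.reg x) m l e) := by
  refine ⟨_, (fillSum_spec hb hs h20 h21 h22 hN hl hx' hy' hz' hav hc hlb hbL h).mono ?_,
    Store.Bdd.filled hb hs hlb hbL h _, ⟨fun _ _ => rfl, fun j hj => ?_⟩, rfl⟩
  · rw [one_mul, timeUnit]
    exact Nat.mul_le_mul (by omega) (Nat.mul_le_mul (by omega) (Nat.mul_le_mul_right _ (by omega)))
  · rw [Store.setArr_arr, if_neg]; rintro rfl; exact hj hk

end

end Ram

namespace Ram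

open Matrix

variable {n : ℕ}

/-! ### Matrices and vectors in memory -/

/-- The matrix is stored row by row. -/
def IsMat (f : ℤ → ℤ) (Q : Matrix (Fin n) (Fin n) ℤ) : Prop :=
  ∀ i j : Fin n, f ((i : ℕ) * n + (j : ℕ)) = Q i j

/-- The vector is stored in the first cells. -/
def IsVec (f : ℤ → ℤ) (v : Fin n → ℤ) : Prop := ∀ i : Fin n, f (i : ℕ) = v i

theorem row_ediv (i j : Fin n) : ((i : ℕ) * n + (j : ℕ) : ℤ) / n = (i : ℕ) := by
  have hn : (0 : ℤ) < n := by have := i.pos; omega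
  rw [add_comm, Int.add_mul_ediv_right _ _ hn.ne', Int.ediv_eq_zero_of_lt (by omega) (by omega),
    zero_add]

theorem col_sub (i j : Fin n) : ((i : ℕ) * n + (j : ℕ) : ℤ) - n * (i : ℕ) = (j : ℕ) := by ring

theorem exists_cell {c : ℕ} (hc : c < n * n) : ∃ i j : Fin n, c = (i : ℕ) * n + j := by
  have hn : 0 < n := Nat.pos_of_ne_zero (by rintro rfl; simp at hc)
  exact ⟨⟨c / n, Nat.div_lt_of_lt_mul hc⟩, ⟨c % n, Nat.mod_lt _ hn⟩, (Nat.div_add_mod' c n).symm⟩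

theorem cell_lt (i j : Fin n) : (i : ℕ) * n + j < n * n := by
  have := i.2
  have := j.2
  nlinarith

/-- Parameters: the numbers `n`, a bound `b` for the bits of the essential values, a bound `L` for the
bits of all values, and a bound `N` for the lengths of inner loops. -/
structure Dim (n b L N : ℕ) : Prop where
  pos : 1 ≤ n
  three_le : 3 ≤ b
  bits : 200 * b ≤ L
  sq_le : n * n ≤ N
  two_mul_le : 2 * n ≤ N
  sq_le_pow : ((n * n : ℕ) : ℤ) ≤ 2 ^ b

/-- The registers and cells that keep their contents after the initialization. -/
structure Ctx (M : Matrix (Fin n) (Fin n) ℤ) (a : Fin n) (s : Store) : Prop where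
  r2 : s.reg 2 = n
  r3 : s.reg 3 = (n * n : ℕ)
  r4 : s.reg 4 = (1 : ℕ)
  r5 : s.reg 5 = (a : ℕ)
  r20 : s.reg 20 = 0
  r21 : s.reg 21 = 0
  r22 : s.reg 22 = 0
  r23 : s.reg 23 = 0
  r24 : s.reg 24 = (2 * n : ℕ)
  r25 : s.reg 25 = (4 * n ^ 2 + 1 : ℕ)
  r26 : s.reg 26 = (4 * n ^ 4 * (4 * n ^ 2 + 1) : ℕ)
  r27 : s.reg 27 = (8 * n ^ 2 + 1 : ℕ)
  input : ∀ i j : Fin n, s.arr 0 (2 + ((i : ℕ) * n + (j : ℕ))) = M i j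

theorem Ctx.agree {M : Matrix (Fin n) (Fin n) ℤ} {a : Fin n} {s s' : Store} {R K : List ℕ}
    (h : Ctx M a s) (h' : Agree R K s s')
    (hR : ∀ x ∈ R, x ∉ [2, 3, 4, 5, 20, 21, 22, 23, 24, 25, 26, 27]) (hK : 0 ∉ K) : Ctx M a s' := by
  have key : ∀ x ∈ [2, 3, 4, 5, 20, 21, 22, 23, 24, 25, 26, 27], s'.reg x = s.reg x :=
    fun x hx => h'.reg x fun hxR => hR x hxR hx
  constructor
  · rw [key 2 (by decide), h.r2]
  · rw [key 3 (by decide), h.r3]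
  · rw [key 4 (by decide), h.r4]
  · rw [key 5 (by decide), h.r5]
  · rw [key 20 (by decide), h.r20]
  · rw [key 21 (by decide), h.r21]
  · rw [key 22 (by decide), h.r22]
  · rw [key 23 (by decide), h.r23]
  · rw [key 24 (by decide), h.r24]
  · rw [key 25 (by decide), h.r25]
  · rw [key 26 (by decide), h.r26]
  · rw [key 27 (by decide), h.r27]
  · rw [h'.arr 0 hK]; exact h.input

section
variable {b L N : ℕ} {M : Matrix (Fin n) (Fin n) ℤ} {a : Fin n} {s : Store} {R K : List ℕ}

/-- Operands are bounded by `2 ^ b'`, with `b'` a multiple of `b` in applications, and results by `2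
^ ((deg + 1) * b')`. Register `23`, always `0`, is the offset; a plain assignment is a sum of length
`1`, the content of register `4`. -/
theorem Does.fillMat (D : Dim n b L N) (hc : Ctx M a s) (hs : s.Bdd L) {k z l : ℕ} {e : Expr}
    (Q : Matrix (Fin n) (Fin n) ℤ) {b' : ℕ} (hbb : b ≤ b') (hk : k ∈ K) (hz : s.reg z = l)
    (hlN : l ≤ N)
    (hz' : z ≠ 20 ∧ z ≠ 21 ∧ z ≠ 22) (hav : e.Avoids 21 k) (hc' : e.SmallConsts)
    (hlb : (l : ℤ) ≤ 2 ^ b') (hbL : (e.deg + 1) * b' ≤ L) (hw : e.weight + e.deg ≤ 350)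
    (h : ∀ i j : Fin n, ∀ t : Fin l,
      e.Leaves b' ((s.setReg 20 ((i : ℕ) * n + (j : ℕ))).setReg 22 (t : ℕ)))
    (hv : ∀ i j : Fin n, ∑ t : Fin l,
      e.eval ((s.setReg 20 ((i : ℕ) * n + (j : ℕ))).setReg 22 (t : ℕ)) = Q i j) :
    Does N L (fillSum k 23 3 z e) s 1 R K fun s' =>
      ∃ f, s' = s.setArr k f ∧ IsMat f Q ∧ ∀ i j, |Q i j| ≤ 2 ^ ((e.deg + 1) * b') := by
  have hleaf : ∀ i < n * n, ∀ j < l, e.Leaves b' ((s.setReg 20 (i : ℤ)).setReg 22 j) := by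
    intro c hc j hj
    obtain ⟨i₁, j₁, rfl⟩ := exists_cell hc
    have := h i₁ j₁ ⟨j, hj⟩
    push_cast
    exact this
  refine (Does.fill (D.three_le.trans hbb) hs hc.r20 hc.r21 hc.r22 hc.r3 hz D.sq_le hlN (by decide)
    (by decide) hz' hav hc' hlb hbL hw hk hleaf).mono le_rfl (List.Subset.refl _)
    (List.Subset.refl _) ?_
  rintro s' - - rfl
  refine ⟨_, rfl, fun i j => ?_, fun i j => ?_⟩
  · have hlt := cell_lt i j
    unfold filled
    rw [hc.r23, if_pos (by push_cast at hlt ⊢; constructor <;> [positivity; (zify at hlt; linarith)])]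
    rw [sumAt, Finset.sum_range, ← hv i j]
    simp
  · rw [← hv i j, ← Finset.sum_range fun t : ℕ =>
      e.eval ((s.setReg 20 ((i : ℕ) * n + (j : ℕ))).setReg 22 (t : ℕ))]
    exact abs_sumAt_le (by have := D.three_le; omega) hlb fun t ht => h i j ⟨t, ht⟩

theorem Does.fillVec (D : Dim n b L N) (hc : Ctx M a s) (hs : s.Bdd L) {k y z m l : ℕ} {e : Expr}
    (v : Fin m → ℤ) {b' : ℕ} (hbb : b ≤ b') (hk : k ∈ K) (hy : s.reg y = m) (hz : s.reg z = l)
    (hmN : m ≤ N) (hlN : l ≤ N)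
    (hy' : y ≠ 20 ∧ y ≠ 21 ∧ y ≠ 22)
    (hz' : z ≠ 20 ∧ z ≠ 21 ∧ z ≠ 22) (hav : e.Avoids 21 k) (hc' : e.SmallConsts)
    (hlb : (l : ℤ) ≤ 2 ^ b') (hbL : (e.deg + 1) * b' ≤ L) (hw : e.weight + e.deg ≤ 350)
    (h : ∀ i : Fin m, ∀ t : Fin l, e.Leaves b' ((s.setReg 20 (i : ℕ)).setReg 22 (t : ℕ)))
    (hv : ∀ i : Fin m, ∑ t : Fin l, e.eval ((s.setReg 20 (i : ℕ)).setReg 22 (t : ℕ)) = v i) :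
    Does N L (fillSum k 23 y z e) s 1 R K fun s' =>
      ∃ f, s' = s.setArr k f ∧ IsVec f v ∧ ∀ i, |v i| ≤ 2 ^ ((e.deg + 1) * b') := by
  refine (Does.fill (D.three_le.trans hbb) hs hc.r20 hc.r21 hc.r22 hy hz hmN hlN (by decide)
    hy' hz' hav hc' hlb hbL hw hk fun i hi j hj => h ⟨i, hi⟩ ⟨j, hj⟩).mono le_rfl
    (List.Subset.refl _) (List.Subset.refl _) ?_
  rintro s' - - rfl
  refine ⟨_, rfl, fun i => ?_, fun i => ?_⟩
  · have := i.2
    unfold filled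
    rw [hc.r23, if_pos (by omega), sumAt, Finset.sum_range, ← hv i]
    simp
  · rw [← hv i, ← Finset.sum_range fun t : ℕ => e.eval ((s.setReg 20 (i : ℕ)).setReg 22 (t : ℕ))]
    exact abs_sumAt_le (by have := D.three_le; omega) hlb fun t ht => h i ⟨t, ht⟩

end

/-! ### Auxiliary expressions -/

/-- Row index that belongs to the cell number in register `20`. -/
def rowIdx : Expr := .reg 20 /ₑ .reg 2

/-- Column index that belongs to the cell number in register `20`. -/
def colIdx : Expr := .reg 20 -ₑ .reg 2 *ₑ (.reg 20 /ₑ .reg 2)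

/-- The entry of the matrix in array `k`. -/
def entry (k : ℕ) (i j : Expr) : Expr := .read k (i *ₑ .reg 2 +ₑ j)

/-- `1` if the values are equal and `0` otherwise. -/
def ifEq (e₁ e₂ : Expr) : Expr := .const 1 /ₑ (.const 1 +ₑ (e₁ -ₑ e₂) *ₑ (e₁ -ₑ e₂))

theorem one_ediv_one_add {x : ℤ} (hx : 0 ≤ x) : 1 / (1 + x) = if x = 0 then 1 else 0 := by
  split_ifs with h
  · simp [h]
  · exact Int.ediv_eq_zero_of_lt (by omega) (by omega)

@[simp] theorem ifEq_eval (e₁ e₂ : Expr) (s : Store) :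
    (ifEq e₁ e₂).eval s = if e₁.eval s = e₂.eval s then 1 else 0 := by
  simp only [ifEq, Expr.eval, one_ediv_one_add (mul_self_nonneg _), mul_self_eq_zero, sub_eq_zero]

@[simp] theorem ifEq_leaves (e₁ e₂ : Expr) (b : ℕ) (s : Store) :
    (ifEq e₁ e₂).Leaves b s ↔ e₁.Leaves b s ∧ e₂.Leaves b s := by
  have : (1 : ℤ) ≤ 2 ^ b := one_le_pow₀ (by norm_num)
  simp [ifEq, Expr.Leaves, this]

@[simp] theorem ifEq_smallConsts (e₁ e₂ : Expr) :
    (ifEq e₁ e₂).SmallConsts ↔ e₁.SmallConsts ∧ e₂.SmallConsts := by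
  simp [ifEq, Expr.SmallConsts]

@[simp] theorem ifEq_avoids (e₁ e₂ : Expr) (y k : ℕ) :
    (ifEq e₁ e₂).Avoids y k ↔ e₁.Avoids y k ∧ e₂.Avoids y k := by
  simp [ifEq, Expr.Avoids]

/-- `array 2 := 2 M - p`, for `p` in register `7`. -/
def shiftedProg : Prog :=
  fillSum 2 23 3 4 (.const 2 *ₑ .read 0 (.const 2 +ₑ .reg 20) -ₑ .reg 7 *ₑ ifEq rowIdx colIdx)

/-- `array 3 := B² - q² Δ`, for `B` in array `2`, `q` in register `8` and `Δ` in register `6`. -/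
def sqShiftedProg : Prog :=
  fillSum 3 23 3 2 (entry 2 rowIdx (.reg 22) *ₑ entry 2 (.reg 22) colIdx -ₑ
    .reg 8 *ₑ .reg 8 *ₑ .reg 6 *ₑ (ifEq rowIdx (.reg 22) *ₑ ifEq (.reg 22) colIdx))

section
variable {b L N : ℕ} {M : Matrix (Fin n) (Fin n) ℤ} {a : Fin n} {s : Store} {R K : List ℕ}

theorem leaf_bounds (D : Dim n b L N) {b' : ℕ} (hb : b ≤ b') :
    (1 : ℤ) ≤ 2 ^ b' ∧ (2 : ℤ) ≤ 2 ^ b' ∧ (n : ℤ) ≤ 2 ^ b' ∧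
    (∀ i : Fin n, ((i : ℕ) : ℤ) ≤ 2 ^ b') ∧
    ∀ i j : Fin n, |((i : ℕ) * n + (j : ℕ) : ℤ)| ≤ 2 ^ b' := by
  have h1 : (2 : ℤ) ≤ 2 ^ b' := by
    calc (2 : ℤ) = 2 ^ 1 := by norm_num
      _ ≤ 2 ^ b' := pow_two_mono (by have := D.three_le; omega)
  have h0 : ((n * n : ℕ) : ℤ) ≤ 2 ^ b' := D.sq_le_pow.trans (pow_two_mono hb)
  have h2 : (n : ℤ) ≤ 2 ^ b' := by
    refine le_trans ?_ h0
    exact_mod_cast Nat.le_mul_of_pos_left n D.pos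
  refine ⟨by omega, h1, h2, fun i => by have := i.2; omega, fun i j => ?_⟩
  rw [abs_of_nonneg (by positivity)]
  have h3 := cell_lt i j
  have h5 : ((i : ℕ) * n + (j : ℕ) : ℤ) < (n * n : ℕ) := by exact_mod_cast h3
  omega

theorem shiftedProg_spec (D : Dim n b L N) (hc : Ctx M a s) (hs : s.Bdd L) (hK : 2 ∈ K)
    (hM : ∀ i j, |M i j| ≤ 2 ^ b) (hp : |s.reg 7| ≤ 2 ^ b) :
    Does N L shiftedProg s 1 R K fun s' => ∃ f, s' = s.setArr 2 f ∧
      IsMat f (StateTransfer.shifted M (s.reg 7)) := by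
  obtain ⟨h1, h2, hn, hi, hij⟩ := leaf_bounds D le_rfl
  have hbL := D.bits
  refine (Does.fillMat D hc hs (l := 1) (StateTransfer.shifted M (s.reg 7)) le_rfl hK hc.r4
    (by have := D.pos; have := D.sq_le; nlinarith)
    (by decide) ?_ ?_ (by simpa using h1) ?_ (by decide) ?_ ?_).mono le_rfl (List.Subset.refl _)
    (List.Subset.refl _) ?_
  · simp [Expr.Avoids, rowIdx, colIdx]
  · simp [Expr.SmallConsts, rowIdx, colIdx]
  · simp only [Expr.deg, ifEq]; omega
  · intro i j t
    simp [Expr.Leaves, Expr.eval, rowIdx, colIdx, hc.r2, hc.input, h2, hij, hM, hp, hn]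
  · intro i j
    simp [Expr.eval, rowIdx, colIdx, hc.r2, hc.input, row_ediv, col_sub, StateTransfer.shifted,
      Fin.ext_iff]
  · rintro s' - - ⟨f, rfl, hf, -⟩
    exact ⟨f, rfl, hf⟩

/-- The scalar matrix has to be put under the sum that computes `B²`: over the summation index `t`,
the products `δ_it δ_tj` add up to `δ_ij`. -/
theorem sqShiftedProg_spec (D : Dim n b L N) (hc : Ctx M a s) (hs : s.Bdd L) (hK : 3 ∈ K)
    {B : Matrix (Fin n) (Fin n) ℤ} (hB : IsMat (s.arr 2) B)
    (hBb : ∀ i j, |B i j| ≤ 2 ^ b) (hq : |s.reg 8| ≤ 2 ^ b) (hΔ : |s.reg 6| ≤ 2 ^ b) :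
    Does N L sqShiftedProg s 1 R K fun s' => ∃ f, s' = s.setArr 3 f ∧
      IsMat f (StateTransfer.sqShifted B (s.reg 8 * s.reg 8 * s.reg 6)) := by
  obtain ⟨h1, h2, hn, hi, hij⟩ := leaf_bounds D le_rfl
  have hbL := D.bits
  refine (Does.fillMat D hc hs (StateTransfer.sqShifted B (s.reg 8 * s.reg 8 * s.reg 6)) le_rfl hK
    hc.r2 (by have := D.two_mul_le; omega)
    (by decide) ?_ ?_ hn ?_ (by decide) ?_ ?_).mono le_rfl (List.Subset.refl _)
    (List.Subset.refl _) ?_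
  · simp [Expr.Avoids, rowIdx, colIdx, entry]
  · simp [Expr.SmallConsts, rowIdx, colIdx, entry]
  · simp only [Expr.deg, ifEq, entry]; omega
  · intro i j t
    simp [Expr.Leaves, Expr.eval, rowIdx, colIdx, entry, hc.r2, hi, hij, hn, row_ediv, col_sub,
      hB _ _, hBb, hq, hΔ]
  · intro i j
    simp only [Expr.eval, rowIdx, colIdx, entry, hc.r2, ifEq_eval, Store.setReg_reg,
      Store.setReg_arr, row_ediv, col_sub, if_true, reduceIte, Nat.reduceEqDiff,
      hB _ _]
    simp only [StateTransfer.sqShifted, Matrix.sub_apply, Matrix.mul_apply, Matrix.smul_apply,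
      Matrix.one_apply, Finset.sum_sub_distrib, ← Finset.mul_sum, smul_eq_mul]
    simp [← Fin.ext_iff]
  · rintro s' - - ⟨f, rfl, hf, -⟩
    exact ⟨f, rfl, hf⟩

end

end Ram

/-! ### One orthogonalization step on the machine -/

namespace Ram

open Matrix

variable {n : ℕ}

/-- The state of the orthogonalization is stored in array `4` and register `9`. -/
def IsGS (s : Store) (σ : GramSchmidt n) : Prop := IsMat (s.arr 4) σ.Q ∧ s.reg 9 = σ.G

/-- For `r` in array `5`: the vector `Q r` in array `6` and the number `r · Q r` in array `7`. -/
def projectProg : Prog :=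
  fillSum 6 23 2 2 (entry 4 (.reg 20) (.reg 22) *ₑ .read 5 (.reg 22)) ;;
  fillSum 7 23 4 2 (.read 5 (.reg 22) *ₑ .read 6 (.reg 22))

/-- The new matrix of the orthogonalization. -/
def updateProg : Prog :=
  fillSum 10 23 3 4 ((.read 7 (.const 0) *ₑ .read 4 (.reg 20) -ₑ .read 6 rowIdx *ₑ .read 6 colIdx)
    /ₑ .reg 9) ;;
  fillSum 4 23 3 4 (.read 10 (.reg 20)) ;;
  .set 9 (.read 7 (.const 0))

/-- Process the vector in array `5`. -/
def stepProg : Prog :=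
  projectProg ;; .ifPos (.read 7 (.const 0)) updateProg .skip

section
variable {b L N : ℕ} {M : Matrix (Fin n) (Fin n) ℤ} {a : Fin n} {s : Store} {R K : List ℕ}
  {σ : GramSchmidt n} {S : Set (Fin n → ℤ)} {r : Fin n → ℤ}

theorem IsVec.at {m : ℕ} {f : ℤ → ℤ} {v : Fin m → ℤ} (h : IsVec f v) (i : Fin m) :
    f ((i : ℕ) : ℤ) = v i := h i

theorem projectProg_spec (D : Dim n b L N) (hc : Ctx M a s) (hs : s.Bdd L) (h6 : 6 ∈ K)
    (h7 : 7 ∈ K) (hσ : IsGS s σ) (hr : IsVec (s.arr 5) r) (hrb : ∀ i, |r i| ≤ 2 ^ b)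
    (hQ : ∀ i j, |σ.Q i j| ≤ 2 ^ b) :
    Does N L projectProg s 2 R K fun s' => ∃ f g, s' = (s.setArr 6 f).setArr 7 g ∧
      IsVec f (σ.Q *ᵥ r) ∧ (∀ i, |(σ.Q *ᵥ r) i| ≤ 2 ^ (9 * b)) ∧ g 0 = σ.gain r ∧
      |σ.gain r| ≤ 2 ^ (9 * b) := by
  have hbL := D.bits
  have hb3 := D.three_le
  have hN := D.two_mul_le
  have hn1 := D.pos
  have l1 := leaf_bounds D (le_refl b)
  have l3 := leaf_bounds D (by omega : b ≤ 3 * b)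
  have hrb3 : ∀ i, |r i| ≤ 2 ^ (3 * b) := fun i => (hrb i).trans (pow_two_mono (by omega))
  refine (Does.seq (τ₁ := 1) (τ₂ := 1) (Does.fillVec D hc hs (y := 2) (z := 2) (σ.Q *ᵥ r) le_rfl h6
    hc.r2 hc.r2 (by omega) (by omega) (by decide) (by decide) ?_ ?_ l1.2.2.1
    ?_ (by decide) ?_ ?_) ?_)
  · simp [Expr.Avoids, entry]
  · simp [Expr.SmallConsts, entry]
  · simp only [Expr.deg, entry]; omega
  · intro i t
    simp [Expr.Leaves, Expr.eval, entry, hc.r2, l1, hσ.1 _ _, hr.at, hQ, hrb]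
  · intro i
    simp [Expr.eval, entry, hc.r2, hσ.1 _ _, hr.at, mulVec, dotProduct]
  rintro s₁ hs₁ hag ⟨f, rfl, hf, hfb⟩
  have hc₁ : Ctx M a (s.setArr 6 f) := hc.agree (R := []) (K := [6])
    ⟨fun _ _ => rfl, fun k hk => by simp at hk; simp [hk]⟩ (by simp) (by simp)
  have hfb' : ∀ i, |(σ.Q *ᵥ r) i| ≤ 2 ^ (3 * b) := fun i => (hfb i).trans (pow_two_mono (by
    simp only [Expr.deg, entry]; omega))
  refine (Does.fillVec D hc₁ hs₁ (k := 7) (y := 4) (z := 2) (b' := 3 * b)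
    (fun _ : Fin 1 => σ.gain r) (by omega) h7
    hc₁.r4 hc₁.r2 (by omega) (by omega) (by decide) (by decide) ?_ ?_
    l3.2.2.1 ?_ (by decide) ?_ ?_).mono le_rfl (List.Subset.refl _) (List.Subset.refl _) ?_
  · simp [Expr.Avoids]
  · simp [Expr.SmallConsts]
  · simp only [Expr.deg]; omega
  · intro i t
    simp [Expr.Leaves, Expr.eval, l3, hr.at, hf.at, hrb3, hfb']
  · intro i
    simp [Expr.eval, hr.at, hf.at, GramSchmidt.gain, dotProduct]
  rintro s₂ - - ⟨g, rfl, hg, hgb⟩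
  refine ⟨f, g, rfl, hf, fun i => (hfb' i).trans (pow_two_mono (by omega)), hg 0, ?_⟩
  refine (hgb 0).trans (pow_two_mono ?_)
  simp only [Expr.deg]; omega

/-- The new matrix passes through array `10`, as `fillSum` must not read its target. No bound on the
new entries is exported: it is recovered each time from `Valid.abs_le` and a bound on `G`. -/
theorem stepProg_spec (D : Dim n b L N) (hc : Ctx M a s) (hs : s.Bdd L) (hσ : IsGS s σ)
    (hv : σ.Valid S) (hG : σ.G ≤ 2 ^ b) (hr : IsVec (s.arr 5) r) (hrb : ∀ i, |r i| ≤ 2 ^ b) :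
    Does N L stepProg s 6 [9] [4, 6, 7, 10] fun s' => IsGS s' (σ.step r) := by
  have hbL := D.bits
  have hb3 := D.three_le
  have hN := D.two_mul_le
  have hn1 := D.pos
  have hQ : ∀ i j, |σ.Q i j| ≤ 2 ^ b := fun i j => (hv.abs_le i j).trans hG
  refine Does.seq (τ₁ := 2) (τ₂ := 4) (projectProg_spec D hc hs (by simp) (by simp) hσ hr hrb hQ) ?_
  rintro s₁ hs₁ - ⟨f, g, rfl, hf, hfb, hg, hgb⟩
  have hc₁ : Ctx M a ((s.setArr 6 f).setArr 7 g) := hc.agree (R := []) (K := [6, 7])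
    ⟨fun _ _ => rfl, fun k hk => by simp at hk; simp [hk]⟩ (by simp) (by simp)
  refine Does.ifPos (by omega) hs₁ (by simp [Expr.SmallConsts]) (by decide) (fun hpos => ?_)
    (fun hneg => ?_)
  · replace hpos : 0 < σ.gain r := by simpa [Expr.eval, hg] using hpos
    have hstep : σ.step r = ⟨.of fun i j =>
        (σ.gain r * σ.Q i j - (σ.Q *ᵥ r) i * (σ.Q *ᵥ r) j) / σ.G, σ.gain r⟩ := by
      rw [GramSchmidt.step, if_pos hpos]
    have l9 := leaf_bounds D (by omega : b ≤ 9 * b)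
    have hQ9 : ∀ i j, |σ.Q i j| ≤ 2 ^ (9 * b) := fun i j => (hQ i j).trans (pow_two_mono (by omega))
    have hG9 : |σ.G| ≤ 2 ^ (9 * b) := by
      rw [abs_of_pos hv.pos]; exact hG.trans (pow_two_mono (by omega))
    refine Does.seq (τ₁ := 1) (τ₂ := 2) (Does.fillMat D hc₁ hs₁ (k := 10) (z := 4) (b' := 9 * b)
      (.of fun i j => (σ.gain r * σ.Q i j - (σ.Q *ᵥ r) i * (σ.Q *ᵥ r) j) / σ.G) (by omega)
      (by simp) hc₁.r4 (by omega) (by decide) ?_ ?_ (by simpa using l9.1) ?_ (by decide) ?_ ?_) ?_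
    · simp [Expr.Avoids, rowIdx, colIdx]
    · simp [Expr.SmallConsts, rowIdx, colIdx]
    · simp only [Expr.deg]; omega
    · intro i j t
      simp [Expr.Leaves, Expr.eval, rowIdx, colIdx, hc.r2, row_ediv, col_sub, l9, hf.at, hg, hgb,
        hfb, hσ.1 _ _, hQ9, hσ.2, hG9]
    · intro i j
      simp [Expr.eval, rowIdx, colIdx, hc.r2, row_ediv, col_sub, hf.at, hg, hσ.1 _ _, hσ.2]
    rintro s₂ hs₂ - ⟨Q₁, rfl, hQ₁, hQ₁b⟩
    -- The operands have `9 * b` bits and the expression has degree `4`, whence `(4 + 1) * 9 = 45`;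
    -- the copy that follows needs `90 * b`, still below `L`.
    replace hQ₁b : ∀ i j : Fin n, |(σ.gain r * σ.Q i j - (σ.Q *ᵥ r) i * (σ.Q *ᵥ r) j) / σ.G|
        ≤ 2 ^ (45 * b) := fun i j => (hQ₁b i j).trans (pow_two_mono (by
          simp only [Expr.deg]; omega))
    have l45 := leaf_bounds D (by omega : b ≤ 45 * b)
    have hc₂ : Ctx M a (((s.setArr 6 f).setArr 7 g).setArr 10 Q₁) := hc₁.agree (R := []) (K := [10])
      ⟨fun _ _ => rfl, fun k hk => by simp at hk; simp [hk]⟩ (by simp) (by simp)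
    refine Does.seq (τ₁ := 1) (τ₂ := 1) (Does.fillMat D hc₂ hs₂ (k := 4) (z := 4) (b' := 45 * b)
      (.of fun i j => (σ.gain r * σ.Q i j - (σ.Q *ᵥ r) i * (σ.Q *ᵥ r) j) / σ.G) (by omega)
      (by simp) hc₂.r4 (by omega) (by decide) ?_ ?_ (by simpa using l45.1) ?_ (by decide) ?_ ?_) ?_
    · simp [Expr.Avoids]
    · simp [Expr.SmallConsts]
    · simp only [Expr.deg]; omega
    · intro i j t
      simp [Expr.Leaves, Expr.eval, l45, hQ₁ _ _, hQ₁b]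
    · intro i j
      simp [Expr.eval, hQ₁ _ _]
    rintro s₃ hs₃ - ⟨Q₂, rfl, hQ₂, -⟩
    refine (Does.set (by omega) hs₃ (by simp [Expr.SmallConsts]) (by decide) (by simp) ?_).mono
      le_rfl (List.Subset.refl _) (List.Subset.refl _) ?_
    · simpa [Expr.eval, hg] using hgb.trans (pow_two_mono (by omega))
    rintro s₄ - - rfl
    rw [hstep]
    exact ⟨by simpa using hQ₂, by simp [Expr.eval, hg]⟩
  · replace hneg : ¬ 0 < σ.gain r := by simpa [Expr.eval, hg] using hneg
    refine (Does.skip hs₁ (P := fun s' => IsGS s' (σ.step r)) ?_).mono (by omega)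
      (List.Subset.refl _) (List.Subset.refl _) fun _ _ _ h => h
    rw [GramSchmidt.step, if_neg hneg]
    exact ⟨by simpa using hσ.1, by simpa using hσ.2⟩

end

end Ram

namespace Ram

open Matrix StateTransfer

variable {n : ℕ}

/-! ### Lists in memory -/

/-- The cells of `f` from `o` on contain the list. -/
def HoldsAt (f : ℤ → ℤ) (o : ℤ) (l : List ℤ) : Prop := ∀ i (h : i < l.length), f (o + i) = l[i]

theorem HoldsAt.nil (f : ℤ → ℤ) (o : ℤ) : HoldsAt f o [] := fun i h => absurd h (by simp)

theorem holdsAt_cons {f : ℤ → ℤ} {o x : ℤ} {l : List ℤ} :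
    HoldsAt f o (x :: l) ↔ f o = x ∧ HoldsAt f (o + 1) l := by
  constructor
  · intro h
    have h0 : f (o + (0 : ℕ)) = x := h 0 (by simp)
    refine ⟨by simpa using h0, fun i hi => ?_⟩
    have := h (i + 1) (by simpa using hi)
    rw [show o + 1 + (i : ℤ) = o + ((i + 1 : ℕ) : ℤ) by push_cast; ring, this]
    simp
  · rintro ⟨h1, h2⟩ i hi
    rcases i with - | i
    · simpa using h1
    · have := h2 i (by simpa using hi)
      rw [show o + ((i + 1 : ℕ) : ℤ) = o + 1 + (i : ℤ) by push_cast; ring, this]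
      simp

theorem holdsAt_append {f : ℤ → ℤ} {o : ℤ} {l l' : List ℤ} :
    HoldsAt f o (l ++ l') ↔ HoldsAt f o l ∧ HoldsAt f (o + l.length) l' := by
  induction l generalizing o with
  | nil => simp [HoldsAt.nil]
  | cons x l ih =>
    rw [List.cons_append, holdsAt_cons, ih, holdsAt_cons, and_assoc]
    simp only [List.length_cons]
    push_cast
    rw [show o + 1 + (l.length : ℤ) = o + (l.length + 1) by ring]

theorem HoldsAt.congr {f f' : ℤ → ℤ} {o : ℤ} {l : List ℤ} (h : HoldsAt f o l)
    (hf : ∀ c, o ≤ c → c < o + l.length → f' c = f c) : HoldsAt f' o l := by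
  intro i hi
  rw [hf _ (by omega) (by omega)]
  exact h i hi

theorem HoldsAt.congr_offset {f f' : ℤ → ℤ} {o o' : ℤ} {l : List ℤ} (h : HoldsAt f o l)
    (ho : o' = o) (hf : ∀ c, o ≤ c → f' c = f c) : HoldsAt f' o' l := by
  subst ho
  exact h.congr fun c hc _ => hf c hc

theorem holdsAt_pairs {f : ℤ → ℤ} {o : ℤ} {l : List (ℤ × ℤ)}
    (h : ∀ i (hi : i < l.length), f (o + 2 * i) = l[i].1 ∧ f (o + 2 * i + 1) = l[i].2) :
    HoldsAt f o (l.flatMap fun z => [z.1, z.2]) := by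
  induction l generalizing o with
  | nil => exact HoldsAt.nil f o
  | cons z l ih =>
    have h0 := h 0 (by simp)
    simp only [Nat.cast_zero, mul_zero, add_zero, List.getElem_cons_zero] at h0
    simp only [List.flatMap_cons, List.cons_append, List.nil_append]
    rw [holdsAt_cons, holdsAt_cons]
    refine ⟨h0.1, h0.2, ih fun i hi => ?_⟩
    have := h (i + 1) (by simpa using hi)
    push_cast at this
    rw [show o + 2 * ((i : ℤ) + 1) = o + 1 + 1 + 2 * i by ring] at this
    simpa using this

theorem length_encodeVector (x : Fin n → ℤ × ℤ) : (encodeVector x).length = 2 * n := by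
  have : ∀ l : List (ℤ × ℤ), (l.flatMap fun z => [z.1, z.2]).length = 2 * l.length := by
    intro l
    induction l with
    | nil => rfl
    | cons z l ih => simp only [List.flatMap_cons, List.length_append, ih, List.length_cons,
        List.length_nil]; ring
  simp [encodeVector, this]

theorem holdsAt_encodeVector {f : ℤ → ℤ} {o : ℤ} {x : Fin n → ℤ × ℤ}
    (h : ∀ j : Fin n, f (o + 2 * (j : ℕ)) = (x j).1 ∧ f (o + 2 * (j : ℕ) + 1) = (x j).2) :
    HoldsAt f o (encodeVector x) := by
  refine holdsAt_pairs fun i hi => ?_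
  simpa using h ⟨i, by simpa using hi⟩

/-! ### Writing down an eigenvector -/

/-- Parity of the content of register `20`. -/
def parity : Expr := .reg 20 -ₑ .const 2 *ₑ (.reg 20 /ₑ .const 2)

/-- The cells of the encoding of the vector `(B + f + q √Δ) w`, as sums over register `22`. -/
def eigenvectorCell : Expr :=
  (.const 1 -ₑ parity) *ₑ (entry 2 (.reg 20 /ₑ .const 2) (.reg 22) *ₑ .read 6 (.reg 22)) +ₑ
    ifEq (.reg 22) (.reg 20 /ₑ .const 2) *ₑ .read 6 (.reg 22) *ₑ
      ((.const 1 -ₑ parity) *ₑ (.const 1 /ₑ (.const 1 +ₑ .reg 8 *ₑ .reg 8)) +ₑ parity *ₑ .reg 8)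

/-- Append an eigenvector to the output. -/
def writeVectorProg : Prog :=
  fillSum 1 1 24 2 eigenvectorCell ;;
  .set 1 (.reg 1 +ₑ .reg 24) ;;
  .set 17 (.reg 17 +ₑ .const 1)

section
variable {b L N : ℕ} {M : Matrix (Fin n) (Fin n) ℤ} {a : Fin n} {s : Store}

/-- Even cells hold the integer parts and odd cells the `√Δ`-parts. The sum over register `22`
computes `(B w) j`, and a Kronecker delta extracts `w j` from the same sum. -/
theorem eigenvectorCell_sum (hc : Ctx M a s) {B : Matrix (Fin n) (Fin n) ℤ} {w : Fin n → ℤ}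
    (hB : IsMat (s.arr 2) B) (hw : IsVec (s.arr 6) w) (j : Fin n) :
    sumAt s n eigenvectorCell (2 * (j : ℕ)) = (eigenvectorOf B (s.reg 8) w j).1 ∧
      sumAt s n eigenvectorCell (2 * (j : ℕ) + 1) = (eigenvectorOf B (s.reg 8) w j).2 := by
  have e1 : (2 * ((j : ℕ) : ℤ)) / 2 = (j : ℕ) := by omega
  have e2 : (2 * ((j : ℕ) : ℤ) + 1) / 2 = (j : ℕ) := by omega
  have e3 : ((j : ℕ) : ℤ) < n := by have := j.2; omega
  constructor
  · rw [sumAt, Finset.sum_range]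
    simp only [eigenvectorCell, parity, entry, Expr.eval, ifEq_eval, Store.setReg_reg,
      Store.setReg_arr, reduceIte, Nat.reduceEqDiff, e1, hc.r2, hB _ _, hw.at, sub_self, sub_zero,
      one_mul, zero_mul, add_zero, Finset.sum_add_distrib, ite_mul, Nat.cast_inj, ← Fin.ext_iff,
      Finset.sum_ite_eq', Finset.mem_univ, if_true, eigenvectorOf, mulVec, dotProduct]
    ring
  · rw [sumAt, Finset.sum_range]
    have e4 : 2 * ((j : ℕ) : ℤ) + 1 - 2 * ((j : ℕ) : ℤ) = 1 := by ring
    simp only [eigenvectorCell, parity, entry, Expr.eval, ifEq_eval, Store.setReg_reg,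
      Store.setReg_arr, reduceIte, Nat.reduceEqDiff, e2, e4, hc.r2, hB _ _, hw.at, sub_self,
      one_mul, zero_mul, zero_add, ite_mul, Nat.cast_inj, ← Fin.ext_iff,
      Finset.sum_ite_eq', Finset.mem_univ, if_true, eigenvectorOf]
    ring

theorem writeVectorProg_spec (D : Dim n b L N) (hc : Ctx M a s) (hs : s.Bdd L)
    {B : Matrix (Fin n) (Fin n) ℤ} {w : Fin n → ℤ} (hB : IsMat (s.arr 2) B)
    (hBb : ∀ i j, |B i j| ≤ 2 ^ b) (hw : IsVec (s.arr 6) w) (hwb : ∀ i, |w i| ≤ 2 ^ (9 * b))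
    (hq : |s.reg 8| ≤ 2 ^ b) (h1 : |s.reg 1 + (2 * n : ℕ)| ≤ 2 ^ b)
    (h17 : |s.reg 17 + 1| ≤ 2 ^ b) :
    Does N L writeVectorProg s 3 [1, 17] [1] fun s' => s'.reg 1 = s.reg 1 + (2 * n : ℕ) ∧
      s'.reg 17 = s.reg 17 + 1 ∧
      HoldsAt (s'.arr 1) (s.reg 1) (encodeVector (eigenvectorOf B (s.reg 8) w)) ∧
      ∀ c < s.reg 1, s'.arr 1 c = s.arr 1 c := by
  have hbL := D.bits
  have hb3 := D.three_le
  have hN := D.two_mul_le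
  have l9 := leaf_bounds D (by omega : b ≤ 9 * b)
  have hBb9 : ∀ i j, |B i j| ≤ 2 ^ (9 * b) := fun i j => (hBb i j).trans (pow_two_mono (by omega))
  refine Does.seq (τ₁ := 1) (τ₂ := 2) (Does.fill (b := 9 * b) (by omega) hs hc.r20 hc.r21 hc.r22
    (x := 1) hc.r24 hc.r2 hN (by omega) (by decide) (by decide) (by decide) ?_ ?_ l9.2.2.1 ?_
    (by decide) (by simp) ?_) ?_
  · simp [Expr.Avoids, eigenvectorCell, entry, parity]
  · simp [Expr.SmallConsts, eigenvectorCell, entry, parity]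
  -- The degree is `17` and the operands have `9 * b` bits: `18 * 9 = 162`, the largest multiple of
  -- `b` that occurs, is covered by the `200` in `Dim`.
  · simp only [Expr.deg, eigenvectorCell, entry, parity, ifEq]; omega
  · intro c hc' t ht
    obtain ⟨j, hj⟩ : ∃ j : Fin n, (c : ℤ) / 2 = (j : ℕ) :=
      ⟨⟨c / 2, by omega⟩, by simp⟩
    have hcb : (c : ℤ) ≤ 2 ^ (9 * b) := by
      have : c ≤ n * n ∨ c ≤ 2 := by
        rcases Nat.lt_or_ge n 2 with h | h
        · right; omega
        · left; nlinarith
      rcases this with h | h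
      · have h' : (c : ℤ) ≤ (n * n : ℕ) := by exact_mod_cast h
        exact h'.trans (D.sq_le_pow.trans (pow_two_mono (by omega)))
      · have h' : (c : ℤ) ≤ 2 := by exact_mod_cast h
        exact h'.trans l9.2.1
    obtain ⟨t', rfl⟩ : ∃ t' : Fin n, t = (t' : ℕ) := ⟨⟨t, ht⟩, rfl⟩
    have hq9 : |s.reg 8| ≤ 2 ^ (9 * b) := hq.trans (pow_two_mono (by omega))
    simp [Expr.Leaves, Expr.eval, eigenvectorCell, entry, parity, hc.r2, hj, l9, hB _ _, hw.at, hBb9,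
      hwb, hcb, hq9]
  rintro s₁ hs₁ - rfl
  refine Does.seq (τ₁ := 1) (τ₂ := 1) (Does.set (by omega) hs₁ (by simp [Expr.SmallConsts])
    (by decide) (by simp) ?_) ?_
  · simp only [Expr.eval, Store.setArr_reg, hc.r24]
    exact h1.trans (pow_two_mono (by omega))
  rintro s₂ hs₂ - rfl
  refine (Does.set (by omega) hs₂ (by simp [Expr.SmallConsts]) (by decide) (by simp) ?_).mono le_rfl
    (List.Subset.refl _) (List.Subset.refl _) ?_
  · simp only [Expr.eval, Store.setArr_reg, Store.setReg_reg, Nat.reduceEqDiff, reduceIte]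
    exact h17.trans (pow_two_mono (by omega))
  rintro s₃ - - rfl
  refine ⟨by simp [Expr.eval, hc.r24], by simp [Expr.eval], holdsAt_encodeVector fun j => ?_,
    fun c hcl => ?_⟩
  · have hj := j.2
    have := eigenvectorCell_sum hc hB hw j
    simp only [Store.setReg_arr, Store.setArr_arr, reduceIte, filled]
    rw [if_pos (by push_cast; omega), if_pos (by push_cast; omega), ← this.1, ← this.2]
    constructor <;> congr 1 <;> ring
  · simp only [Store.setReg_arr, Store.setArr_arr, reduceIte, filled]
    rw [if_neg (by omega)]

end

end Ram

/-! ### Kernels and the treatment of one coordinate -/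

namespace Ram

open Matrix StateTransfer

variable {n : ℕ}

/-- Array `5` becomes a row of the matrix in array `k`; the number of the row is in register `10`. -/
def loadRow (k : ℕ) : Prog := fillSum 5 23 2 4 (entry k (.reg 10) (.reg 20))

/-- Array `5` becomes a standard basis vector, whose number is in register `10`. -/
def loadUnit : Prog := fillSum 5 23 2 4 (ifEq (.reg 20) (.reg 10))

/-- Orthogonalization of the rows of the matrix in array `3`. -/
def kernelProg : Prog :=
  fillSum 4 23 3 4 (ifEq rowIdx colIdx) ;; .set 9 (.const 1) ;; forLoop 10 2 (loadRow 3 ;; stepProg)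

/-- Deal with one coordinate in the construction of a basis of an eigenspace. -/
def coordinateProg : Prog :=
  loadUnit ;; projectProg ;; .ifPos (.read 7 (.const 0)) writeVectorProg .skip ;; stepProg ;;
    loadRow 2 ;; stepProg

section
variable {b L N : ℕ} {M : Matrix (Fin n) (Fin n) ℤ} {a : Fin n} {s : Store} {R K : List ℕ}

theorem Ctx.setArr (hc : Ctx M a s) {k : ℕ} (hk : k ≠ 0) (f : ℤ → ℤ) : Ctx M a (s.setArr k f) :=
  hc.agree (R := []) (K := [k]) ⟨fun _ _ => rfl, fun j hj => by simp at hj; simp [hj]⟩ (by simp)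
    (by simpa using hk.symm)

theorem loadRow_spec (D : Dim n b L N) (hc : Ctx M a s) (hs : s.Bdd L) {k : ℕ} (hk : k ≠ 5)
    (hw : (entry k (.reg 10) (.reg 20)).weight + (entry k (.reg 10) (.reg 20)).deg ≤ 350)
    (hK : 5 ∈ K) {A : Matrix (Fin n) (Fin n) ℤ} (hA : IsMat (s.arr k) A)
    (hAb : ∀ i j, |A i j| ≤ 2 ^ b) {i : Fin n} (hi : s.reg 10 = (i : ℕ)) :
    Does N L (loadRow k) s 1 R K fun s' => ∃ f, s' = s.setArr 5 f ∧ IsVec f (A i) := by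
  have hbL := D.bits
  have hN := D.two_mul_le
  have hn1 := D.pos
  have l := leaf_bounds D (le_refl b)
  refine (Does.fillVec D hc hs (k := 5) (y := 2) (z := 4) (A i) le_rfl hK hc.r2 hc.r4 (by omega)
    (by omega) (by decide) (by decide) ?_ ?_ (by simpa using l.1) ?_ hw ?_ ?_).mono le_rfl
    (List.Subset.refl _) (List.Subset.refl _) ?_
  · simp [Expr.Avoids, entry, hk]
  · simp [Expr.SmallConsts, entry]
  · simp only [Expr.deg, entry]; omega
  · intro j t
    simp [Expr.Leaves, Expr.eval, entry, hc.r2, hi, l, hA _ _, hAb]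
  · intro j
    simp [Expr.eval, entry, hc.r2, hi, hA _ _]
  · rintro s' - - ⟨f, rfl, hf, -⟩
    exact ⟨f, rfl, hf⟩

theorem loadUnit_spec (D : Dim n b L N) (hc : Ctx M a s) (hs : s.Bdd L) (hK : 5 ∈ K) {i : Fin n}
    (hi : s.reg 10 = (i : ℕ)) :
    Does N L loadUnit s 1 R K fun s' => ∃ f, s' = s.setArr 5 f ∧ IsVec f (Pi.single i 1) := by
  have hbL := D.bits
  have hN := D.two_mul_le
  have hn1 := D.pos
  have l := leaf_bounds D (le_refl b)
  refine (Does.fillVec D hc hs (k := 5) (y := 2) (z := 4) (Pi.single i 1) le_rfl hK hc.r2 hc.r4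
    (by omega) (by omega) (by decide) (by decide) ?_ ?_ (by simpa using l.1) ?_ (by decide)
    ?_ ?_).mono le_rfl (List.Subset.refl _) (List.Subset.refl _) ?_
  · simp [Expr.Avoids]
  · simp [Expr.SmallConsts]
  · simp only [Expr.deg, ifEq]; omega
  · intro j t
    simp [Expr.Leaves, hi, l]
  · intro j
    simp [Expr.eval, hi, Pi.single_apply, Fin.ext_iff]
  · rintro s' - - ⟨f, rfl, hf, -⟩
    exact ⟨f, rfl, hf⟩

/-- After `m` rows the state is valid for them and `G ≤ C ^ m`. `B` is arbitrary because `processed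
A B 0` consists of the rows of `A` alone. -/
theorem kernelProg_spec (D : Dim n b L N) (hc : Ctx M a s) (hs : s.Bdd L)
    {A : Matrix (Fin n) (Fin n) ℤ} (B : Matrix (Fin n) (Fin n) ℤ) (hA : IsMat (s.arr 3) A)
    (hAb : ∀ i j, |A i j| ≤ 2 ^ b) {C : ℤ} (hC : 1 ≤ C) (hAC : ∀ i, A i ⬝ᵥ A i ≤ C)
    (hCb : C ^ n ≤ 2 ^ b) :
    Does N L kernelProg s (2 + (n + 1) * 8) [9, 10] [4, 5, 6, 7, 10] fun s' =>
      ∃ σ : GramSchmidt n, IsGS s' σ ∧ σ.Valid (processed A B 0) ∧ σ.G ≤ C ^ n := by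
  have hbL := D.bits
  have hb3 := D.three_le
  have hN := D.two_mul_le
  have hn1 := D.pos
  have l := leaf_bounds D (le_refl b)
  refine (Does.seq (τ₁ := 1) (τ₂ := 1 + (n + 1) * 8) (Does.fillMat D hc hs (k := 4) (z := 4)
    (1 : Matrix (Fin n) (Fin n) ℤ) le_rfl (by simp) hc.r4 (by omega) (by decide) ?_ ?_
    (by simpa using l.1) ?_ (by decide) ?_ ?_) ?_).mono (by omega) (List.Subset.refl _)
    (List.Subset.refl _) fun _ _ _ h => h
  · simp [Expr.Avoids, rowIdx, colIdx]
  · simp [Expr.SmallConsts, rowIdx, colIdx]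
  · simp only [Expr.deg, ifEq]; omega
  · intro i j t
    simp [Expr.Leaves, rowIdx, colIdx, hc.r2, l]
  · intro i j
    simp [Expr.eval, rowIdx, colIdx, hc.r2, row_ediv, col_sub, Matrix.one_apply, Fin.ext_iff]
  rintro s₁ hs₁ - ⟨f, rfl, hf, -⟩
  refine Does.seq (Does.set (by omega) hs₁ (by simp [Expr.SmallConsts]) (by decide) (by simp) ?_) ?_
  · simpa [Expr.eval] using l.1.trans (pow_two_mono (by omega))
  rintro s₂ hs₂ - rfl
  have hc₂ : Ctx M a ((s.setArr 4 f).setReg 9 ((Expr.const 1).eval (s.setArr 4 f))) :=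
    (hc.setArr (by decide) f).agree (R := [9]) (K := []) ⟨fun x hx => by
      simp at hx; simp [hx], fun _ _ => rfl⟩ (by decide) (by decide)
  refine (Does.for (τ := 7) (by omega) hs₂ hc₂.r2 (by decide) (by simp) (R' := [9]) (by decide)
    (by simp) (fun m s' => ∃ σ : GramSchmidt n, IsGS s' σ ∧
      σ.Valid {r | ∃ i : Fin n, (i : ℕ) < m ∧ r = A i} ∧ σ.G ≤ C ^ m) ?_ ?_).mono le_rfl
    (List.Subset.refl _) (List.Subset.refl _) ?_
  · refine ⟨GramSchmidt.init n, ⟨by simpa [GramSchmidt.init] using hf, by simp [Expr.eval, GramSchmidt.init]⟩, ?_,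
      by simp [GramSchmidt.init]⟩
    convert GramSchmidt.valid_init (n := n) using 1
    ext r; simp
  · rintro m s₃ hm hs₃ hag h10 ⟨σ, hσ, hv, hG⟩
    have hc₃ : Ctx M a s₃ := hc₂.agree hag (by decide) (by decide)
    have hA₃ : IsMat (s₃.arr 3) A := by
      rw [hag.arr 3 (by decide)]; simpa using hA
    refine Does.seq (τ₁ := 1) (τ₂ := 6) (loadRow_spec D hc₃ hs₃ (by decide) (by decide) (by simp) hA₃
      hAb (i := ⟨m, hm⟩) h10) ?_
    rintro s₄ hs₄ - ⟨r, rfl, hr⟩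
    have hGb : σ.G ≤ 2 ^ b := hG.trans ((pow_le_pow_right₀ hC hm.le).trans hCb)
    refine (stepProg_spec D (hc₃.setArr (by decide) r) hs₄ (σ := σ) ⟨by simpa using hσ.1, by
      simpa using hσ.2⟩ hv hGb (by simpa using hr) (hAb _)).mono le_rfl (by simp) (by simp) ?_
    intro s₅ _ _ hσ'
    refine ⟨_, ⟨by simpa using hσ'.1, by simpa using hσ'.2⟩, ?_, ?_⟩
    · convert hv.step (A ⟨m, hm⟩) using 1
      ext r'
      simp only [Set.mem_ofPred_eq, Set.mem_insert_iff]
      constructor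
      · rintro ⟨i, hi, rfl⟩
        rcases Nat.lt_succ_iff_lt_or_eq.1 hi with h | h
        · exact .inr ⟨i, h, rfl⟩
        · left; congr 1; exact Fin.ext h
      · rintro (rfl | ⟨i, hi, rfl⟩)
        exacts [⟨⟨m, hm⟩, by simp, rfl⟩, ⟨i, by omega, rfl⟩]
    · rw [pow_succ]
      exact (hv.step_G_le _ hC (hAC _)).trans (mul_le_mul_of_nonneg_right hG (by omega))
  · rintro s₃ - - ⟨σ, hσ, hv, hG⟩
    refine ⟨σ, hσ, ?_, hG⟩
    convert hv using 1
    ext r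
    simp [processed]

/-- Effect of dealing with one coordinate on the output. -/
structure Appended (s s' : Store) (v : Fin n → ℤ × ℤ) : Prop where
  reg1 : s'.reg 1 = s.reg 1 + (2 * n : ℕ)
  reg17 : s'.reg 17 = s.reg 17 + 1
  holds : HoldsAt (s'.arr 1) (s.reg 1) (encodeVector v)
  keep : ∀ c < s.reg 1, s'.arr 1 c = s.arr 1 c

/-- The vector to be written is `Q e_j` for the state before `e_j` is processed. Writing it leaves
array `5` alone, so the same `e_j` is processed next, followed by row `j` of `B`: two steps, hence
`C ^ (k + 2)`. -/
theorem coordinateProg_spec (D : Dim n b L N) (hc : Ctx M a s) (hs : s.Bdd L)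
    {A B : Matrix (Fin n) (Fin n) ℤ} (hB : IsMat (s.arr 2) B) (hBb : ∀ i j, |B i j| ≤ 2 ^ b)
    {C : ℤ} (hC : 1 ≤ C) (hBC : ∀ i, B i ⬝ᵥ B i ≤ C) {k : ℕ} (hCb : C ^ (k + 1) ≤ 2 ^ b)
    {σ : GramSchmidt n} {j : Fin n} (hj : s.reg 10 = (j : ℕ)) (hσ : IsGS s σ)
    (hv : σ.Valid (processed A B j)) (hG : σ.G ≤ C ^ k)
    (hq : |s.reg 8| ≤ 2 ^ b) (h1 : |s.reg 1 + (2 * n : ℕ)| ≤ 2 ^ b)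
    (h17 : |s.reg 17 + 1| ≤ 2 ^ b) :
    Does N L coordinateProg s 20 [1, 9, 17] [1, 4, 5, 6, 7, 10] fun s' =>
      (∃ σ' : GramSchmidt n, IsGS s' σ' ∧ σ'.Valid (processed A B (j + 1)) ∧ σ'.G ≤ C ^ (k + 2)) ∧
      (0 < σ.gain (Pi.single j 1) ∧
          Appended s s' (eigenvectorOf B (s.reg 8) (σ.Q *ᵥ Pi.single j 1)) ∨
        σ.gain (Pi.single j 1) ≤ 0 ∧ s'.reg 1 = s.reg 1 ∧ s'.reg 17 = s.reg 17 ∧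
          s'.arr 1 = s.arr 1) := by
  have hbL := D.bits
  have hb3 := D.three_le
  have hN := D.two_mul_le
  have hn1 := D.pos
  have l := leaf_bounds D (le_refl b)
  have hC0 : (0 : ℤ) ≤ C := by omega
  have hG1 : σ.G ≤ 2 ^ b := hG.trans ((pow_le_pow_right₀ hC (by omega)).trans hCb)
  have hunit : ∀ i, |(Pi.single j 1 : Fin n → ℤ) i| ≤ 2 ^ b := by
    intro i
    rw [Pi.single_apply]
    split_ifs
    · simpa using l.1
    · simp
  have hQ : ∀ i j, |σ.Q i j| ≤ 2 ^ b := fun i j => (hv.abs_le i j).trans hG1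
  have hs2 : (σ.step (Pi.single j 1)).G ≤ C ^ (k + 1) := by
    rw [pow_succ]
    exact (hv.step_G_le _ hC (by simpa using hC)).trans (mul_le_mul_of_nonneg_right hG hC0)
  have hv2 := hv.step (Pi.single j 1)
  refine Does.seq (τ₁ := 1) (τ₂ := 19) (loadUnit_spec D hc hs (by simp) hj) ?_
  rintro s₁ hs₁ - ⟨r, rfl, hr⟩
  have hc₁ := hc.setArr (k := 5) (by decide) r
  refine Does.seq (τ₁ := 2) (τ₂ := 17) (projectProg_spec D hc₁ hs₁ (by simp) (by simp) (σ := σ)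
    ⟨by simpa using hσ.1, by simpa using hσ.2⟩ (by simpa using hr) hunit hQ) ?_
  rintro s₂ hs₂ - ⟨f, g, rfl, hf, hfb, hg, -⟩
  have hc₂ := (hc₁.setArr (k := 6) (by decide) f).setArr (k := 7) (by decide) g
  -- writing the vector
  refine Does.seq (τ₁ := 4) (τ₂ := 13) (P := fun s' =>
    Agree [1, 17] [1] (((s.setArr 5 r).setArr 6 f).setArr 7 g) s' ∧
    (0 < σ.gain (Pi.single j 1) ∧
        Appended s s' (eigenvectorOf B (s.reg 8) (σ.Q *ᵥ Pi.single j 1)) ∨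
      σ.gain (Pi.single j 1) ≤ 0 ∧ s'.reg 1 = s.reg 1 ∧ s'.reg 17 = s.reg 17 ∧
        s'.arr 1 = s.arr 1)) ?_ ?_
  · refine Does.ifPos (by omega) hs₂ (by simp [Expr.SmallConsts]) (by decide) (fun hpos => ?_)
      (fun hneg => ?_)
    · replace hpos : 0 < σ.gain (Pi.single j 1) := by simpa [Expr.eval, hg] using hpos
      refine (writeVectorProg_spec D hc₂ hs₂ (B := B) (w := σ.Q *ᵥ Pi.single j 1)
        (by simpa using hB) hBb (by simpa using hf) hfb (by simpa using hq) (by simpa using h1)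
        (by simpa using h17)).mono le_rfl (by simp) (by simp) ?_
      rintro s₃ - hag ⟨h3, h4, h5, h6⟩
      exact ⟨hag, .inl ⟨hpos, ⟨by simpa using h3, by simpa using h4, by simpa using h5,
        by simpa using h6⟩⟩⟩
    · replace hneg : σ.gain (Pi.single j 1) ≤ 0 := by simpa [Expr.eval, hg] using hneg
      exact (Does.skip hs₂ ⟨.refl _ _ _, .inr ⟨hneg, by simp, by simp, by simp⟩⟩).mono (by omega)
        (List.Subset.refl _) (List.Subset.refl _) fun _ _ _ h => h
  rintro s₃ hs₃ - ⟨hag₃, hout₃⟩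
  have hc₃ : Ctx M a s₃ := hc₂.agree hag₃ (by decide) (by decide)
  have hσ₃ : IsGS s₃ σ := by
    refine ⟨?_, ?_⟩
    · rw [hag₃.arr 4 (by decide)]; simpa using hσ.1
    · rw [hag₃.reg 9 (by decide)]; simpa using hσ.2
  have hr₃ : IsVec (s₃.arr 5) (Pi.single j 1) := by
    rw [hag₃.arr 5 (by decide)]; simpa using hr
  refine Does.seq (τ₁ := 6) (τ₂ := 7) ((stepProg_spec D hc₃ hs₃ hσ₃ hv hG1 hr₃ hunit).mono le_rfl
    (R' := [1, 9, 17]) (K' := [1, 4, 5, 6, 7, 10]) (by simp) (by simp)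
    (P' := fun s' => IsGS s' (σ.step (Pi.single j 1)) ∧ Agree [9] [4, 6, 7, 10] s₃ s')
    fun s' _ h h' => ⟨h', h⟩) ?_
  rintro s₄ hs₄ - ⟨hσ₄, hag₄⟩
  have hc₄ : Ctx M a s₄ := hc₃.agree hag₄ (by decide) (by decide)
  have hB₄ : IsMat (s₄.arr 2) B := by
    rw [hag₄.arr 2 (by decide), hag₃.arr 2 (by decide)]; simpa using hB
  have hj₄ : s₄.reg 10 = (j : ℕ) := by
    rw [hag₄.reg 10 (by decide), hag₃.reg 10 (by decide)]; simpa using hj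
  refine Does.seq (τ₁ := 1) (τ₂ := 6) (loadRow_spec D hc₄ hs₄ (by decide) (by decide) (by simp) hB₄
    hBb hj₄) ?_
  rintro s₅ hs₅ - ⟨r', rfl, hr'⟩
  refine (stepProg_spec D (hc₄.setArr (by decide) r') hs₅ (σ := σ.step (Pi.single j 1))
    ⟨by simpa using hσ₄.1, by simpa using hσ₄.2⟩ hv2 (hs2.trans hCb) (by simpa using hr')
    (hBb _)).mono le_rfl (by simp) (by simp) ?_
  intro s₆ _ hag₆ hσ₆
  refine ⟨⟨_, hσ₆, ?_, ?_⟩, ?_⟩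
  · rw [← processed_succ]; exact hv2.step _
  · rw [pow_succ]
    exact (hv2.step_G_le _ hC (hBC _)).trans (mul_le_mul_of_nonneg_right hs2 hC0)
  · have e1 : s₆.reg 1 = s₃.reg 1 := by
      rw [hag₆.reg 1 (by decide)]; exact hag₄.reg 1 (by decide)
    have e2 : s₆.reg 17 = s₃.reg 17 := by
      rw [hag₆.reg 17 (by decide)]; exact hag₄.reg 17 (by decide)
    have e3 : s₆.arr 1 = s₃.arr 1 := by
      rw [hag₆.arr 1 (by decide)]
      simpa using hag₄.arr 1 (by decide)
    rcases hout₃ with ⟨h, h'⟩ | ⟨h, h', h'', h'''⟩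
    · exact .inl ⟨h, ⟨e1.trans h'.reg1, e2.trans h'.reg17, by rw [e3]; exact h'.holds,
        by rw [e3]; exact h'.keep⟩⟩
    · exact .inr ⟨h, e1.trans h', e2.trans h'', e3.trans h'''⟩

end

end Ram

/-! ### The basis of one eigenspace -/

namespace Ram

open Matrix StateTransfer

variable {n : ℕ}

/-- Write down the entry for the eigenvalue with `q` in register `28`. -/
def basisProg : Prog :=
  .set 18 (.reg 1) ;; .set 1 (.reg 1 +ₑ .const 2) ;; .set 17 (.const 0) ;;
  forLoop 10 2 coordinateProg ;;
  .write 1 (.reg 18) (.reg 28) ;; .write 1 (.reg 18 +ₑ .const 1) (.reg 17) ;;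
  .set 19 (.reg 19 +ₑ .const 1)

/-- Bounds for the vectors that are orthogonalized. -/
structure Fits (b : ℕ) (C : ℤ) (A B : Matrix (Fin n) (Fin n) ℤ) : Prop where
  one_le : 1 ≤ C
  left_le : ∀ i j, |A i j| ≤ 2 ^ b
  right_le : ∀ i j, |B i j| ≤ 2 ^ b
  left_sq : ∀ i, A i ⬝ᵥ A i ≤ C
  right_sq : ∀ i, B i ⬝ᵥ B i ≤ C
  pow_le : C ^ (3 * n) ≤ 2 ^ b

/-- The part of the output that belongs to an eigenvalue. -/
def encodeEntry (e : ℤ × List (Fin n → ℤ × ℤ)) : List ℤ :=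
  e.1 :: (e.2.length : ℤ) :: e.2.flatMap encodeVector

theorem length_flatMap_encodeVector (W : List (Fin n → ℤ × ℤ)) :
    (W.flatMap encodeVector).length = W.length * (2 * n) := by
  induction W with
  | nil => simp
  | cons v W ih =>
    rw [List.flatMap_cons, List.length_append, ih, length_encodeVector, List.length_cons]; ring

theorem length_encodeEntry (e : ℤ × List (Fin n → ℤ × ℤ)) :
    (encodeEntry e).length = 2 + e.2.length * (2 * n) := by
  simp only [encodeEntry, List.length_cons, length_flatMap_encodeVector]; ring

section
variable {b L N : ℕ} {M : Matrix (Fin n) (Fin n) ℤ} {a : Fin n} {s : Store} {R K : List ℕ}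

/-- Invariant of the construction of a basis; the entry starts at cell `o`. -/
structure BasisInv (s₀ s : Store) (A B : Matrix (Fin n) (Fin n) ℤ) (C Δ o : ℤ)
    (E : Submodule ℝ (EuclideanSpace ℝ (Fin n))) (j : ℕ) (σ : GramSchmidt n)
    (W : List (Fin n → ℤ × ℤ)) : Prop where
  gs : IsGS s σ
  valid : σ.Valid (processed A B j)
  le : σ.G ≤ C ^ (n + 2 * j)
  basis : PartialBasis Δ E j W
  length_le : W.length ≤ j
  reg1 : s.reg 1 = o + 2 + (W.length * (2 * n) : ℕ)
  reg17 : s.reg 17 = W.length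
  holds : HoldsAt (s.arr 1) (o + 2) (W.flatMap encodeVector)
  keep : ∀ c < o, s.arr 1 c = s₀.arr 1 c

theorem BasisInv.step {s₀ s s' s'' : Store} {A : Matrix (Fin n) (Fin n) ℤ} {C Δ o p : ℤ} {θ : ℝ}
    {j : Fin n} {σ σ' : GramSchmidt n} {W : List (Fin n → ℤ × ℤ)} (hM : M.IsSymm) (hΔ : 0 < Δ)
    (hsq : Squarefree Δ) (hq : s.reg 8 = 0 ∨ 1 < Δ) (hθ : 2 * θ = p + s.reg 8 * √(Δ : ℝ))
    (hA : A = sqShifted (shifted M p) (s.reg 8 * s.reg 8 * Δ))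
    (h : BasisInv s₀ s A (shifted M p) C Δ o (eigenspace M θ) j σ W)
    (hσ : IsGS s'' σ') (hv : σ'.Valid (processed A (shifted M p) (j + 1)))
    (hG : σ'.G ≤ C ^ (n + 2 * j + 2))
    (hreg : ∀ x ∈ [1, 17], s''.reg x = s'.reg x) (harr : s''.arr 1 = s'.arr 1)
    (hout : 0 < σ.gain (Pi.single j 1) ∧
        Appended s s' (eigenvectorOf (shifted M p) (s.reg 8) (σ.Q *ᵥ Pi.single j 1)) ∨
      σ.gain (Pi.single j 1) ≤ 0 ∧ s'.reg 1 = s.reg 1 ∧ s'.reg 17 = s.reg 17 ∧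
        s'.arr 1 = s.arr 1) :
    ∃ W', BasisInv s₀ s'' A (shifted M p) C Δ o (eigenspace M θ) (j + 1) σ' W' := by
  subst hA
  have h1 := hreg 1 (by simp)
  have h17 := hreg 17 (by simp)
  rcases hout with ⟨hg, ha⟩ | ⟨hg, ha1, ha17, haa⟩
  · refine ⟨W ++ [eigenvectorOf (shifted M p) (s.reg 8) (σ.Q *ᵥ Pi.single j 1)], hσ, hv, hG,
      partialBasis_step_pos hM hΔ hsq hq hθ h.valid h.basis hg, ?_, ?_, ?_, ?_, ?_⟩
    · simpa using h.length_le
    · rw [h1, ha.reg1, h.reg1, List.length_append]; simp; ring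
    · rw [h17, ha.reg17, h.reg17]; simp
    · rw [harr, List.flatMap_append, holdsAt_append, length_flatMap_encodeVector]
      refine ⟨h.holds.congr fun c _ hc => ha.keep c ?_, ?_⟩
      · rw [length_flatMap_encodeVector] at hc
        rw [h.reg1]; exact hc
      · have := ha.holds
        rw [h.reg1] at this
        simpa using this
    · intro c hc
      rw [harr, ha.keep c (by rw [h.reg1]; push_cast; nlinarith), h.keep c hc]
  · refine ⟨W, hσ, hv, hG, partialBasis_step_zero hΔ hθ h.valid h.basis hg, ?_, ?_, ?_, ?_, ?_⟩
    · have := h.length_le; omega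
    · rw [h1, ha1, h.reg1]
    · rw [h17, ha17, h.reg17]
    · rw [harr, haa]; exact h.holds
    · rw [harr, haa]; exact h.keep

/-- Two cells are reserved at the start of the entry and filled after the loop, when the number of
basis vectors is known. -/
theorem basisProg_spec (D : Dim n b L N) (hc : Ctx M a s) (hs : s.Bdd L) (hM : M.IsSymm)
    {Δ p : ℤ} {θ : ℝ} (hΔ : 0 < Δ) (hsq : Squarefree Δ) (hq : s.reg 8 = 0 ∨ 1 < Δ)
    (hθ : 2 * θ = p + s.reg 8 * √(Δ : ℝ)) (hB : IsMat (s.arr 2) (shifted M p)) {C : ℤ}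
    (hF : Fits b C (sqShifted (shifted M p) (s.reg 8 * s.reg 8 * Δ)) (shifted M p))
    {σ : GramSchmidt n} (hσ : IsGS s σ)
    (hv : σ.Valid (processed (sqShifted (shifted M p) (s.reg 8 * s.reg 8 * Δ)) (shifted M p) 0))
    (hG : σ.G ≤ C ^ n) (hqb : |s.reg 8| ≤ 2 ^ b) (h1 : 0 ≤ s.reg 1)
    (h1b : s.reg 1 + 2 + 2 * n * n ≤ 2 ^ b) (h19 : |s.reg 19 + 1| ≤ 2 ^ b) :
    Does N L basisProg s (6 + (n + 1) * 21) [1, 9, 10, 17, 18, 19] [1, 4, 5, 6, 7, 10] fun s' =>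
      ∃ W, PartialBasis Δ (eigenspace M θ) n W ∧ W.length ≤ n ∧
        s'.reg 1 = s.reg 1 + (encodeEntry (s.reg 28, W)).length ∧ s'.reg 19 = s.reg 19 + 1 ∧
        HoldsAt (s'.arr 1) (s.reg 1) (encodeEntry (s.reg 28, W)) ∧
        ∀ c < s.reg 1, s'.arr 1 c = s.arr 1 c := by
  have hbL := D.bits
  have hb3 := D.three_le
  have hpow : (2 : ℤ) ^ b ≤ 2 ^ L := pow_two_mono (by omega)
  have hn2 : (0 : ℤ) ≤ 2 * n * n := by positivity
  refine (Does.seq (τ₁ := 1) (τ₂ := 5 + (n + 1) * 21) (Does.set (by omega) hs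
    (by simp [Expr.SmallConsts]) (by decide) (by simp) (by simpa [Expr.eval] using hs.reg 1)) ?_).mono (by omega)
    (List.Subset.refl _) (List.Subset.refl _) fun _ _ _ h => h
  rintro s₁ hs₁ - rfl
  refine (Does.seq (τ₁ := 1) (τ₂ := 4 + (n + 1) * 21) (Does.set (by omega) hs₁
    (by simp [Expr.SmallConsts]) (by decide) (by simp) ?_) ?_).mono (by omega)
    (List.Subset.refl _) (List.Subset.refl _) fun _ _ _ h => h
  · have e : (Expr.reg 1 +ₑ Expr.const 2).eval (s.setReg 18 ((Expr.reg 1).eval s)) =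
        s.reg 1 + 2 := by simp [Expr.eval]
    rw [e, abs_of_nonneg (by omega)]
    omega
  rintro s₂ hs₂ - rfl
  refine (Does.seq (τ₁ := 1) (τ₂ := 3 + (n + 1) * 21) (Does.set (by omega) hs₂
    (by simp [Expr.SmallConsts]) (by decide) (by simp) (by simp [Expr.eval])) ?_).mono (by omega)
    (List.Subset.refl _) (List.Subset.refl _) fun _ _ _ h => h
  rintro s₃ hs₃ - hs₃e
  have hag₃ : Agree [1, 17, 18] [] s s₃ := by
    subst hs₃e
    refine ⟨fun x hx => ?_, fun k _ => rfl⟩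
    simp only [List.mem_cons, List.not_mem_nil, or_false, not_or] at hx
    simp [hx]
  have e1 : s₃.reg 1 = s.reg 1 + 2 := by subst hs₃e; simp [Expr.eval]
  have e17 : s₃.reg 17 = 0 := by subst hs₃e; simp [Expr.eval]
  have e18 : s₃.reg 18 = s.reg 1 := by subst hs₃e; simp [Expr.eval]
  clear hs₃e
  have harr₃ : s₃.arr = s.arr := funext fun k => hag₃.arr k (by simp)
  have hc₃ : Ctx M a s₃ := hc.agree hag₃ (by decide) (by decide)
  -- the loop
  refine (Does.seq (τ₁ := (n + 1) * 21) (τ₂ := 3) ((Does.for (τ := 20) (by omega) hs₃ hc₃.r2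
    (R := [1, 9, 10, 17]) (by decide) (by simp) (R' := [1, 9, 17]) (by decide) (by simp)
    (fun j s' => ∃ σ W, BasisInv s s' (sqShifted (shifted M p) (s.reg 8 * s.reg 8 * Δ))
      (shifted M p) C Δ (s.reg 1) (eigenspace M θ) j σ W) ?_ ?_).frame (by simp)
    (List.Subset.refl _)) ?_).mono (by omega)
    (List.Subset.refl _) (List.Subset.refl _) fun _ _ _ h => h
  · refine ⟨σ, [], ⟨⟨?_, ?_⟩, hv, by simpa using hG, PartialBasis.nil _ _, by simp,
      by simp [e1], by simp [e17], HoldsAt.nil _ _, fun c _ => by simp [harr₃]⟩⟩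
    · simpa [harr₃] using hσ.1
    · rw [Store.setReg_reg, if_neg (by decide), hag₃.reg 9 (by decide)]; exact hσ.2
  · rintro j s₄ hj hs₄ hag₄ h10 ⟨σ₁, W, hI⟩
    have hc₄ : Ctx M a s₄ := hc₃.agree hag₄ (by decide) (by decide)
    have e8 : s₄.reg 8 = s.reg 8 := by rw [hag₄.reg 8 (by decide), hag₃.reg 8 (by decide)]
    have hB₄ : IsMat (s₄.arr 2) (shifted M p) := by
      rw [hag₄.arr 2 (by decide), harr₃]; exact hB
    have hlen : ((W.length * (2 * n) : ℕ) : ℤ) + (2 * n : ℕ) ≤ 2 * n * n := by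
      have h2 := hI.length_le
      have h3 : (W.length + 1) * (2 * n) ≤ n * (2 * n) := Nat.mul_le_mul_right _ (by omega)
      zify at h3
      push_cast
      linarith
    have hC := hF.one_le
    -- `n` rows of `A` and two vectors for each earlier coordinate have been processed; as `j < n`,
    -- the exponent `n + 2j + 1` stays below the `3n` of `Fits`.
    refine (coordinateProg_spec D hc₄ hs₄ hB₄ hF.right_le hF.one_le hF.right_sq (k := n + 2 * j)
      ((pow_le_pow_right₀ hF.one_le (by omega)).trans hF.pow_le) (j := ⟨j, hj⟩) h10 hI.gs hI.valid
      hI.le (by rw [e8]; exact hqb) ?_ ?_).mono le_rfl (by simp) (by simp) ?_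
    · rw [hI.reg1, abs_of_nonneg (by positivity)]
      linarith
    · have hj' := hI.length_le
      have := (leaf_bounds D (le_refl b)).2.2.1
      rw [hI.reg17, abs_of_nonneg (by positivity)]
      omega
    · rintro s₅ - hag₅ ⟨⟨σ₂, hσ₂, hv₂, hG₂⟩, hout⟩
      refine ⟨σ₂, BasisInv.step (j := ⟨j, hj⟩) (s' := s₅) hM hΔ hsq (by rw [e8]; exact hq)
        (by rw [e8]; exact hθ) (by rw [e8]) hI ⟨by simpa using hσ₂.1, by simpa using hσ₂.2⟩ hv₂ hG₂ ?_
        (by simp) hout⟩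
      intro x hx
      rw [Store.setReg_reg, if_neg]
      rintro rfl
      simp at hx
  rintro s₄ hs₄ - ⟨⟨σ₁, W, hI⟩, hag₄⟩
  have e18' : s₄.reg 18 = s.reg 1 := by rw [hag₄.reg 18 (by decide), e18]
  have e28 : s₄.reg 28 = s.reg 28 := by rw [hag₄.reg 28 (by decide), hag₃.reg 28 (by decide)]
  have e19 : s₄.reg 19 = s.reg 19 := by rw [hag₄.reg 19 (by decide), hag₃.reg 19 (by decide)]
  refine Does.seq (τ₁ := 1) (τ₂ := 2) (Does.write (by omega) hs₄ (by simp [Expr.SmallConsts])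
    (by simp [Expr.SmallConsts]) (by decide) (by simp) (by simpa [Expr.eval] using hs₄.reg 28)) ?_
  rintro s₅ hs₅ - rfl
  refine Does.seq (τ₁ := 1) (τ₂ := 1) (Does.write (by omega) hs₅ (by simp [Expr.SmallConsts])
    (by simp [Expr.SmallConsts]) (by decide) (by simp) (by simpa [Expr.eval] using hs₅.reg 17)) ?_
  rintro s₆ hs₆ - rfl
  refine (Does.set (by omega) hs₆ (by simp [Expr.SmallConsts]) (by decide) (by simp) ?_).mono
    le_rfl (List.Subset.refl _) (List.Subset.refl _) ?_
  · simp only [Expr.eval, Store.setArr_reg, e19]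
    exact h19.trans hpow
  rintro s₇ - - rfl
  refine ⟨W, hI.basis, hI.length_le, ?_, by simp [Expr.eval, e19], ?_, fun c hcl => ?_⟩
  · rw [length_encodeEntry]
    simp [hI.reg1]; ring
  · rw [encodeEntry, holdsAt_cons, holdsAt_cons]
    simp only [Store.setReg_arr, Store.setArr_arr, Store.setArr_reg, reduceIte, Expr.eval, e18',
      e28, hI.reg17]
    refine ⟨by simp, by simp, hI.holds.congr_offset (by ring) fun c hcl => ?_⟩
    rw [Function.update_of_ne (by omega), Function.update_of_ne (by omega)]
  · simp only [Store.setReg_arr, Store.setArr_arr, Store.setArr_reg, reduceIte, Expr.eval, e18']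
    rw [Function.update_of_ne (by omega), Function.update_of_ne (by omega), hI.keep c hcl]

end

end Ram

/-! ### The eigenvalues in the support -/

namespace Ram

open Matrix StateTransfer

variable {n : ℕ}

/-- For the number `t` in register `11`, put `q = 4 n² - t` into register `28`, and into the registers
`7` and `8` numbers `p'` and `q'` with `p + q √Δ = p' + q' √Δ`, where `q' = 0` if `Δ = 1`. -/
def selectProg : Prog :=
  .set 28 (.const 4 *ₑ .reg 3 -ₑ .reg 11) ;;
  .ifPos (.reg 6 -ₑ .const 1) (.set 7 (.reg 16) ;; .set 8 (.reg 28))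
    (.set 7 (.reg 16 +ₑ .reg 28) ;; .set 8 (.const 0))

/-- Deal with one possible eigenvalue. -/
def eigenvalueProg : Prog :=
  selectProg ;; shiftedProg ;; sqShiftedProg ;; kernelProg ;;
    .ifPos (entry 4 (.reg 5) (.reg 5)) basisProg .skip

/-- Write the output for the pair `(Δ, p)` in the registers `6` and `16`. -/
def spectralProg : Prog :=
  .write 1 (.const 0) (.const 1) ;; .write 1 (.const 1) (.reg 6) ;; .write 1 (.const 2) (.reg 16) ;;
    .set 1 (.const 4) ;; .set 19 (.const 0) ;; forLoop 11 27 eigenvalueProg ;;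
    .write 1 (.const 3) (.reg 19)

theorem output_eq_map (s : Store) :
    output s = (List.range (s.reg 1).toNat).map fun i : ℕ => s.arr 1 (i : ℤ) := by
  simp only [output]
  rw [List.map_eq_flatMap, List.map_eq_flatMap]
  simp [List.flatMap_assoc]

section
variable {b L N : ℕ} {M : Matrix (Fin n) (Fin n) ℤ} {a : Fin n} {s : Store} {R K : List ℕ}

/-- For `Δ = 1` the kernel of `B² - q²` would mix the eigenvalues `(p + q)/2` and `(p - q)/2`, so
the pair `(p + q, 0)` describes the same `θ` instead. The original `q` is kept in register `28` for
the output. -/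
theorem selectProg_spec (D : Dim n b L N) (hc : Ctx M a s) (hs : s.Bdd L) {Δ p : ℤ} (hΔ : 0 < Δ)
    (h6 : s.reg 6 = Δ) (h16 : s.reg 16 = p) (hp : |p| ≤ 2 * (n : ℤ) ^ 2) {t : ℕ}
    (h11 : s.reg 11 = t) (ht : t < 8 * n ^ 2 + 1) (hb : 6 * (n : ℤ) ^ 2 ≤ 2 ^ b) :
    Does N L selectProg s 4 [7, 8, 28] [] fun s' => s'.reg 28 = 4 * (n : ℤ) ^ 2 - t ∧
      (s'.reg 8 = 0 ∨ 1 < Δ) ∧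
      2 * quadValue Δ p (4 * (n : ℤ) ^ 2 - t) = (s'.reg 7 : ℝ) + s'.reg 8 * √(Δ : ℝ) ∧
      |s'.reg 7| ≤ 6 * (n : ℤ) ^ 2 ∧ |s'.reg 8| ≤ 4 * (n : ℤ) ^ 2 := by
  have hbL := D.bits
  have hb3 := D.three_le
  have hpow : (2 : ℤ) ^ b ≤ 2 ^ L := pow_two_mono (by omega)
  have hn2 : (0 : ℤ) ≤ (n : ℤ) ^ 2 := by positivity
  have hq : |4 * (n : ℤ) ^ 2 - t| ≤ 4 * (n : ℤ) ^ 2 := by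
    have : (t : ℤ) < 8 * (n : ℤ) ^ 2 + 1 := by exact_mod_cast ht
    rw [abs_le]; omega
  have hpq : |p + (4 * (n : ℤ) ^ 2 - t)| ≤ 6 * (n : ℤ) ^ 2 :=
    (abs_add_le _ _).trans (by omega)
  have e28 : (.const 4 *ₑ .reg 3 -ₑ .reg 11 : Expr).eval s = 4 * (n : ℤ) ^ 2 - t := by
    simp [Expr.eval, hc.r3, h11]; ring
  refine Does.seq (τ₁ := 1) (τ₂ := 3) (Does.set (by omega) hs (by simp [Expr.SmallConsts])
    (by decide) (by simp) ?_) ?_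
  · rw [e28]; omega
  rintro s₁ hs₁ - rfl
  rw [e28] at hs₁ ⊢
  refine Does.ifPos (τ := 2) (by omega) hs₁ (by simp [Expr.SmallConsts]) (by decide) (fun h => ?_)
    (fun h => ?_)
  · replace h : 1 < Δ := by simpa [Expr.eval, h6] using h
    refine Does.seq (τ₁ := 1) (τ₂ := 1) (Does.set (by omega) hs₁ (by simp [Expr.SmallConsts])
      (by decide) (by simp) (by simpa [Expr.eval] using hs₁.reg 16)) ?_
    rintro s₂ hs₂ - rfl
    refine (Does.set (by omega) hs₂ (by simp [Expr.SmallConsts]) (by decide) (by simp)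
      (by simpa [Expr.eval] using hs₂.reg 28)).mono le_rfl (List.Subset.refl _)
      (List.Subset.refl _) ?_
    rintro s₃ - - rfl
    refine ⟨by simp, .inr h, ?_, ?_, ?_⟩
    · simp only [quadValue, Expr.eval, Store.setReg_reg, Nat.reduceEqDiff, reduceIte, h16]
      ring
    · simp only [Expr.eval, Store.setReg_reg, Nat.reduceEqDiff, reduceIte, h16]; omega
    · simp only [Expr.eval, Store.setReg_reg, Nat.reduceEqDiff, reduceIte]; exact hq
  · obtain rfl : Δ = 1 := by
      have : Δ - 1 ≤ 0 := by simpa [Expr.eval, h6] using h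
      omega
    have e7 : (.reg 16 +ₑ .reg 28 : Expr).eval (s.setReg 28 (4 * (n : ℤ) ^ 2 - t)) =
        p + (4 * (n : ℤ) ^ 2 - t) := by simp [Expr.eval, h16]
    refine Does.seq (τ₁ := 1) (τ₂ := 1) (Does.set (by omega) hs₁ (by simp [Expr.SmallConsts])
      (by decide) (by simp) ?_) ?_
    · rw [e7]; omega
    rw [e7]
    rintro s₂ hs₂ - rfl
    refine (Does.set (by omega) hs₂ (by simp [Expr.SmallConsts]) (by decide) (by simp)
      (by simp [Expr.eval])).mono le_rfl (List.Subset.refl _) (List.Subset.refl _) ?_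
    rintro s₃ - - rfl
    refine ⟨by simp, .inl (by simp [Expr.eval]), ?_, ?_, ?_⟩
    · simp only [quadValue, Expr.eval, Store.setReg_reg, Nat.reduceEqDiff, reduceIte]
      push_cast
      rw [Real.sqrt_one]
      ring
    · simp only [Store.setReg_reg, Nat.reduceEqDiff, reduceIte]; exact hpq
    · simp only [Expr.eval, Store.setReg_reg, reduceIte, abs_zero]; omega

/-- Invariant of the loop over the possible eigenvalues. -/
structure SpectralInv (M : Matrix (Fin n) (Fin n) ℤ) (a : Fin n) (Δ p : ℤ) (s₀ s : Store) (t : ℕ)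
    (l : List (ℤ × List (Fin n → ℤ × ℤ))) : Prop where
  entries : EntriesAbove M a Δ p (4 * (n : ℤ) ^ 2 - t) l
  reg19 : s.reg 19 = l.length
  reg1 : s.reg 1 = 4 + (l.flatMap encodeEntry).length
  holds : HoldsAt (s.arr 1) 4 (l.flatMap encodeEntry)
  keep : ∀ c < 4, s.arr 1 c = s₀.arr 1 c
  length_le : l.length ≤ t
  flat_le : (l.flatMap encodeEntry).length ≤ t * (2 + 2 * n * n)

theorem eigenvalueProg_spec (D : Dim n b L N) (hc : Ctx M a s) (hs : s.Bdd L) (hM : M.IsSymm)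
    {Δ p : ℤ} (hΔ : 0 < Δ) (hsq : Squarefree Δ) (h6 : s.reg 6 = Δ) (h16 : s.reg 16 = p)
    (hp : |p| ≤ 2 * (n : ℤ) ^ 2) {C : ℤ}
    (hF : ∀ p' q', |p'| ≤ 6 * (n : ℤ) ^ 2 → |q'| ≤ 4 * (n : ℤ) ^ 2 →
      Fits b C (sqShifted (shifted M p') (q' * q' * Δ)) (shifted M p'))
    (hMb : ∀ i j, |M i j| ≤ 2 ^ b) (hΔb : Δ ≤ 2 ^ b)
    {t : ℕ} (h11 : s.reg 11 = t) (ht : t < 8 * n ^ 2 + 1)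
    (hb : 6 + (8 * n ^ 2 + 1) * (2 + 2 * n * n : ℤ) ≤ 2 ^ b) {s₀ : Store}
    {l : List (ℤ × List (Fin n → ℤ × ℤ))} (hI : SpectralInv M a Δ p s₀ s t l) :
    Does N L eigenvalueProg s (15 + (n + 1) * 29) [1, 7, 8, 9, 10, 17, 18, 19, 28]
      [1, 2, 3, 4, 5, 6, 7, 10] fun s' => ∃ l', SpectralInv M a Δ p s₀ s' (t + 1) l' := by
  have hbL := D.bits
  have hb3 := D.three_le
  have hpow : (2 : ℤ) ^ b ≤ 2 ^ L := pow_two_mono (by omega)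
  have hn1 : (1 : ℤ) ≤ n := by exact_mod_cast D.pos
  have hn2 : (1 : ℤ) ≤ (n : ℤ) ^ 2 := one_le_pow₀ hn1
  have hb6 : 6 * (n : ℤ) ^ 2 ≤ 2 ^ b := by nlinarith
  refine (Does.seq (τ₁ := 4) (τ₂ := 11 + (n + 1) * 29) ((selectProg_spec D hc hs hΔ h6 h16 hp h11 ht
    hb6).frame (by simp) (by simp)) ?_).mono (by omega) (List.Subset.refl _) (List.Subset.refl _)
    fun _ _ _ h => h
  rintro s₁ hs₁ - ⟨⟨e28, hq, hθ, hp', hq'⟩, hag₁⟩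
  have hc₁ : Ctx M a s₁ := hc.agree hag₁ (by decide) (by decide)
  have hF₁ := hF _ _ hp' hq'
  have hqb : |s₁.reg 8| ≤ 2 ^ b := by omega
  refine (Does.seq (τ₁ := 1) (τ₂ := 10 + (n + 1) * 29) (shiftedProg_spec D hc₁ hs₁ (by simp) hMb
    (hp'.trans hb6)) ?_).mono (by omega) (List.Subset.refl _) (List.Subset.refl _) fun _ _ _ h => h
  rintro s₂ hs₂ - ⟨f, rfl, hf⟩
  have hc₂ : Ctx M a (s₁.setArr 2 f) := hc₁.setArr (by decide) f
  have h6₂ : (s₁.setArr 2 f).reg 6 = Δ := by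
    rw [Store.setArr_reg, hag₁.reg 6 (by decide), h6]
  refine (Does.seq (τ₁ := 1) (τ₂ := 9 + (n + 1) * 29) (sqShiftedProg_spec D hc₂ hs₂ (by simp)
    (B := shifted M (s₁.reg 7)) (by simpa using hf) hF₁.right_le (by simpa using hqb)
    (by rw [h6₂, abs_of_pos hΔ]; exact hΔb)) ?_).mono (by omega) (List.Subset.refl _)
    (List.Subset.refl _) fun _ _ _ h => h
  rintro s₃ hs₃ - ⟨f', rfl, hf'⟩
  rw [h6₂, Store.setArr_reg] at hf'
  have hc₃ : Ctx M a ((s₁.setArr 2 f).setArr 3 f') := hc₂.setArr (by decide) f'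
  refine (Does.seq (τ₁ := 2 + (n + 1) * 8) (τ₂ := 7 + (n + 1) * 21) ((kernelProg_spec D hc₃ hs₃
    (shifted M (s₁.reg 7)) (by simpa using hf') hF₁.left_le hF₁.one_le hF₁.left_sq
    ((pow_le_pow_right₀ hF₁.one_le (by omega)).trans hF₁.pow_le)).frame (by simp) (by simp))
    ?_).mono (by omega) (List.Subset.refl _) (List.Subset.refl _) fun _ _ _ h => h
  rintro s₄ hs₄ - ⟨⟨σ, hσ, hv, hG⟩, hag₄⟩
  have hc₄ : Ctx M a s₄ := hc₃.agree hag₄ (by decide) (by decide)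
  have e8 : s₄.reg 8 = s₁.reg 8 := hag₄.reg 8 (by decide)
  have f28 : s₄.reg 28 = 4 * (n : ℤ) ^ 2 - t := by rw [← e28]; exact hag₄.reg 28 (by decide)
  have e1 : s₄.reg 1 = s.reg 1 := by
    rw [← hag₁.reg 1 (by decide)]; exact hag₄.reg 1 (by decide)
  have e19 : s₄.reg 19 = s.reg 19 := by
    rw [← hag₁.reg 19 (by decide)]; exact hag₄.reg 19 (by decide)
  have ea1 : s₄.arr 1 = s.arr 1 := by
    rw [← hag₁.arr 1 (by decide), hag₄.arr 1 (by decide)]; simp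
  have hB₄ : IsMat (s₄.arr 2) (shifted M (s₁.reg 7)) := by
    rw [hag₄.arr 2 (by decide)]; simpa using hf
  have htest : (entry 4 (.reg 5) (.reg 5)).eval s₄ = σ.Q a a := by
    simp [entry, Expr.eval, hc₄.r5, hc₄.r2, hσ.1 _ _]
  have hiff := gain_pos_iff hM hΔ hsq hq hθ hv a
  have hflat := hI.flat_le
  have hlen := hI.length_le
  have hcast : (4 * (n : ℤ) ^ 2 - ((t + 1 : ℕ) : ℤ)) = 4 * (n : ℤ) ^ 2 - t - 1 := by
    push_cast; ring
  refine (Does.ifPos (e := entry 4 (.reg 5) (.reg 5)) (τ := 6 + (n + 1) * 21) (by omega) hs₄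
    (by simp [Expr.SmallConsts, entry]) (by decide) (fun h => ?_) (fun h => ?_)).mono (by omega)
    (List.Subset.refl _) (List.Subset.refl _) fun _ _ _ h => h
  · rw [htest] at h
    have h8n : (((l.flatMap encodeEntry).length : ℕ) : ℤ) ≤ t * (2 + 2 * n * n) := by
      exact_mod_cast hflat
    have ht' : (t : ℤ) ≤ 8 * n ^ 2 := by
      have := Nat.le_of_lt_succ ht
      exact_mod_cast this
    have h9n : (t : ℤ) * (2 + 2 * n * n) ≤ 8 * n ^ 2 * (2 + 2 * n * n) :=
      mul_le_mul_of_nonneg_right ht' (by positivity)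
    refine (basisProg_spec D hc₄ hs₄ hM hΔ hsq (p := s₁.reg 7)
      (θ := quadValue Δ p (4 * (n : ℤ) ^ 2 - t)) (by rw [e8]; exact hq) (by rw [e8]; exact hθ) hB₄
      (by rw [e8]; exact hF₁) hσ (by rw [e8]; exact hv) hG (by rw [e8]; exact hqb) ?_ ?_ ?_).mono
      le_rfl (by simp) (by simp) ?_
    · rw [e1, hI.reg1]; positivity
    · rw [e1, hI.reg1]
      nlinarith
    · rw [e19, hI.reg19, abs_of_nonneg (by positivity)]
      have : (l.length : ℤ) ≤ t := by exact_mod_cast hlen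
      nlinarith
    · rintro s₅ - - ⟨W, hW, hWl, h1, h19, hh, hk⟩
      rw [f28] at h1 hh
      refine ⟨l ++ [(4 * (n : ℤ) ^ 2 - t, W)], ?_, ?_, ?_, ?_, ?_, ?_, ?_⟩
      · rw [hcast]
        exact hI.entries.concat (hiff.1 h) hW
      · rw [h19, e19, hI.reg19]; simp
      · rw [h1, e1, hI.reg1]
        simp only [List.flatMap_append, List.flatMap_cons, List.flatMap_nil, List.append_nil,
          List.length_append]
        push_cast; ring
      · rw [List.flatMap_append, holdsAt_append]
        refine ⟨hI.holds.congr fun c _ hc => ?_, ?_⟩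
        · rw [hk c (by rw [e1, hI.reg1]; exact hc), ea1]
        · rw [e1, hI.reg1] at hh
          simpa using hh
      · intro c hc
        rw [hk c (by rw [e1, hI.reg1]; omega), ea1, hI.keep c hc]
      · simpa using hlen
      · simp only [List.flatMap_append, List.flatMap_cons, List.flatMap_nil, List.append_nil,
          List.length_append, length_encodeEntry]
        have h1 : W.length * (2 * n) ≤ n * (2 * n) := Nat.mul_le_mul_right _ hWl
        have h2 : n * (2 * n) = 2 * n * n := by ring
        rw [add_mul t, one_mul]
        omega
  · rw [htest] at h
    refine (Does.skip hs₄ (P := fun s' => ∃ l', SpectralInv M a Δ p s₀ s' (t + 1) l')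
      ⟨l, ?_, ?_, ?_, ?_, ?_, ?_, ?_⟩).mono (by omega) (List.Subset.refl _) (List.Subset.refl _)
      fun _ _ _ h => h
    · rw [hcast]
      exact hI.entries.skip fun h' => absurd (hiff.2 h') (not_lt.2 h)
    · rw [e19]; exact hI.reg19
    · rw [e1]; exact hI.reg1
    · rw [ea1]; exact hI.holds
    · rw [ea1]; exact hI.keep
    · omega
    · exact hflat.trans (Nat.mul_le_mul_right _ (Nat.le_succ t))

/-- Entries start at cell `4`, after the answer `1`, `Δ`, `p` and the number of eigenvalues. This
number goes into cell `3` last. -/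
theorem spectralProg_spec (D : Dim n b L N) (hc : Ctx M a s) (hs : s.Bdd L) (hM : M.IsSymm)
    (hMn : ∀ i j, |M i j| ≤ (n : ℤ)) {Δ p : ℤ} (hΔ : 0 < Δ) (hg : Good M a Δ p)
    (h6 : s.reg 6 = Δ) (h16 : s.reg 16 = p) (hp : |p| ≤ 2 * (n : ℤ) ^ 2) {C : ℤ}
    (hF : ∀ p' q', |p'| ≤ 6 * (n : ℤ) ^ 2 → |q'| ≤ 4 * (n : ℤ) ^ 2 →
      Fits b C (sqShifted (shifted M p') (q' * q' * Δ)) (shifted M p'))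
    (hΔb : Δ ≤ 2 ^ b) (hb : 6 + (8 * n ^ 2 + 1) * (2 + 2 * n * n : ℤ) ≤ 2 ^ b) :
    Does N L spectralProg s (6 + (8 * n ^ 2 + 2) * (16 + (n + 1) * 29))
      [1, 7, 8, 9, 10, 11, 17, 18, 19, 28] [1, 2, 3, 4, 5, 6, 7, 10] fun s' =>
      ∃ D : SpectralData n, D.Correct M a ∧ output s' = 1 :: D.encode ∧
        (output s').length ≤ 4 + (8 * n ^ 2 + 1) * (2 + 2 * n * n) := by
  have hbL := D.bits
  have hb3 := D.three_le
  have hpow : (2 : ℤ) ^ b ≤ 2 ^ L := pow_two_mono (by omega)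
  have h8L : (8 : ℤ) ≤ 2 ^ L := by
    calc (8 : ℤ) = 2 ^ 3 := by norm_num
      _ ≤ 2 ^ L := pow_two_mono (by omega)
  have hMb : ∀ i j, |M i j| ≤ 2 ^ b := fun i j =>
    (hMn i j).trans (leaf_bounds D (le_refl b)).2.2.1
  set T := (8 * n ^ 2 + 2) * (16 + (n + 1) * 29) with hT
  refine (Does.seq (τ₁ := 1) (τ₂ := 5 + T) (Does.write (by omega) hs (by simp [Expr.SmallConsts])
    (by simp [Expr.SmallConsts]) (by decide) (by simp) (by simp [Expr.eval]; omega)) ?_).mono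
    (by omega) (List.Subset.refl _) (List.Subset.refl _) fun _ _ _ h => h
  rintro s₁ hs₁ - rfl
  refine (Does.seq (τ₁ := 1) (τ₂ := 4 + T) (Does.write (by omega) hs₁ (by simp [Expr.SmallConsts])
    (by simp [Expr.SmallConsts]) (by decide) (by simp) (by simpa [Expr.eval] using hs₁.reg 6))
    ?_).mono (by omega) (List.Subset.refl _) (List.Subset.refl _) fun _ _ _ h => h
  rintro s₂ hs₂ - rfl
  refine (Does.seq (τ₁ := 1) (τ₂ := 3 + T) (Does.write (by omega) hs₂ (by simp [Expr.SmallConsts])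
    (by simp [Expr.SmallConsts]) (by decide) (by simp) (by simpa [Expr.eval] using hs₂.reg 16))
    ?_).mono (by omega) (List.Subset.refl _) (List.Subset.refl _) fun _ _ _ h => h
  rintro s₃ hs₃ - rfl
  refine (Does.seq (τ₁ := 1) (τ₂ := 2 + T) (Does.set (by omega) hs₃ (by simp [Expr.SmallConsts])
    (by decide) (by simp) (by simp [Expr.eval]; omega)) ?_).mono
    (by omega) (List.Subset.refl _) (List.Subset.refl _) fun _ _ _ h => h
  rintro s₄ hs₄ - rfl
  refine (Does.seq (τ₁ := 1) (τ₂ := 1 + T) (Does.set (by omega) hs₄ (by simp [Expr.SmallConsts])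
    (by decide) (by simp) (by simp [Expr.eval])) ?_).mono
    (by omega) (List.Subset.refl _) (List.Subset.refl _) fun _ _ _ h => h
  rintro s₅ hs₅ - hs₅e
  have hag₅ : Agree [1, 19] [1] s s₅ := by
    subst hs₅e
    refine ⟨fun x hx => ?_, fun k hk => ?_⟩
    · simp only [List.mem_cons, List.not_mem_nil, or_false, not_or] at hx
      simp [hx]
    · simp only [List.mem_cons, List.not_mem_nil, or_false] at hk
      simp [hk]
  have g1 : s₅.reg 1 = 4 := by subst hs₅e; simp [Expr.eval]
  have g19 : s₅.reg 19 = 0 := by subst hs₅e; simp [Expr.eval]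
  have ga0 : s₅.arr 1 0 = 1 := by subst hs₅e; simp [Expr.eval]
  have ga1 : s₅.arr 1 1 = Δ := by subst hs₅e; simp [Expr.eval, h6]
  have ga2 : s₅.arr 1 2 = p := by subst hs₅e; simp [Expr.eval, h16]
  clear hs₅e
  have hc₅ : Ctx M a s₅ := hc.agree hag₅ (by decide) (by decide)
  refine (Does.seq (τ₁ := (8 * n ^ 2 + 1 + 1) * (15 + (n + 1) * 29 + 1)) (τ₂ := 1)
    (Does.for (R := [1, 7, 8, 9, 10, 11, 17, 18, 19, 28]) (by omega) hs₅
    (m := 8 * n ^ 2 + 1) (by rw [hc₅.r27])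
    (by decide) (by simp) (R' := [1, 7, 8, 9, 10, 17, 18, 19, 28]) (by decide) (by simp)
    (fun t s' => ∃ l, SpectralInv M a Δ p s₅ s' t l) ?_ ?_) ?_).mono
    (by rw [hT]; ring_nf; omega)
    (List.Subset.refl _) (List.Subset.refl _) fun _ _ _ h => h
  · refine ⟨[], ?_, by simp [g19], by simp [g1], HoldsAt.nil _ _, by simp, by simp, by simp⟩
    simpa using EntriesAbove.nil hMn a hΔ hp
  · rintro t s₆ ht hs₆ hag₆ h11 ⟨l, hI⟩
    refine (eigenvalueProg_spec D (hc₅.agree hag₆ (by decide) (by decide)) hs₆ hM hΔ hg.1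
      (by rw [hag₆.reg 6 (by decide), hag₅.reg 6 (by decide), h6])
      (by rw [hag₆.reg 16 (by decide), hag₅.reg 16 (by decide), h16]) hp hF hMb hΔb h11 ht hb
      hI).mono le_rfl (List.Subset.refl _) (List.Subset.refl _) ?_
    rintro s₇ - - ⟨l', h⟩
    exact ⟨l', h.entries, by simpa using h.reg19, by simpa using h.reg1, by simpa using h.holds,
      by simpa using h.keep, h.length_le, h.flat_le⟩
  rintro s₆ hs₆ - ⟨l, hI⟩
  refine (Does.write (by omega) hs₆ (by simp [Expr.SmallConsts]) (by simp [Expr.SmallConsts])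
    (by decide) (by simp) (by simpa [Expr.eval] using hs₆.reg 19)).mono le_rfl
    (List.Subset.refl _) (List.Subset.refl _) ?_
  rintro s₇ - - rfl
  have hlen : (output (s₆.setArr 1 (Function.update (s₆.arr 1) ((Expr.const 3).eval s₆)
      ((Expr.reg 19).eval s₆)))).length = 4 + (l.flatMap encodeEntry).length := by
    simp only [output_eq_map, Store.setArr_reg, hI.reg1, List.length_map, List.length_range]
    omega
  refine ⟨⟨Δ, p, l⟩, EntriesAbove.correct hM hMn hΔ hp hg ?_, ?_, ?_⟩
  -- After `8n² + 1` rounds the threshold `4n² - t` has come down to `-4n² - 1`.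
  · have := hI.entries
    convert this using 1
    push_cast; ring
  · have hh : HoldsAt (Function.update (s₆.arr 1) 3 (l.length : ℤ)) 0
        (1 :: SpectralData.encode ⟨Δ, p, l⟩) := by
      rw [SpectralData.encode, holdsAt_cons, holdsAt_cons, holdsAt_cons, holdsAt_cons]
      have k0 := hI.keep 0 (by norm_num)
      have k1 := hI.keep 1 (by norm_num)
      have k2 := hI.keep 2 (by norm_num)
      refine ⟨by simpa [Function.update_apply] using k0.trans ga0,
        by simpa [Function.update_apply] using k1.trans ga1,
        by simpa [Function.update_apply] using k2.trans ga2, by norm_num, ?_⟩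
      refine HoldsAt.congr_offset hI.holds (by norm_num) fun c hc => ?_
      rw [Function.update_of_ne (by omega)]
    have hl2 : (1 :: SpectralData.encode ⟨Δ, p, l⟩).length =
        4 + (l.flatMap encodeEntry).length := by
      simp only [SpectralData.encode, List.length_cons]
      change (l.flatMap encodeEntry).length + 1 + 1 + 1 + 1 = _
      omega
    refine List.ext_getElem (by rw [hlen, hl2]) fun i h1 h2 => ?_
    have := hh i h2
    rw [← this]
    simp [output_eq_map, Expr.eval, hI.reg19]
  · rw [hlen]
    have := hI.flat_le
    omega

end

end Ram

/-! ### The search for a pair -/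

namespace Ram

open Matrix StateTransfer

variable {n : ℕ}

/-- The candidate for `Δ` with number `t`. -/
def candΔ (n t : ℕ) : ℤ := 1 + (t : ℤ) / (4 * n ^ 2 + 1 : ℕ)

/-- The candidate for `p` with number `t`. -/
def candp (n t : ℕ) : ℤ := (t : ℤ) % (4 * n ^ 2 + 1 : ℕ) - 2 * n ^ 2

theorem cand_bounds {t : ℕ} (ht : t < 4 * n ^ 4 * (4 * n ^ 2 + 1)) :
    0 < candΔ n t ∧ candΔ n t ≤ 4 * (n : ℤ) ^ 4 ∧ |candp n t| ≤ 2 * (n : ℤ) ^ 2 := by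
  have h0 : (0 : ℤ) < (4 * n ^ 2 + 1 : ℕ) := by positivity
  have h1 : (0 : ℤ) ≤ (t : ℤ) / (4 * n ^ 2 + 1 : ℕ) := by positivity
  have h2 : (t : ℤ) / (4 * n ^ 2 + 1 : ℕ) < 4 * (n : ℤ) ^ 4 :=
    Int.ediv_lt_of_lt_mul h0 (by exact_mod_cast ht)
  have h3 := Int.emod_nonneg (t : ℤ) h0.ne'
  have h4 := Int.emod_lt_of_pos (t : ℤ) h0
  refine ⟨by unfold candΔ; omega, by unfold candΔ; omega, ?_⟩
  unfold candp
  push_cast at h3 h4 ⊢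
  rw [abs_le]; omega

/-- Division with remainder by `4n² + 1`, the number of possible `p`: take `t = (Δ - 1)(4n² + 1) +
(p + 2n²)`. -/
theorem exists_cand {Δ p : ℤ} (h0 : 0 < Δ) (hΔ : Δ ≤ 4 * (n : ℤ) ^ 4) (hp : |p| ≤ 2 * (n : ℤ) ^ 2) :
    ∃ t < 4 * n ^ 4 * (4 * n ^ 2 + 1), candΔ n t = Δ ∧ candp n t = p := by
  obtain ⟨d, rfl⟩ : ∃ d : ℕ, Δ = 1 + d := ⟨(Δ - 1).toNat, by omega⟩
  rw [abs_le] at hp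
  obtain ⟨e, he⟩ : ∃ e : ℕ, p + 2 * (n : ℤ) ^ 2 = e := ⟨(p + 2 * (n : ℤ) ^ 2).toNat, by omega⟩
  have he' : e < 4 * n ^ 2 + 1 := by zify; omega
  have hd' : d + 1 ≤ 4 * n ^ 4 := by zify; omega
  refine ⟨d * (4 * n ^ 2 + 1) + e, ?_, ?_, ?_⟩
  · calc d * (4 * n ^ 2 + 1) + e < (d + 1) * (4 * n ^ 2 + 1) := by rw [add_mul]; omega
      _ ≤ _ := Nat.mul_le_mul_right _ hd'
  · rw [candΔ, ← Int.natCast_div, Nat.div_eq_of_lt_le (k := d)]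
    · omega
    · rw [add_mul]; omega
  · have : (d * (4 * n ^ 2 + 1) + e) % (4 * n ^ 2 + 1) = e := by
      rw [Nat.mul_add_mod', Nat.mod_eq_of_lt he']
    rw [candp, ← Int.natCast_mod, this]
    omega

/-- The sum over `d = 2, …, m + 1` of the numbers `1` if `d²` divides `m`, and `0` otherwise. -/
theorem sum_sq_dvd_eq_zero_iff {Δ : ℤ} {m : ℕ} (hm : Δ = m) (h0 : 0 < Δ) {f : Fin m → ℤ}
    (hf : ∀ j, f j = 1 / (1 + (Δ - ((j : ℕ) + 2) * ((j : ℕ) + 2) *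
      (Δ / (((j : ℕ) + 2) * ((j : ℕ) + 2)))))) :
    0 ≤ ∑ j, f j ∧ (∑ j, f j = 0 ↔ Squarefree Δ) := by
  have hf' : ∀ j, f j = if ((j : ℕ) + 2 : ℤ) * ((j : ℕ) + 2) ∣ Δ then 1 else 0 := by
    intro j
    rw [hf, ← Int.emod_def, one_ediv_one_add (Int.emod_nonneg _ (by positivity))]
    simp only [Int.dvd_iff_emod_eq_zero]
  have hf0 : ∀ j, 0 ≤ f j := fun j => by rw [hf']; split_ifs <;> norm_num
  refine ⟨Finset.sum_nonneg fun j _ => hf0 j, ?_⟩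
  rw [Finset.sum_eq_zero_iff_of_nonneg fun j _ => hf0 j]
  constructor
  · intro h x hx
    by_contra hu
    have hx0 : x ≠ 0 := by rintro rfl; simp at hx; omega
    rw [Int.isUnit_iff_natAbs_eq] at hu
    have h2 : 2 ≤ x.natAbs := by omega
    have hdvd : (x.natAbs : ℤ) * x.natAbs ∣ Δ := by rwa [Int.natAbs_mul_self']
    have hle := Int.le_of_dvd h0 hdvd
    -- `|x| ≤ x² ≤ Δ = m`, so trial divisors up to `m + 1` catch every square factor.
    have hlt : x.natAbs - 2 < m := by
      have : (x.natAbs : ℤ) ≤ x.natAbs * x.natAbs := by nlinarith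
      omega
    have := h ⟨x.natAbs - 2, hlt⟩ (Finset.mem_univ _)
    rw [hf', if_pos] at this
    · exact one_ne_zero this
    · have e : (((x.natAbs - 2 : ℕ) : ℤ) + 2) = x.natAbs := by omega
      simpa only [e] using hdvd
  · intro h j _
    rw [hf', if_neg]
    intro hd
    have := Int.isUnit_iff_natAbs_eq.1 (h _ hd)
    omega

/-- For the number `t` in register `11`, put the candidates into the registers `6` and `7`. -/
def decodeProg : Prog :=
  .set 6 (.const 1 +ₑ .reg 11 /ₑ .reg 25) ;;
    .set 7 (.reg 11 -ₑ .reg 25 *ₑ (.reg 11 /ₑ .reg 25) -ₑ .const 2 *ₑ .reg 3)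

/-- Compute the product of the matrices `B² - q² Δ` with the unit vector in array `8`. -/
def annihilateProg : Prog :=
  fillSum 8 23 2 4 (ifEq (.reg 20) (.reg 5)) ;;
    forLoop 8 25 (sqShiftedProg ;;
      fillSum 6 23 2 2 (entry 3 (.reg 20) (.reg 22) *ₑ .read 8 (.reg 22)) ;;
      fillSum 8 23 2 4 (.read 6 (.reg 20)))

/-- `1` if the square of `2 + j`, for `j` in register `22`, divides the number in register `6`, and
`0` otherwise. -/
def sqDvd : Expr :=
  .const 1 /ₑ (.const 1 +ₑ (.reg 6 -ₑ (.reg 22 +ₑ .const 2) *ₑ (.reg 22 +ₑ .const 2) *ₑ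
    (.reg 6 /ₑ ((.reg 22 +ₑ .const 2) *ₑ (.reg 22 +ₑ .const 2)))))

/-- Keep the candidates if they are good. -/
def keepProg : Prog :=
  fillSum 7 23 4 2 (.read 8 (.reg 22) *ₑ .read 8 (.reg 22)) ;; fillSum 9 23 4 6 sqDvd ;;
    .ifPos (.const 1 -ₑ .read 7 (.const 0) -ₑ .read 9 (.const 0))
      (.set 14 (.const 1) ;; .set 15 (.reg 6) ;; .set 16 (.reg 7)) .skip

/-- Search for good candidates. -/
def searchProg : Prog :=
  .set 14 (.const 0) ;;
    forLoop 11 26 (decodeProg ;; shiftedProg ;; annihilateProg ;; keepProg)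

section
variable {b L N : ℕ} {M : Matrix (Fin n) (Fin n) ℤ} {a : Fin n} {s : Store} {R K : List ℕ}

theorem decodeProg_spec (D : Dim n b L N) (hc : Ctx M a s) (hs : s.Bdd L) {t : ℕ}
    (h11 : s.reg 11 = t) (ht : t < 4 * n ^ 4 * (4 * n ^ 2 + 1)) (hb : 4 * (n : ℤ) ^ 4 ≤ 2 ^ b) :
    Does N L decodeProg s 2 [6, 7] [] fun s' => s'.reg 6 = candΔ n t ∧ s'.reg 7 = candp n t ∧
      s'.arr = s.arr := by
  have hbL := D.bits
  have hb3 := D.three_le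
  have hpow : (2 : ℤ) ^ b ≤ 2 ^ L := pow_two_mono (by omega)
  obtain ⟨h1, h2, h3⟩ := cand_bounds ht
  have hn1 : (1 : ℤ) ≤ n := by exact_mod_cast D.pos
  have hn2 : (n : ℤ) ^ 2 ≤ n ^ 4 := pow_le_pow_right₀ hn1 (by norm_num)
  have e6 : (.const 1 +ₑ .reg 11 /ₑ .reg 25 : Expr).eval s = candΔ n t := by
    simp [Expr.eval, hc.r25, h11, candΔ]
  refine Does.seq (τ₁ := 1) (τ₂ := 1) (Does.set (by omega) hs (by simp [Expr.SmallConsts])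
    (by decide) (by simp) (by rw [e6, abs_of_pos h1]; omega)) ?_
  rintro s₁ hs₁ - rfl
  rw [e6] at hs₁ ⊢
  have e7 : (.reg 11 -ₑ .reg 25 *ₑ (.reg 11 /ₑ .reg 25) -ₑ .const 2 *ₑ .reg 3 : Expr).eval
      (s.setReg 6 (candΔ n t)) = candp n t := by
    simp only [Expr.eval, Store.setReg_reg, Nat.reduceEqDiff, if_false, hc.r25, h11, hc.r3, candp,
      Int.emod_def]
    push_cast; ring
  refine (Does.set (by omega) hs₁ (by simp [Expr.SmallConsts])
    (by decide) (by simp) (by rw [e7]; omega)).mono le_rfl (List.Subset.refl _)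
    (List.Subset.refl _) ?_
  rintro s₂ - - rfl
  rw [e7]
  simp

/-- The loop counter sits in register `8`, exactly where `sqShiftedProg` expects `q`. The product
goes to array `6` and is copied back, since a target array must not be read. -/
theorem annihilateProg_spec (D : Dim n b L N) (hc : Ctx M a s) (hs : s.Bdd L) {Δ p : ℤ}
    (h6 : s.reg 6 = Δ) (hΔ : |Δ| ≤ 2 ^ b) (hB : IsMat (s.arr 2) (shifted M p))
    (hBb : ∀ i j, |shifted M p i j| ≤ 2 ^ b) (hn : 4 * (n : ℤ) ^ 2 ≤ 2 ^ b)
    (hA : ∀ k : ℕ, k ≤ 4 * n ^ 2 → ∀ i j, |sqShifted (shifted M p) ((k : ℤ) ^ 2 * Δ) i j| ≤ 2 ^ b)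
    (hv : ∀ k : ℕ, k ≤ 4 * n ^ 2 + 1 → ∀ i, |annihilate M a Δ p k i| ≤ 2 ^ b) :
    Does N L annihilateProg s (1 + (4 * n ^ 2 + 2) * 4) [8] [3, 6, 8] fun s' =>
      IsVec (s'.arr 8) (annihilate M a Δ p (4 * n ^ 2 + 1)) := by
  obtain ⟨h1, h2, hnb, hi, hij⟩ := leaf_bounds D le_rfl
  have hbL := D.bits
  have hb3 := D.three_le
  have hnN : n ≤ N := by have := D.two_mul_le; omega
  have h1N : 1 ≤ N := D.pos.trans hnN
  refine Does.seq (τ₁ := 1) (τ₂ := (4 * n ^ 2 + 2) * 4) (Does.fillVec D hc hs (m := n) (l := 1)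
    (Pi.single a (1 : ℤ)) le_rfl (by simp) hc.r2 hc.r4 hnN h1N (by decide) (by decide)
    (by simp [Expr.Avoids]) (by simp [Expr.SmallConsts]) (by simpa using h1)
    (by simp only [Expr.deg, ifEq]; omega) (by decide) ?_ ?_) ?_
  · intro i t
    simp [Expr.Leaves, hi, hc.r5]
  · intro i
    simp [Expr.eval, hc.r5, Pi.single_apply, Fin.ext_iff]
  rintro s₁ hs₁ hag₁ ⟨f, rfl, hf, -⟩
  have hc₁ : Ctx M a (s.setArr 8 f) := hc.setArr (by decide) f
  refine (Does.for (m := 4 * n ^ 2 + 1) (τ := 3) (R := [8]) (R' := []) (by omega) hs₁ hc₁.r25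
    (by decide) (by simp) (by simp) (by simp)
    (fun k s' => IsVec (s'.arr 8) (annihilate M a Δ p k)) ?_ ?_).mono (by omega)
    (List.Subset.refl _) (List.Subset.refl _) fun _ _ _ h => h
  · simpa [annihilate] using hf
  intro k s₂ hk hs₂ hag₂ h8 hI
  have hc₂ : Ctx M a s₂ := hc₁.agree hag₂ (by decide) (by decide)
  have g6 : s₂.reg 6 = Δ := by rw [hag₂.reg 6 (by decide), Store.setArr_reg, h6]
  have hB₂ : IsMat (s₂.arr 2) (shifted M p) := by
    rw [hag₂.arr 2 (by decide)]; simpa using hB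
  have hkb : (k : ℤ) ≤ 2 ^ b := by
    have : (k : ℤ) ≤ 4 * (n : ℤ) ^ 2 := by exact_mod_cast Nat.le_of_lt_succ hk
    omega
  refine Does.seq (τ₁ := 1) (τ₂ := 2) (sqShiftedProg_spec D hc₂ hs₂ (by simp) hB₂ hBb
    (by rw [h8, abs_of_nonneg (by positivity)]; exact hkb) (by rw [g6]; exact hΔ)) ?_
  rintro s₃ hs₃ - ⟨f₃, rfl, hf₃⟩
  have hc₃ : Ctx M a (s₂.setArr 3 f₃) := hc₂.setArr (by decide) f₃
  rw [h8, g6, ← pow_two] at hf₃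
  have hA' := hA k (by omega)
  have hv' := hv k (by omega)
  refine Does.seq (τ₁ := 1) (τ₂ := 1) (Does.fillVec D hc₃ hs₃ (m := n) (l := n)
    (annihilate M a Δ p (k + 1)) le_rfl (by simp) hc₃.r2 hc₃.r2 hnN hnN (by decide) (by decide)
    (by simp [Expr.Avoids, entry]) (by simp [Expr.SmallConsts, entry]) hnb
    (by simp only [Expr.deg, entry]; omega) (by decide) ?_ ?_) ?_
  · intro i t
    simp [Expr.Leaves, Expr.eval, entry, hi, hc₂.r2, hf₃ _ _, hI _, hA', hv', hnb]
  · intro i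
    simp [Expr.eval, entry, hc₂.r2, hf₃ _ _, hI _, annihilate, mulVec, dotProduct]
  rintro s₄ hs₄ - ⟨f₄, rfl, hf₄, -⟩
  have hc₄ : Ctx M a ((s₂.setArr 3 f₃).setArr 6 f₄) := hc₃.setArr (by decide) f₄
  have hv'' := hv (k + 1) (by omega)
  refine (Does.fillVec D hc₄ hs₄ (m := n) (l := 1)
    (annihilate M a Δ p (k + 1)) le_rfl (by simp) hc₄.r2 hc₄.r4 hnN h1N (by decide) (by decide)
    (by simp [Expr.Avoids]) (by simp [Expr.SmallConsts]) (by simpa using h1)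
    (by simp only [Expr.deg]; omega) (by decide) ?_ ?_).mono le_rfl
    (List.Subset.refl _) (List.Subset.refl _) ?_
  · intro i t
    simp [Expr.Leaves, Expr.eval, hi, hf₄ _, hv'']
  · intro i
    simp [Expr.eval, hf₄ _]
  rintro s₅ - - ⟨f₅, rfl, hf₅, -⟩
  simpa using hf₅

/-- `v · v` and the number of square divisors found are nonnegative integers, so `1` minus both is
positive exactly when both vanish. Trial division takes `Δ` rounds, hence `Δ ≤ N`. -/
theorem keepProg_spec (D : Dim n b L N) (hc : Ctx M a s) (hs : s.Bdd L) {Δ : ℤ}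
    (h6 : s.reg 6 = Δ) (h0 : 0 < Δ) (hΔ : Δ ≤ 2 ^ b) (hΔN : Δ ≤ N) {v : Fin n → ℤ}
    (hv : IsVec (s.arr 8) v) (hvb : ∀ i, |v i| ≤ 2 ^ b) :
    Does N L keepProg s 6 [14, 15, 16] [7, 9] fun s' =>
      (Squarefree Δ ∧ v = 0 ∧ s'.reg 14 = 1 ∧ s'.reg 15 = Δ ∧ s'.reg 16 = s.reg 7) ∨
      (¬ (Squarefree Δ ∧ v = 0) ∧ s'.reg 14 = s.reg 14 ∧ s'.reg 15 = s.reg 15 ∧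
        s'.reg 16 = s.reg 16) := by
  obtain ⟨h1, h2, hnb, hi, hij⟩ := leaf_bounds D le_rfl
  have hbL := D.bits
  have hb3 := D.three_le
  have hnN : n ≤ N := by have := D.two_mul_le; omega
  have h1N : 1 ≤ N := D.pos.trans hnN
  have h1L : (1 : ℤ) ≤ 2 ^ L := one_le_pow₀ (by norm_num)
  obtain ⟨m, hm⟩ : ∃ m : ℕ, Δ = m := ⟨Δ.toNat, by omega⟩
  refine Does.seq (τ₁ := 1) (τ₂ := 5) (Does.fillVec D hc hs (m := 1) (l := n)
    (fun _ => v ⬝ᵥ v) le_rfl (by simp) hc.r4 hc.r2 h1N hnN (by decide) (by decide)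
    (by simp [Expr.Avoids]) (by simp [Expr.SmallConsts]) hnb
    (by simp only [Expr.deg]; omega) (by decide) ?_ ?_) ?_
  · intro i t
    simp [Expr.Leaves, Expr.eval, hi, hv _, hvb]
  · intro i
    simp [Expr.eval, hv _, dotProduct]
  rintro s₁ hs₁ - ⟨f₁, rfl, hf₁, -⟩
  have hc₁ : Ctx M a (s.setArr 7 f₁) := hc.setArr (by decide) f₁
  refine Does.seq (τ₁ := 1) (τ₂ := 4) (Does.fillVec D hc₁ hs₁ (m := 1) (l := m)
    (fun _ => ∑ j : Fin m, 1 / (1 + (Δ - ((j : ℕ) + 2) * ((j : ℕ) + 2) *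
      (Δ / (((j : ℕ) + 2) * ((j : ℕ) + 2)))))) le_rfl (by simp) hc₁.r4 (by simpa [h6] using hm) h1N
    (by omega) (by decide) (by decide)
    (by simp [Expr.Avoids, sqDvd]) (by simp [Expr.SmallConsts, sqDvd]) (by omega)
    (by simp only [Expr.deg, sqDvd]; omega) (by decide) ?_ ?_) ?_
  · intro i t
    have : ((t : ℕ) : ℤ) ≤ 2 ^ b := by have := t.2; omega
    simp [Expr.Leaves, sqDvd, h1, h2, h6, abs_of_pos h0, hΔ, this]
  · intro i
    simp [Expr.eval, sqDvd, h6]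
  rintro s₂ hs₂ - ⟨f₂, rfl, hf₂, -⟩
  obtain ⟨hq0, hq⟩ := sum_sq_dvd_eq_zero_iff hm h0 (fun _ => rfl)
  have hd0 : 0 ≤ v ⬝ᵥ v := Finset.sum_nonneg fun i _ => mul_self_nonneg _
  have hd : v ⬝ᵥ v = 0 ↔ v = 0 := dotProduct_self_eq_zero
  have e7 : f₁ 0 = v ⬝ᵥ v := by simpa using hf₁ 0
  have e9 := hf₂ 0
  rw [Fin.val_zero, Nat.cast_zero] at e9
  refine Does.ifPos (τ := 3) (by omega) hs₂ (by simp [Expr.SmallConsts]) (by decide)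
    (fun h => ?_) (fun h => ?_)
  · simp only [Expr.eval, Store.setArr_arr, if_true, Nat.reduceEqDiff, if_false, e7, e9] at h
    refine Does.seq (τ₁ := 1) (τ₂ := 2) (Does.set (by omega) hs₂ (by simp [Expr.SmallConsts])
      (by decide) (by simp) (by simpa [Expr.eval] using h1L)) ?_
    rintro s₃ hs₃ - rfl
    refine Does.seq (τ₁ := 1) (τ₂ := 1) (Does.set (by omega) hs₃ (by simp [Expr.SmallConsts])
      (by decide) (by simp) (by simpa [Expr.eval] using hs₃.reg 6)) ?_
    rintro s₄ hs₄ - rfl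
    refine (Does.set (by omega) hs₄ (by simp [Expr.SmallConsts])
      (by decide) (by simp) (by simpa [Expr.eval] using hs₄.reg 7)).mono le_rfl
      (List.Subset.refl _) (List.Subset.refl _) ?_
    rintro s₅ - - rfl
    refine Or.inl ⟨hq.1 (by omega), hd.1 (by omega), ?_, ?_, ?_⟩ <;> simp [Expr.eval, h6]
  · simp only [Expr.eval, Store.setArr_arr, if_true, Nat.reduceEqDiff, if_false, e7, e9] at h
    refine (Does.skip hs₂ (P := fun s' =>
      (Squarefree Δ ∧ v = 0 ∧ s'.reg 14 = 1 ∧ s'.reg 15 = Δ ∧ s'.reg 16 = s.reg 7) ∨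
      (¬ (Squarefree Δ ∧ v = 0) ∧ s'.reg 14 = s.reg 14 ∧ s'.reg 15 = s.reg 15 ∧
        s'.reg 16 = s.reg 16)) (Or.inr ⟨?_, rfl, rfl, rfl⟩)).mono (by omega) (List.Subset.refl _)
      (List.Subset.refl _) fun _ _ _ h => h
    rintro ⟨h3, h4⟩
    have := hq.2 h3
    have := hd.2 h4
    omega

/-- The result of the search among the first `t` candidates. -/
def SearchInv (M : Matrix (Fin n) (Fin n) ℤ) (a : Fin n) (t : ℕ) (s : Store) : Prop :=
  (s.reg 14 = 0 ∧ ∀ t' < t, ¬ Good M a (candΔ n t') (candp n t')) ∨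
    (s.reg 14 = 1 ∧ ∃ t' < 4 * n ^ 4 * (4 * n ^ 2 + 1), s.reg 15 = candΔ n t' ∧
      s.reg 16 = candp n t' ∧ Good M a (candΔ n t') (candp n t'))

/-- A later good candidate overwrites an earlier one; any good pair serves the output. -/
theorem searchProg_spec (D : Dim n b L N) (hc : Ctx M a s) (hs : s.Bdd L)
    (hMb : ∀ i j, |M i j| ≤ 2 ^ b) (hn : 4 * (n : ℤ) ^ 4 ≤ 2 ^ b) (hnN : 4 * n ^ 4 ≤ N)
    (hB : ∀ p, |p| ≤ 2 * (n : ℤ) ^ 2 → ∀ i j, |shifted M p i j| ≤ 2 ^ b)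
    (hA : ∀ Δ p : ℤ, 0 < Δ → Δ ≤ 4 * (n : ℤ) ^ 4 → |p| ≤ 2 * (n : ℤ) ^ 2 → ∀ k : ℕ,
      k ≤ 4 * n ^ 2 → ∀ i j, |sqShifted (shifted M p) ((k : ℤ) ^ 2 * Δ) i j| ≤ 2 ^ b)
    (hv : ∀ Δ p : ℤ, 0 < Δ → Δ ≤ 4 * (n : ℤ) ^ 4 → |p| ≤ 2 * (n : ℤ) ^ 2 → ∀ k : ℕ,
      k ≤ 4 * n ^ 2 + 1 → ∀ i, |annihilate M a Δ p k i| ≤ 2 ^ b) :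
    Does N L searchProg s
      (1 + (4 * n ^ 4 * (4 * n ^ 2 + 1) + 1) * (11 + (4 * n ^ 2 + 2) * 4))
      [6, 7, 8, 11, 14, 15, 16] [2, 3, 6, 7, 8, 9] fun s' =>
      SearchInv M a (4 * n ^ 4 * (4 * n ^ 2 + 1)) s' := by
  have hbL := D.bits
  have hb3 := D.three_le
  have hn1 : (1 : ℤ) ≤ n := by exact_mod_cast D.pos
  have hn2 : (n : ℤ) ^ 2 ≤ n ^ 4 := pow_le_pow_right₀ hn1 (by norm_num)
  refine Does.seq (τ₁ := 1) (Does.set (by omega) hs (by simp [Expr.SmallConsts])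
    (by decide) (by simp) (by simp [Expr.eval])) ?_
  rintro s₁ hs₁ hag₁ rfl
  have hc₁ := hc.agree hag₁ (by decide) (by decide)
  refine (Does.for (R := [6, 7, 8, 11, 14, 15, 16]) (m := 4 * n ^ 4 * (4 * n ^ 2 + 1))
    (τ := 10 + (4 * n ^ 2 + 2) * 4) (by omega) hs₁ hc₁.r26
    (by decide) (by simp) (R' := [6, 7, 8, 14, 15, 16]) (by decide) (by simp)
    (fun t s' => SearchInv M a t s') (Or.inl ⟨by simp [Expr.eval], by simp⟩) ?_).mono
    (Nat.mul_le_mul_left _ (by omega)) (List.Subset.refl _) (List.Subset.refl _) fun _ _ _ h => h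
  intro t s₂ ht hs₂ hag₂ h11 hI
  have hc₂ := hc₁.agree hag₂ (by decide) (by decide)
  obtain ⟨hΔ0, hΔ4, hp⟩ := cand_bounds ht
  refine (Does.seq (τ₁ := 2) (τ₂ := 8 + (4 * n ^ 2 + 2) * 4) ((decodeProg_spec D hc₂ hs₂ h11 ht
    hn).frame (by simp) (by simp)) ?_).mono (by omega) (List.Subset.refl _) (List.Subset.refl _)
    fun _ _ _ h => h
  rintro s₃ hs₃ - ⟨⟨h6, h7, -⟩, hag₃⟩
  have hc₃ := hc₂.agree hag₃ (by decide) (by decide)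
  refine (Does.seq (τ₁ := 1) (τ₂ := 7 + (4 * n ^ 2 + 2) * 4) (shiftedProg_spec D hc₃ hs₃ (by simp)
    hMb (by rw [h7]; omega)) ?_).mono (by omega) (List.Subset.refl _) (List.Subset.refl _)
    fun _ _ _ h => h
  rintro s₄ hs₄ - ⟨f, rfl, hf⟩
  rw [h7] at hf
  have hc₄ := hc₃.setArr (k := 2) (by decide) f
  refine (Does.seq (τ₁ := 1 + (4 * n ^ 2 + 2) * 4) (τ₂ := 6) ((annihilateProg_spec D hc₄ hs₄
    (Δ := candΔ n t) (p := candp n t)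
    (by simpa using h6) (by rw [abs_of_pos hΔ0]; omega) (by simpa using hf) (hB _ hp) (by omega)
    (hA _ _ hΔ0 hΔ4 hp) (hv _ _ hΔ0 hΔ4 hp)).frame (by simp) (by simp)) ?_).mono (by omega)
    (List.Subset.refl _) (List.Subset.refl _) fun _ _ _ h => h
  rintro s₅ hs₅ - ⟨h8, hag₅⟩
  have hc₅ := hc₄.agree hag₅ (by decide) (by decide)
  have g6 : s₅.reg 6 = candΔ n t := by rw [hag₅.reg 6 (by decide)]; simpa using h6
  have g7 : s₅.reg 7 = candp n t := by rw [hag₅.reg 7 (by decide)]; simpa using h7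
  have keep : ∀ x ∈ [14, 15, 16], s₅.reg x = s₂.reg x := by
    intro x hx
    have hx3 : x ∉ [6, 7] := (by decide : ∀ x ∈ [14, 15, 16], x ∉ [6, 7]) x hx
    have hx5 : x ∉ [8] := (by decide : ∀ x ∈ [14, 15, 16], x ∉ [8]) x hx
    rw [hag₅.reg x hx5, Store.setArr_reg, hag₃.reg x hx3]
  refine (keepProg_spec D hc₅ hs₅ g6 hΔ0 (by omega) (by zify at hnN; omega) h8
    (hv _ _ hΔ0 hΔ4 hp _ le_rfl)).mono le_rfl (by simp) (by simp) ?_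
  rintro s₆ - - h
  rw [g7, keep 14 (by simp), keep 15 (by simp), keep 16 (by simp)] at h
  unfold SearchInv
  simp only [Store.setReg_reg, Nat.reduceEqDiff, if_false]
  obtain ⟨k1, k2, k3, k4, k5⟩ | ⟨k1, k2, k3, k4⟩ := h
  · exact Or.inr ⟨k3, t, ht, k4, k5, k1, k2⟩
  · rw [k2, k3, k4]
    obtain ⟨i1, i2⟩ | i := hI
    · refine Or.inl ⟨i1, fun t' ht' => ?_⟩
      obtain h | rfl := Nat.lt_succ_iff_lt_or_eq.1 ht'
      · exact i2 t' h
      · exact k1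
    · exact Or.inr i

theorem SearchInv.iff (hM : M.IsSymm) (hMn : ∀ i j, |M i j| ≤ (n : ℤ))
    (h : SearchInv M a (4 * n ^ 4 * (4 * n ^ 2 + 1)) s) : ConditionB M a ↔ 0 < s.reg 14 := by
  rw [conditionB_iff hM hMn]
  obtain ⟨h1, h2⟩ | ⟨h1, t, ht, -, -, hg⟩ := h
  · refine iff_of_false ?_ (by omega)
    rintro ⟨Δ, p, h0, h4, hp, hg⟩
    obtain ⟨t, ht, rfl, rfl⟩ := exists_cand h0 h4 hp
    exact h2 t ht hg
  · obtain ⟨h3, h4, h5⟩ := cand_bounds ht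
    exact iff_of_true ⟨_, _, h3, h4, h5, hg⟩ (by omega)

end

end Ram

/-! ### Size bounds, initialization and the whole algorithm -/

namespace Ram

open Matrix StateTransfer

variable {n : ℕ}

/-! ### Bounds for the numbers that occur -/

theorem natCast_pow_le (n k : ℕ) : (n : ℤ) ^ k ≤ 2 ^ (k * n) := by
  rw [mul_comm, pow_mul]
  exact pow_le_pow_left₀ (by positivity) (by exact_mod_cast Nat.lt_two_pow_self.le) k

theorem abs_shifted_le (hn : 1 ≤ n) {M : Matrix (Fin n) (Fin n) ℤ} (hM : ∀ i j, |M i j| ≤ (n : ℤ))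
    {p : ℤ} (hp : |p| ≤ 6 * (n : ℤ) ^ 2) (i j : Fin n) : |shifted M p i j| ≤ 8 * (n : ℤ) ^ 2 := by
  have hn1 : (1 : ℤ) ≤ n := by exact_mod_cast hn
  have h1 := hM i j
  rw [abs_le] at h1 hp
  rw [shifted, of_apply, abs_le]
  split_ifs <;> constructor <;> nlinarith

theorem abs_mul_apply_le {n : ℕ} {A B : Matrix (Fin n) (Fin n) ℤ} {c d : ℤ}
    (hA : ∀ i j, |A i j| ≤ c) (hB : ∀ i j, |B i j| ≤ d) (i j : Fin n) :
    |(A * B) i j| ≤ n * (c * d) := by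
  rw [Matrix.mul_apply]
  calc _ ≤ ∑ k, |A i k * B k j| := Finset.abs_sum_le_sum_abs _ _
    _ ≤ ∑ _k : Fin n, c * d := Finset.sum_le_sum fun k _ => by
        rw [abs_mul]
        exact mul_le_mul (hA i k) (hB k j) (abs_nonneg _) ((abs_nonneg _).trans (hA i k))
    _ = n * (c * d) := by simp

theorem abs_sqShifted_le (hn : 1 ≤ n) {B : Matrix (Fin n) (Fin n) ℤ}
    (hB : ∀ i j, |B i j| ≤ 8 * (n : ℤ) ^ 2) {c : ℤ} (hc : |c| ≤ 64 * (n : ℤ) ^ 8) (i j : Fin n) :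
    |sqShifted B c i j| ≤ 128 * (n : ℤ) ^ 8 := by
  have hn1 : (1 : ℤ) ≤ n := by exact_mod_cast hn
  have h1 := abs_mul_apply_le hB hB i j
  have h2 : (n : ℤ) ^ 5 ≤ n ^ 8 := pow_le_pow_right₀ hn1 (by norm_num)
  have h3 : (n : ℤ) * (8 * (n : ℤ) ^ 2 * (8 * (n : ℤ) ^ 2)) = 64 * (n : ℤ) ^ 5 := by ring
  have h4 : |(c • (1 : Matrix (Fin n) (Fin n) ℤ)) i j| ≤ |c| := by
    rw [Matrix.smul_apply, Matrix.one_apply]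
    split_ifs <;> simp
  rw [sqShifted, Matrix.sub_apply]
  refine (abs_sub _ _).trans ?_
  linarith

theorem dotProduct_self_le {v : Fin n → ℤ} {c : ℤ} (hv : ∀ i, |v i| ≤ c) : v ⬝ᵥ v ≤ n * c ^ 2 := by
  calc v ⬝ᵥ v ≤ ∑ _i : Fin n, c ^ 2 := Finset.sum_le_sum fun i _ => by
        rw [← pow_two]; exact sq_le_sq' (abs_le.1 (hv i)).1 (abs_le.1 (hv i)).2
    _ = n * c ^ 2 := by simp

theorem abs_annihilate_le {M : Matrix (Fin n) (Fin n) ℤ} {a : Fin n} {Δ p c : ℤ}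
    {m : ℕ} (hA : ∀ k < m, ∀ i j, |sqShifted (shifted M p) ((k : ℤ) ^ 2 * Δ) i j| ≤ c) :
    ∀ k ≤ m, ∀ i, |annihilate M a Δ p k i| ≤ (n * c) ^ k
  | 0, _, i => by
    rw [annihilate, Pi.single_apply]
    split_ifs <;> simp
  | k + 1, hk, i => by
    have ih := abs_annihilate_le (a := a) hA k (by omega)
    rw [annihilate, mulVec, dotProduct]
    calc _ ≤ ∑ j, |sqShifted (shifted M p) ((k : ℤ) ^ 2 * Δ) i j * annihilate M a Δ p k j| :=
          Finset.abs_sum_le_sum_abs _ _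
      _ ≤ ∑ _j : Fin n, c * (n * c) ^ k := Finset.sum_le_sum fun j _ => by
          have h := hA k hk i j
          rw [abs_mul]
          exact mul_le_mul h (ih j) (abs_nonneg _) ((abs_nonneg _).trans h)
      _ = (n * c) ^ (k + 1) := by simp; ring

/-- A bound for the bits of the essential values. -/
abbrev bitBound (n : ℕ) : ℕ := 100 * n ^ 3

theorem le_two_pow_bitBound {n k m : ℕ} {c : ℤ} (hn : 1 ≤ n) (hc : c ≤ 2 ^ k)
    (h : k + m * n ≤ 100 * n) : c * (n : ℤ) ^ m ≤ 2 ^ bitBound n := by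
  have h3 : n ≤ n ^ 3 := Nat.le_self_pow (by norm_num) n
  calc c * (n : ℤ) ^ m ≤ 2 ^ k * 2 ^ (m * n) :=
        mul_le_mul hc (natCast_pow_le n m) (by positivity) (by positivity)
    _ = 2 ^ (k + m * n) := (pow_add _ _ _).symm
    _ ≤ 2 ^ bitBound n := pow_two_mono (by unfold bitBound; omega)

theorem const_mul_pow_le {n : ℕ} (hn : 1 ≤ n) : 128 * (n : ℤ) ^ 8 ≤ 2 ^ (15 * n) := by
  calc 128 * (n : ℤ) ^ 8 ≤ 2 ^ 7 * 2 ^ (8 * n) :=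
        mul_le_mul (by norm_num) (natCast_pow_le n 8) (by positivity) (by positivity)
    _ = 2 ^ (7 + 8 * n) := (pow_add _ _ _).symm
    _ ≤ 2 ^ (15 * n) := pow_two_mono (by omega)

/-- A row has squared length at most `C = n (128 n⁸)² ≤ 2 ^ (31n)`, and `3n` factors give `2 ^
(93n²)`. -/
theorem fits_of_le (hn : 1 ≤ n) {A B : Matrix (Fin n) (Fin n) ℤ}
    (hA : ∀ i j, |A i j| ≤ 128 * (n : ℤ) ^ 8) (hB : ∀ i j, |B i j| ≤ 8 * (n : ℤ) ^ 2) :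
    Fits (bitBound n) (n * (128 * (n : ℤ) ^ 8) ^ 2) A B := by
  have hn1 : (1 : ℤ) ≤ n := by exact_mod_cast hn
  have h28 : (n : ℤ) ^ 2 ≤ n ^ 8 := pow_le_pow_right₀ hn1 (by norm_num)
  have h8 : (1 : ℤ) ≤ (n : ℤ) ^ 8 := one_le_pow₀ hn1
  have hV : 128 * (n : ℤ) ^ 8 ≤ 2 ^ bitBound n :=
    le_two_pow_bitBound (k := 7) hn (by norm_num) (by omega)
  have hB' : ∀ i j, |B i j| ≤ 128 * (n : ℤ) ^ 8 := fun i j => (hB i j).trans (by linarith)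
  refine ⟨?_, fun i j => (hA i j).trans hV, fun i j => (hB' i j).trans hV,
    fun i => dotProduct_self_le (hA i), fun i => dotProduct_self_le (hB' i), ?_⟩
  · have : (1 : ℤ) ≤ (128 * (n : ℤ) ^ 8) ^ 2 := one_le_pow₀ (by linarith)
    nlinarith
  · have h1 : (n : ℤ) ≤ 2 ^ n := by exact_mod_cast Nat.lt_two_pow_self.le
    calc ((n : ℤ) * (128 * (n : ℤ) ^ 8) ^ 2) ^ (3 * n)
        ≤ (2 ^ n * (2 ^ (15 * n)) ^ 2) ^ (3 * n) := by gcongr; exact const_mul_pow_le hn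
      _ = 2 ^ (93 * n ^ 2) := by rw [← pow_mul, ← pow_add, ← pow_mul]; congr 1; ring
      _ ≤ 2 ^ bitBound n := pow_two_mono (by
          unfold bitBound
          have : n ^ 2 ≤ n ^ 3 := Nat.pow_le_pow_right hn (by norm_num)
          omega)

/-- Each of the at most `5n²` factors contributes `16n` bits. These `80n³` bits are the reason for
the cubic `bitBound`. -/
theorem abs_annihilate_le_two_pow (hn : 1 ≤ n) {M : Matrix (Fin n) (Fin n) ℤ} {a : Fin n} {Δ p : ℤ}
    (hA : ∀ k < 4 * n ^ 2 + 1, ∀ i j,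
      |sqShifted (shifted M p) ((k : ℤ) ^ 2 * Δ) i j| ≤ 128 * (n : ℤ) ^ 8)
    {k : ℕ} (hk : k ≤ 4 * n ^ 2 + 1) (i : Fin n) : |annihilate M a Δ p k i| ≤ 2 ^ bitBound n := by
  have h1 : (n : ℤ) ≤ 2 ^ n := by exact_mod_cast Nat.lt_two_pow_self.le
  have hn2 : 1 ≤ n ^ 2 := Nat.one_le_pow _ _ hn
  have hk5 : k ≤ 5 * n ^ 2 := by omega
  calc |annihilate M a Δ p k i| ≤ (n * (128 * (n : ℤ) ^ 8)) ^ k := abs_annihilate_le hA k hk i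
    _ ≤ (2 ^ n * 2 ^ (15 * n)) ^ k := by gcongr; exact const_mul_pow_le hn
    _ = 2 ^ (16 * n * k) := by rw [← pow_add, ← pow_mul]; congr 1; ring
    _ ≤ 2 ^ bitBound n := pow_two_mono (by unfold bitBound; nlinarith [Nat.mul_le_mul_left n hk5])

/-- The loop bound `4n⁴` is dictated by trial division of the largest `Δ`. -/
theorem dim_bitBound (hn : 1 ≤ n) : Dim n (bitBound n) (200 * bitBound n) (4 * n ^ 4) := by
  have h2 : n ^ 2 ≤ n ^ 4 := Nat.pow_le_pow_right hn (by norm_num)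
  have h1 : n ≤ n ^ 4 := Nat.le_self_pow (by norm_num) n
  refine ⟨hn, ?_, le_rfl, by nlinarith, by omega, ?_⟩
  · have := Nat.one_le_pow 3 n hn
    unfold bitBound; omega
  · have := le_two_pow_bitBound (k := 0) (m := 2) (c := 1) hn (by norm_num) (by omega)
    push_cast
    linarith

/-! ### The input -/

theorem divNat_cell (i j : Fin n) (h : (i : ℕ) * n + j < n * n) :
    (⟨(i : ℕ) * n + j, h⟩ : Fin (n * n)).divNat = i := by
  apply Fin.ext
  simp only [Fin.coe_divNat]
  have := j.2
  exact Nat.div_eq_of_lt_le (by omega) (by rw [add_mul]; omega)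

theorem modNat_cell (i j : Fin n) (h : (i : ℕ) * n + j < n * n) :
    (⟨(i : ℕ) * n + j, h⟩ : Fin (n * n)).modNat = j := by
  apply Fin.ext
  simp only [Fin.coe_modNat]
  rw [Nat.mul_add_mod', Nat.mod_eq_of_lt j.2]

theorem encodeInput_eq (M : Matrix (Fin n) (Fin n) ℤ) (a : Fin n) :
    encodeInput M a = (n : ℤ) :: ((a : ℕ) : ℤ) :: List.ofFn fun k : Fin (n * n) =>
      M k.divNat k.modNat := by
  simp only [encodeInput, List.ofFn_mul, divNat_cell, modNat_cell]

theorem initial_bdd {l : List ℤ} {L : ℕ} (h : ∀ z ∈ l, |z| ≤ 2 ^ L) (hl : (l.length : ℤ) ≤ 2 ^ L) :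
    (initial l).Bdd L := by
  refine ⟨fun x => ?_, fun k i => ?_⟩
  · simp only [initial, Function.update_apply]
    split_ifs
    · simpa using hl
    · simp
  · simp only [initial, Function.update_apply]
    split_ifs
    · beta_reduce
      split_ifs
      swap
      · simp
      rw [List.getD_eq_getElem?_getD]
      rcases h' : l[i.toNat]? with _ | z
      · simp
      · simpa using h z (List.mem_of_getElem? h')
    · simp

/-- Prepare the registers that keep their contents. -/
def initProg : Prog :=
  .set 2 (.read 0 (.const 0)) ;; .set 3 (.reg 2 *ₑ .reg 2) ;; .set 4 (.const 1) ;;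
    .set 5 (.read 0 (.const 1)) ;; .set 24 (.const 2 *ₑ .reg 2) ;;
    .set 25 (.const 4 *ₑ .reg 3 +ₑ .const 1) ;; .set 26 (.const 4 *ₑ .reg 3 *ₑ .reg 3 *ₑ .reg 25) ;;
    .set 27 (.const 8 *ₑ .reg 3 +ₑ .const 1)

/-- Decide the condition and, if it holds, compute the eigenvalues and the bases. -/
def decisionProg : Prog :=
  initProg ;; searchProg ;;
    .ifPos (.reg 14) (.set 6 (.reg 15) ;; spectralProg) (.set 1 (.const 1))

theorem Does.setTo {N L : ℕ} {s : Store} {R K : List ℕ} {b : ℕ} (hL : 3 ≤ L) (hbL : b ≤ L)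
    (hs : s.Bdd L) {x : ℕ} {e : Expr} {v : ℤ} (hv : e.eval s = v) (he : e.SmallConsts)
    (hw : e.weight ≤ 100) (hx : x ∈ R) (h0 : 0 ≤ v) (hvb : v ≤ 2 ^ b) :
    Does N L (.set x e) s 1 R K fun s' => s' = s.setReg x v := by
  subst hv
  exact Does.set hL hs he hw hx (by rw [abs_of_nonneg h0]; exact hvb.trans (pow_two_mono hbL))

section
variable {M : Matrix (Fin n) (Fin n) ℤ} {a : Fin n}

theorem initial_encodeInput_arr (c : ℕ) :
    (initial (encodeInput M a)).arr 0 c = (encodeInput M a).getD c 0 := by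
  simp [initial]

theorem initial_encodeInput_entry (i j : Fin n) :
    (initial (encodeInput M a)).arr 0 (2 + ((i : ℕ) * n + (j : ℕ))) = M i j := by
  have hlt := cell_lt i j
  have h := initial_encodeInput_arr (M := M) (a := a) (((i : ℕ) * n + j) + 2)
  have e : ((((i : ℕ) * n + j) + 2 : ℕ) : ℤ) = 2 + ((i : ℕ) * n + (j : ℕ)) := by push_cast; ring
  rw [e] at h
  rw [h, encodeInput_eq, List.getD_cons_succ, List.getD_cons_succ,
    List.getD_eq_getElem _ _ (by simpa using hlt), List.getElem_ofFn]
  rw [divNat_cell, modNat_cell]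

theorem initial_encodeInput_bdd (hn : 1 ≤ n) (hM : ∀ i j, |M i j| ≤ (n : ℤ)) :
    (initial (encodeInput M a)).Bdd (200 * bitBound n) := by
  have hpow : (2 : ℤ) ^ bitBound n ≤ 2 ^ (200 * bitBound n) := pow_two_mono (by omega)
  have hn1 : (1 : ℤ) ≤ n := by exact_mod_cast hn
  have h2 : 3 * (n : ℤ) ^ 2 ≤ 2 ^ bitBound n :=
    le_two_pow_bitBound (k := 2) hn (by norm_num) (by omega)
  have h1 : (n : ℤ) ≤ 2 ^ (200 * bitBound n) := by nlinarith
  refine initial_bdd (fun z hz => ?_) ?_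
  · rw [encodeInput_eq, List.mem_cons, List.mem_cons, List.mem_ofFn] at hz
    obtain rfl | rfl | ⟨k, rfl⟩ := hz
    · simpa using h1
    · have := a.2
      rw [abs_of_nonneg (by positivity)]; omega
    · exact (hM _ _).trans h1
  · rw [encodeInput_eq, List.length_cons, List.length_cons, List.length_ofFn]
    push_cast
    nlinarith

theorem initProg_spec (hn : 1 ≤ n) {N : ℕ} (hM : ∀ i j, |M i j| ≤ (n : ℤ)) :
    Does N (200 * bitBound n) initProg (initial (encodeInput M a)) 8
      [2, 3, 4, 5, 24, 25, 26, 27] [] (Ctx M a) := by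
  have hb3 := (dim_bitBound hn).three_le
  have hn1 : (1 : ℤ) ≤ n := by exact_mod_cast hn
  have hn2 : (n : ℤ) ≤ n ^ 2 := by nlinarith
  have hn3 : (n : ℤ) ^ 2 ≤ n ^ 6 := pow_le_pow_right₀ hn1 (by norm_num)
  have hn4 : (n : ℤ) ^ 4 ≤ n ^ 6 := pow_le_pow_right₀ hn1 (by norm_num)
  have h6 : 32 * (n : ℤ) ^ 6 ≤ 2 ^ bitBound n :=
    le_two_pow_bitBound (k := 5) hn (by norm_num) (by omega)
  have hs := initial_encodeInput_bdd (a := a) hn hM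
  have e0 : (initial (encodeInput M a)).arr 0 0 = n := initial_encodeInput_arr 0
  have e1 : (initial (encodeInput M a)).arr 0 1 = (a : ℕ) := initial_encodeInput_arr 1
  have hent := initial_encodeInput_entry (M := M) (a := a)
  have hreg : ∀ x, x ≠ 0 → (initial (encodeInput M a)).reg x = 0 := fun x hx => by
    simp [initial, hx]
  generalize initial (encodeInput M a) = s at *
  have hbL : bitBound n ≤ 200 * bitBound n := by omega
  have hL3 : 3 ≤ 200 * bitBound n := by omega
  have ha := a.2
  refine Does.seq (τ₁ := 1) (τ₂ := 7) (Does.setTo hL3 hbL hs (v := n) (by simp [Expr.eval, e0])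
    (by simp [Expr.SmallConsts]) (by decide) (by simp) (by positivity) (by linarith)) ?_
  rintro s₁ hs₁ - rfl
  refine Does.seq (τ₁ := 1) (τ₂ := 6) (Does.setTo hL3 hbL hs₁ (v := n ^ 2)
    (by simp [Expr.eval]; ring)
    (by simp [Expr.SmallConsts]) (by decide) (by simp) (by positivity) (by linarith)) ?_
  rintro s₂ hs₂ - rfl
  refine Does.seq (τ₁ := 1) (τ₂ := 5) (Does.setTo hL3 hbL hs₂ (v := 1) (by simp [Expr.eval])
    (by simp [Expr.SmallConsts]) (by decide) (by simp) (by positivity) (by linarith)) ?_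
  rintro s₃ hs₃ - rfl
  refine Does.seq (τ₁ := 1) (τ₂ := 4) (Does.setTo hL3 hbL hs₃ (v := (a : ℕ))
    (by simp [Expr.eval, e1])
    (by simp [Expr.SmallConsts]) (by decide) (by simp) (by positivity) (by linarith)) ?_
  rintro s₄ hs₄ - rfl
  refine Does.seq (τ₁ := 1) (τ₂ := 3) (Does.setTo hL3 hbL hs₄ (v := 2 * n) (by simp [Expr.eval])
    (by simp [Expr.SmallConsts]) (by decide) (by simp) (by positivity) (by linarith)) ?_
  rintro s₅ hs₅ - rfl
  refine Does.seq (τ₁ := 1) (τ₂ := 2) (Does.setTo hL3 hbL hs₅ (v := 4 * n ^ 2 + 1)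
    (by simp [Expr.eval])
    (by simp [Expr.SmallConsts]) (by decide) (by simp) (by positivity) (by linarith)) ?_
  rintro s₆ hs₆ - rfl
  refine Does.seq (τ₁ := 1) (τ₂ := 1) (Does.setTo hL3 hbL hs₆ (v := 4 * n ^ 4 * (4 * n ^ 2 + 1))
    (by simp only [Expr.eval, Store.setReg_reg, Nat.reduceEqDiff, if_true, if_false]; ring)
    (by simp [Expr.SmallConsts]) (by decide) (by simp) (by positivity) (by nlinarith)) ?_
  rintro s₇ hs₇ - rfl
  refine (Does.setTo hL3 hbL hs₇ (v := 8 * n ^ 2 + 1) (by simp [Expr.eval])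
    (by simp [Expr.SmallConsts]) (by decide) (by simp) (by positivity) (by linarith)).mono le_rfl
    (List.Subset.refl _) (List.Subset.refl _) ?_
  rintro s₈ - - rfl
  constructor <;> simp [hreg, hent]
  ring

/-- The number of units of time that the decision takes. -/
def decisionUnits (n : ℕ) : ℕ :=
  8 + ((1 + (4 * n ^ 4 * (4 * n ^ 2 + 1) + 1) * (11 + (4 * n ^ 2 + 2) * 4)) +
    (1 + (6 + (8 * n ^ 2 + 2) * (16 + (n + 1) * 29)) + 1))

theorem decisionProg_spec (hn : 1 ≤ n) (hM : M.IsSymm) (hMn : ∀ i j, |M i j| ≤ (n : ℤ)) :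
    ∃ s', Run decisionProg (initial (encodeInput M a))
        (decisionUnits n * timeUnit (4 * n ^ 4) (200 * bitBound n)) s' ∧
      (¬ ConditionB M a → output s' = [0]) ∧
      (ConditionB M a → ∃ D : SpectralData n, D.Correct M a ∧ output s' = 1 :: D.encode ∧
        (output s').length ≤ 4 + (8 * n ^ 2 + 1) * (2 + 2 * n * n)) := by
  have D := dim_bitBound hn
  have hb3 := D.three_le
  have hL3 : 3 ≤ 200 * bitBound n := by omega
  have hn1 : (1 : ℤ) ≤ n := by exact_mod_cast hn
  have hn20 : (0 : ℤ) ≤ (n : ℤ) ^ 2 := by positivity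
  have hn4 : (1 : ℤ) ≤ (n : ℤ) ^ 4 := one_le_pow₀ hn1
  have hn24 : (n : ℤ) ^ 2 ≤ n ^ 4 := pow_le_pow_right₀ hn1 (by norm_num)
  have hn28 : (n : ℤ) ^ 2 ≤ n ^ 8 := pow_le_pow_right₀ hn1 (by norm_num)
  have h128 : 128 * (n : ℤ) ^ 8 ≤ 2 ^ bitBound n :=
    le_two_pow_bitBound (k := 7) hn (by norm_num) (by omega)
  have h64 : 64 * (n : ℤ) ^ 4 ≤ 2 ^ bitBound n :=
    le_two_pow_bitBound (k := 6) hn (by norm_num) (by omega)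
  have hsq : ∀ Δ p q : ℤ, 0 < Δ → Δ ≤ 4 * (n : ℤ) ^ 4 → |p| ≤ 6 * (n : ℤ) ^ 2 →
      |q| ≤ 4 * (n : ℤ) ^ 2 → ∀ i j, |sqShifted (shifted M p) (q ^ 2 * Δ) i j| ≤
        128 * (n : ℤ) ^ 8 := by
    intro Δ p q h0 h4 hp hq
    refine abs_sqShifted_le hn (abs_shifted_le hn hMn hp) ?_
    rw [abs_mul, abs_of_pos h0, abs_pow]
    calc |q| ^ 2 * Δ ≤ (4 * (n : ℤ) ^ 2) ^ 2 * (4 * (n : ℤ) ^ 4) := by gcongr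
      _ = 64 * (n : ℤ) ^ 8 := by ring
  have hk4 : ∀ {k : ℕ}, k ≤ 4 * n ^ 2 → |(k : ℤ)| ≤ 4 * (n : ℤ) ^ 2 := fun {k} hk => by
    rw [abs_of_nonneg (by positivity)]; exact_mod_cast hk
  have h1L : (1 : ℤ) ≤ 2 ^ (200 * bitBound n) := one_le_pow₀ (by norm_num)
  -- In the negative case only the output length is set; the answer `0` is the untouched initial
  -- content of this cell.
  have ha1 : (initial (encodeInput M a)).arr 1 0 = 0 := by simp [initial]
  suffices h : Does (4 * n ^ 4) (200 * bitBound n) decisionProg (initial (encodeInput M a))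
      (decisionUnits n) (List.range 30) (List.range 12) fun s' =>
      (¬ ConditionB M a → output s' = [0]) ∧
      (ConditionB M a → ∃ D : SpectralData n, D.Correct M a ∧ output s' = 1 :: D.encode ∧
        (output s').length ≤ 4 + (8 * n ^ 2 + 1) * (2 + 2 * n * n)) by
    obtain ⟨s', h1, -, -, h2⟩ := h
    exact ⟨s', h1, h2⟩
  refine Does.seq ((initProg_spec hn hMn).frame (by decide) (by decide)) ?_
  rintro s₁ hs₁ - ⟨hc₁, hag₁⟩
  refine Does.seq ((searchProg_spec D hc₁ hs₁ (fun i j => (hMn i j).trans (by nlinarith))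
    (by linarith) le_rfl
    (fun p hp i j => (abs_shifted_le hn hMn (hp.trans (by linarith)) i j).trans (by linarith))
    (fun Δ p h0 h4 hp k hk i j => (hsq Δ p k h0 h4 (hp.trans (by linarith)) (hk4 hk) i j).trans h128)
    (fun Δ p h0 h4 hp k hk i => abs_annihilate_le_two_pow hn (fun k' hk' => hsq Δ p k' h0 h4
      (hp.trans (by linarith)) (hk4 (by omega))) hk i)).frame (by decide) (by decide)) ?_
  rintro s₂ hs₂ - ⟨hI, hag₂⟩
  have hc₂ := hc₁.agree hag₂ (by decide) (by decide)
  have hiff := hI.iff hM hMn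
  refine Does.ifPos hL3 hs₂ (by simp [Expr.SmallConsts]) (by decide) (fun h => ?_) (fun h => ?_)
  · obtain ⟨h14, -⟩ | ⟨-, t, ht, h15, h16, hg⟩ := hI
    · exact absurd h (by simp [Expr.eval, h14])
    obtain ⟨h0, h4, hp⟩ := cand_bounds ht
    refine Does.seq (τ₁ := 1) (Does.set hL3 hs₂ (by simp [Expr.SmallConsts]) (by decide) (by decide)
      (by simpa [Expr.eval] using hs₂.reg 15)) ?_
    rintro s₃ hs₃ hag₃ rfl
    have hc₃ : Ctx M a (s₂.setReg 6 (s₂.reg 15)) :=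
      hc₂.agree (R := [6]) (K := []) ⟨fun x hx => by simp_all, fun _ _ => rfl⟩ (by decide)
        (by decide)
    refine (spectralProg_spec D hc₃ hs₃ hM hMn h0 hg (by simp [h15]) (by simp [h16]) hp
      (fun p' q' hp' hq' => fits_of_le hn (by rw [← pow_two]; exact hsq _ p' q' h0 h4 hp' hq')
        (abs_shifted_le hn hMn hp')) (by linarith) (by nlinarith)).mono le_rfl (by decide)
      (by decide) ?_
    rintro s₄ - - h'
    exact ⟨fun hn => absurd (hiff.2 h) hn, fun _ => h'⟩
  · refine (Does.set hL3 hs₂ (by simp [Expr.SmallConsts]) (by decide) (by decide)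
      (by simpa [Expr.eval] using h1L)).mono (by omega) (List.Subset.refl _)
      (List.Subset.refl _) ?_
    rintro s₃ - - rfl
    have hnot : ¬ ConditionB M a := fun h' => absurd (hiff.1 h') (by simpa [Expr.eval] using h)
    refine ⟨fun _ => ?_, fun h' => absurd h' hnot⟩
    have : s₂.arr 1 0 = 0 := by rw [hag₂.arr 1 (by decide), hag₁.arr 1 (by decide), ha1]
    simp [output_eq_map, Expr.eval, this]

end

end Ram

open Polynomial in
/-- A bound for the running time of the decision. -/
noncomputable def Ram.decisionTime : Polynomial ℕ :=
  (8 + ((1 + (4 * X ^ 4 * (4 * X ^ 2 + 1) + 1) * (11 + (4 * X ^ 2 + 2) * 4)) +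
    (1 + (6 + (8 * X ^ 2 + 2) * (16 + (X + 1) * 29)) + 1))) *
    ((4 * X ^ 4 + 1) * ((4 * X ^ 4 + 1) * (400 * (200 * (100 * X ^ 3) + 3)))) +
    (4 + (8 * X ^ 2 + 1) * (2 + 2 * X * X))

theorem Ram.eval_decisionTime (n : ℕ) : Ram.decisionTime.eval n =
    Ram.decisionUnits n * Ram.timeUnit (4 * n ^ 4) (200 * Ram.bitBound n) +
      (4 + (8 * n ^ 2 + 1) * (2 + 2 * n * n)) := by
  simp [Ram.decisionTime, Ram.decisionUnits, Ram.timeUnit, Ram.bitBound]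

/-- One program, running in time polynomial in `n`, decides the condition (first output cell `1` or
`0`) and, if it holds, also outputs the eigenvalues in the support of `a` and bases of their
eigenspaces. -/
theorem mainTheorem4 :
    ∃ (c : Ram.Prog) (T : Polynomial ℕ),
      ∀ (n : ℕ) (M : Matrix (Fin n) (Fin n) ℤ) (a : Fin n),
        M.IsSymm → (∀ i j, |M i j| ≤ (n : ℤ)) →
          (¬ StateTransfer.ConditionB M a →
            Ram.ComputesInTime c (StateTransfer.encodeInput M a) [0] (T.eval n)) ∧
          (StateTransfer.ConditionB M a →
            ∃ D : StateTransfer.SpectralData n, D.Correct M a ∧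
              Ram.ComputesInTime c (StateTransfer.encodeInput M a) (1 :: D.encode) (T.eval n)) := by
  refine ⟨Ram.decisionProg, Ram.decisionTime, fun n M a hM hMn => ?_⟩
  -- The existence of the column `a` gives `n ≥ 1`.
  obtain ⟨s, ⟨t, hrun, ht⟩, h1, h2⟩ := Ram.decisionProg_spec (a := a) a.pos hM hMn
  rw [Ram.eval_decisionTime]
  refine ⟨fun h => ⟨t, s, hrun, h1 h, ?_⟩, fun h => ?_⟩
  · rw [List.length_singleton]; omega
  · obtain ⟨D, hD, ho, hl⟩ := h2 h
    refine ⟨D, hD, t, s, hrun, ho, ?_⟩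
    rw [← ho]; omega
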